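/- Let $n\ge 2$. For measurable $f:\mathbb R^n\to\mathbb C$ and $p,\tilde p\in[1,\infty)$ write $$\|f\|_{L^pL^{\tilde p}}=\Big(\int_0^\infty \|f(\rho\,\cdot)\|_{L^{\tilde p}(\mathbb S^{n-1})}^{p}\,\rho^{n-1}\,d\rho\Big)^{1/p},$$ and let $|D|^\sigma=(-\Delta_{\mathbb R^n})^{\sigma/2}$ be the Fourier multiplier with symbol $|\xi|^\sigma$ (for the Fourier transform $\hat u(\xi)=\int e^{-ix\cdot\xi}u(x)\,dx$). Let $r,\tilde r,p,\tilde p,q,\tilde q\in[1,\infty)$, $0<a\le 1$, $0<\sigma<n$ and $\alpha,\beta,\gamma\in\mathbb R$ satisfy $$\gamma<\frac nr,\qquad \beta<\frac nq,\qquad \frac np-n<\alpha<\frac np-\sigma$$ and the scaling condition $$\gamma-\frac nr=a\Big(\alpha+\sigma-\frac np\Big)+(1-a)\Big(\beta-\frac nq\Big).$$ Define $$\Delta=a\sigma+n\Big(\frac1r-\frac{1-a}{q}-\frac ap\Big),\qquad \tilde\Delta=a\sigma+n\Big(\frac1{\tilde r}-\frac{1-a}{\tilde q}-\frac a{\tilde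 p}\Big).$$ Assume that one of the following holds: (A) $\Delta+(n-1)\tilde\Delta\ge 0$, $\;p>1$, $\;a(\sigma-\frac np)<\Delta\le a\sigma$ and $a(\sigma-\frac n{\tilde p})\le\tilde\Delta\le a\sigma$; (B) $\Delta+(n-1)\tilde\Delta>0$, $\;p\ge1$, $\;a(\sigma-\frac np)\le\Delta\le a\sigma$ and $a(\sigma-\frac n{\tilde p})\le\tilde\Delta\le a\sigma$. Exclude the endpoint at which all four of the equalities $\Delta+(n-1)\tilde\Delta=0$, $\Delta=a\sigma$, $\tilde p=1$ and $\frac1{\tilde r}=1-\frac{\sigma}{n-1}$ hold. Then there is a constant $C<\infty$, depending only on $n$ and the parameters $r,\tilde r,p,\tilde p,q,\tilde q,a,\sigma,\alpha,\beta,\gamma$, such that for every complex-valued Schwartz function $u$ on $\mathbb R^n$ $$\big\||x|^{-\gamma}u\big\|_{L^rL^{\tilde r}}\le C\,\big\||x|^{-\alpha}|D|^\sigma u\big\|_{L^pL^{\tilde p}}^{a}\,\big\||x|^{-\beta}u\big\|_{L^qL^{\tilde q}}^{1-a}.$$ -/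

import Mathlib

open MeasureTheory Set
open scoped NNReal ENNReal FourierTransform SchwartzMap

/-- The mixed radial-angular norm
`(∫₀^∞ ‖f(ρ ·)‖_{L^{pt}(S^{n-1})}^p ρ^{n-1} dρ)^{1/p}`, with values in `[0, ∞]`.
Here `volume.toSphere` is the surface measure of the unit sphere and
`Measure.volumeIoiPow (n - 1)` is the measure `ρ^{n-1} dρ` on `(0, ∞)`. -/
noncomputable def mixedNorm {n : ℕ} (p pt : ℝ≥0∞) (f : EuclideanSpace ℝ (Fin n) → ℂ) : ℝ≥0∞ :=
  eLpNorm
    (fun ρ : Ioi (0 : ℝ) =>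
      eLpNorm (fun θ : Metric.sphere (0 : EuclideanSpace ℝ (Fin n)) 1 =>
        f ((ρ : ℝ) • (θ : EuclideanSpace ℝ (Fin n)))) pt
        (volume : Measure (EuclideanSpace ℝ (Fin n))).toSphere)
    p (Measure.volumeIoiPow (n - 1))

/-- The function `x ↦ |x|^s f(x)`. -/
noncomputable def powWeight {n : ℕ} (s : ℝ) (f : EuclideanSpace ℝ (Fin n) → ℂ) :
    EuclideanSpace ℝ (Fin n) → ℂ :=
  fun x => ((‖x‖ ^ s : ℝ) : ℂ) * f x

/-- The fractional derivative `|D|^σ = (-Δ)^{σ/2}`, that is the Fourier multiplier with symbol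
`(2π|ξ|)^σ` for the normalization `𝓕 u ξ = ∫ exp(-2πi⟨x, ξ⟩) u(x) dx`. -/
noncomputable def fracDeriv {n : ℕ} (σ : ℝ) (u : EuclideanSpace ℝ (Fin n) → ℂ) :
    EuclideanSpace ℝ (Fin n) → ℂ :=
  𝓕⁻ (fun ξ : EuclideanSpace ℝ (Fin n) => (((2 * Real.pi * ‖ξ‖) ^ σ : ℝ) : ℂ) * 𝓕 u ξ)

/-!
A weighted interpolation inequality between mixed radial-angular norms of a function and of its
fractional derivative.

In logarithmic polar coordinates `x = e^t θ` all three norms become mixed Lebesgue norms on the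
cylinder `ℝ × S^{n-1}`, with exponential weights in `t`. The subordination formula
`fracDeriv_subordination` bounds `u` by the Riesz potential of `f = |D|^σ u`. After multiplication
with the weights the Riesz kernel is dominated by `d^{-l}` times a factor which decays along the
axis, where `d` is the product distance on the cylinder and `l = n - σ`; this uses that both
`n / p - α - σ` and `n - (n / p - α)` are positive, which is the condition on `α`. The scaling
condition makes the weights of the three norms match. What remains
(`exists_lpn_lpn_interpolation`) is an inequality for potentials on `ℝ × S`, where `S` carries
a measure whose balls have measure comparable with `r^N`, `N = n - 1`. It is reduced to one on the
slices `{t} × S` by Hölder's inequality along the axis (`exists_slice_interpolation`).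

With `1 / s`, `1 / s̃` defined by `1 / r = a / s + (1 - a) / q` and
`1 / r̃ = a / s̃ + (1 - a) / q̃`, the number `Δ + (n - 1) Δ̃` is a positive multiple of
`N (1 + 1 / s̃ - 1 / p̃) + (1 + 1 / s - 1 / p) - l`.

* If it is positive, the singularity has room to spare and Young's inequality on the slices and on
  the axis suffices (`exists_slice_bound_of_lt`).
* If it vanishes and `p < s`, Young's inequality on the slices leaves a Hardy–Littlewood–Sobolev
  kernel on the axis (`exists_slice_bound_of_eq`).
* If it vanishes and `p = s`, nothing is gained along the axis. For `1 < p̃ < s̃ < ∞` the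
  potential is bounded by Hedberg's argument with a maximal function on the cylinder, whose
  mixed-norm bounds follow from the weighted inequality of Fefferman and Stein, and by duality
  (`exists_lpn_cylPot_le`). For `p̃ = 1` there is a weak-type bound on each slice
  (`exists_measure_cylPot_lt_le`), which interpolates with the `L^{q̃}` norm unless `s̃ = r̃`:
  this is the excluded endpoint. For `s̃ = ∞` the potential just fails to be bounded, and the
  function is compared with its averages over balls in the slice; here the increments of `u`, and
  not only its size, have to be controlled by the potential (`SliceDiffBound`,
  `exists_lpn_slice_le_maxFun_rpow`).

When the number vanishes, a maximal theorem on the axis enters every one of these estimates, which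
is why `p > 1` is needed there.
-/

/-! ### Lebesgue norms indexed by the reciprocal exponent -/

/-- The `L^{1/θ}` norm of an `ℝ≥0∞`-valued function. Indexing by the reciprocal `θ` of the exponent
keeps Hölder and Young relations linear; every `θ ≤ 0` stands for the exponent `∞`. -/
noncomputable def lpn {X : Type*} [MeasurableSpace X] (θ : ℝ) (μ : Measure X) (f : X → ℝ≥0∞) :
    ℝ≥0∞ :=
  if 0 < θ then (∫⁻ x, f x ^ θ⁻¹ ∂μ) ^ θ else essSup f μ

section lpn

variable {X Y : Type*} [MeasurableSpace X] [MeasurableSpace Y] {μ : Measure X} {ν : Measure Y}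

theorem lpn_of_pos {θ : ℝ} (h : 0 < θ) (f : X → ℝ≥0∞) :
    lpn θ μ f = (∫⁻ x, f x ^ θ⁻¹ ∂μ) ^ θ := if_pos h

theorem lpn_zero (f : X → ℝ≥0∞) : lpn 0 μ f = essSup f μ := if_neg (lt_irrefl _)

theorem lpn_one (f : X → ℝ≥0∞) : lpn 1 μ f = ∫⁻ x, f x ∂μ := by
  simp [lpn_of_pos one_pos]

theorem lpn_rpow_inv {θ : ℝ} (h : 0 < θ) (f : X → ℝ≥0∞) :
    lpn θ μ f ^ θ⁻¹ = ∫⁻ x, f x ^ θ⁻¹ ∂μ := by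
  rw [lpn_of_pos h, ENNReal.rpow_rpow_inv h.ne']

theorem lpn_le_iff {θ : ℝ} (h : 0 < θ) {f : X → ℝ≥0∞} {A : ℝ≥0∞} :
    lpn θ μ f ≤ A ↔ ∫⁻ x, f x ^ θ⁻¹ ∂μ ≤ A ^ θ⁻¹ := by
  rw [← lpn_rpow_inv h, ENNReal.rpow_le_rpow_iff (inv_pos.2 h)]

theorem lpn_mono_ae {θ : ℝ} {f g : X → ℝ≥0∞} (h : f ≤ᵐ[μ] g) : lpn θ μ f ≤ lpn θ μ g := by
  unfold lpn
  split_ifs with hθ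
  · refine ENNReal.rpow_le_rpow (lintegral_mono_ae ?_) hθ.le
    filter_upwards [h] with x hx using ENNReal.rpow_le_rpow hx (inv_nonneg.2 hθ.le)
  · exact essSup_mono_ae h

theorem lpn_mono {θ : ℝ} {f g : X → ℝ≥0∞} (h : ∀ x, f x ≤ g x) : lpn θ μ f ≤ lpn θ μ g :=
  lpn_mono_ae (Filter.Eventually.of_forall h)

theorem lpn_le_of_forall_le {f : X → ℝ≥0∞} {A : ℝ≥0∞} (h : ∀ x, f x ≤ A) : lpn 0 μ f ≤ A := by
  rw [lpn_zero]
  exact essSup_le_of_ae_le _ (Filter.Eventually.of_forall h)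

theorem lpn_const_mul (θ : ℝ) {c : ℝ≥0∞} (hc : c ≠ ∞) (f : X → ℝ≥0∞) :
    lpn θ μ (fun x => c * f x) = c * lpn θ μ f := by
  unfold lpn
  split_ifs with hθ
  · have h0 : (0 : ℝ) ≤ θ⁻¹ := inv_nonneg.2 hθ.le
    simp_rw [ENNReal.mul_rpow_of_nonneg _ _ h0]
    rw [lintegral_const_mul' _ _ (ENNReal.rpow_ne_top_of_nonneg h0 hc),
      ENNReal.mul_rpow_of_nonneg _ _ hθ.le, ENNReal.rpow_inv_rpow hθ.ne']
  · exact ENNReal.essSup_const_mul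

theorem lpn_const_mul' (θ : ℝ) (c : ℝ≥0∞) {f : X → ℝ≥0∞} (hf : Measurable f) :
    lpn θ μ (fun x => c * f x) = c * lpn θ μ f := by
  unfold lpn
  split_ifs with hθ
  · simp_rw [ENNReal.mul_rpow_of_nonneg _ _ (inv_nonneg.2 hθ.le)]
    rw [lintegral_const_mul _ (hf.pow_const _), ENNReal.mul_rpow_of_nonneg _ _ hθ.le,
      ENNReal.rpow_inv_rpow hθ.ne']
  · exact ENNReal.essSup_const_mul

theorem lpn_add_le {θ : ℝ} (h1 : θ ≤ 1) {f g : X → ℝ≥0∞} (hf : Measurable f) (hg : Measurable g) :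
    lpn θ μ (fun x => f x + g x) ≤ lpn θ μ f + lpn θ μ g := by
  unfold lpn
  split_ifs with hθ
  · have := ENNReal.lintegral_Lp_add_le (μ := μ) hf.aemeasurable hg.aemeasurable
      ((one_le_inv₀ hθ).2 h1)
    simpa using this
  · exact ENNReal.essSup_add_le f g

theorem lpn_rpow {θ b : ℝ} (hθ : 0 < θ) (hb : 0 < b) (f : X → ℝ≥0∞) :
    lpn θ μ (fun x => f x ^ b) = lpn (θ / b) μ f ^ b := by
  rw [lpn_of_pos hθ, lpn_of_pos (div_pos hθ hb), ← ENNReal.rpow_mul, div_mul_cancel₀ _ hb.ne']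
  simp_rw [← ENNReal.rpow_mul]
  congr 3
  ext x
  congr 1
  field_simp

theorem lpn_eq_zero {θ : ℝ} (hθ : 0 < θ) {f : X → ℝ≥0∞} (hf : Measurable f)
    (h : lpn θ μ f = 0) : f =ᵐ[μ] 0 := by
  rw [lpn_of_pos hθ, ENNReal.rpow_eq_zero_iff_of_pos hθ] at h
  rw [lintegral_eq_zero_iff (hf.pow_const _)] at h
  filter_upwards [h] with x hx
  simpa [hθ, hθ.not_gt] using hx

theorem lpn_congr_ae {θ : ℝ} {f g : X → ℝ≥0∞} (h : f =ᵐ[μ] g) : lpn θ μ f = lpn θ μ g :=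
  le_antisymm (lpn_mono_ae h.le) (lpn_mono_ae h.symm.le)

theorem lpn_of_ae_zero {θ : ℝ} {f : X → ℝ≥0∞} (h : f =ᵐ[μ] 0) : lpn θ μ f = 0 := by
  rw [lpn_congr_ae h]
  unfold lpn
  split_ifs with hθ
  · simp [hθ]
  · simp

/-- The interpolated Hölder inequality
`‖f^a g^{1-a}‖_{θ} ≤ ‖f‖_{θ₁}^a ‖g‖_{θ₂}^{1-a}` with `θ = a θ₁ + (1 - a) θ₂`. -/
theorem lpn_rpow_mul_rpow_le {a θ₁ θ₂ : ℝ} (ha0 : 0 < a) (ha1 : a ≤ 1) (h1 : 0 ≤ θ₁)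
    (h2 : 0 < θ₂) {f g : X → ℝ≥0∞} (hf : Measurable f) (hg : Measurable g)
    (hθ : 0 < a * θ₁ + (1 - a) * θ₂) :
    lpn (a * θ₁ + (1 - a) * θ₂) μ (fun x => f x ^ a * g x ^ (1 - a)) ≤
      lpn θ₁ μ f ^ a * lpn θ₂ μ g ^ (1 - a) := by
  set θ := a * θ₁ + (1 - a) * θ₂ with hθdef
  have ha' : 0 ≤ 1 - a := by linarith
  rw [lpn_of_pos hθ, lpn_of_pos h2]
  rcases h1.eq_or_lt with h1 | h1
  · subst h1
    have hθ' : θ = (1 - a) * θ₂ := by rw [hθdef]; ring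
    have ha2 : 0 < 1 - a := by
      rcases ha'.eq_or_lt with h | h
      · rw [hθ', ← h] at hθ; simp at hθ
      · exact h
    -- with `θ₁ = 0` the factor `f ^ a` is replaced by its essential supremum
    rw [lpn_zero]
    have key : ∫⁻ x, (f x ^ a * g x ^ (1 - a)) ^ θ⁻¹ ∂μ ≤
        ∫⁻ x, (essSup f μ) ^ (a * θ⁻¹) * g x ^ θ₂⁻¹ ∂μ := by
      refine lintegral_mono_ae ?_
      filter_upwards [ENNReal.ae_le_essSup f] with x hx
      rw [ENNReal.mul_rpow_of_nonneg _ _ (inv_nonneg.2 hθ.le), ← ENNReal.rpow_mul,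
        ← ENNReal.rpow_mul]
      have : (1 - a) * θ⁻¹ = θ₂⁻¹ := by rw [hθ']; field_simp
      rw [this]
      gcongr
    refine (ENNReal.rpow_le_rpow key hθ.le).trans ?_
    rw [lintegral_const_mul _ (hg.pow_const _), ENNReal.mul_rpow_of_nonneg _ _ hθ.le,
      ← ENNReal.rpow_mul, ← ENNReal.rpow_mul]
    have e1 : a * θ⁻¹ * θ = a := by field_simp
    have e2 : θ = θ₂ * (1 - a) := by rw [hθ']; ring
    rw [e1, ← e2]
  · rw [lpn_of_pos h1]
    have key := ENNReal.lintegral_mul_norm_pow_le (μ := μ) (hf.pow_const θ₁⁻¹).aemeasurable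
      (hg.pow_const θ₂⁻¹).aemeasurable (p := a * θ₁ / θ) (q := (1 - a) * θ₂ / θ)
      (by positivity) (by positivity) (by rw [← add_div, ← hθdef, div_self hθ.ne'])
    have e : ∀ x, (f x ^ a * g x ^ (1 - a)) ^ θ⁻¹ =
        (f x ^ θ₁⁻¹) ^ (a * θ₁ / θ) * (g x ^ θ₂⁻¹) ^ ((1 - a) * θ₂ / θ) := by
      intro x
      rw [ENNReal.mul_rpow_of_nonneg _ _ (inv_nonneg.2 hθ.le), ← ENNReal.rpow_mul,
        ← ENNReal.rpow_mul, ← ENNReal.rpow_mul, ← ENNReal.rpow_mul]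
      congr 2 <;> field_simp
    simp_rw [e]
    refine (ENNReal.rpow_le_rpow key hθ.le).trans ?_
    rw [ENNReal.mul_rpow_of_nonneg _ _ hθ.le, ← ENNReal.rpow_mul, ← ENNReal.rpow_mul,
      ← ENNReal.rpow_mul, ← ENNReal.rpow_mul, div_mul_cancel₀ _ hθ.ne', div_mul_cancel₀ _ hθ.ne',
      mul_comm a, mul_comm (1 - a)]

/-- Hölder's inequality for conjugate exponents `1/θ` and `1/(1-θ)`, endpoints included. -/
theorem lintegral_mul_le_lpn {θ : ℝ} (h0 : 0 < θ) (h1 : θ ≤ 1) {f g : X → ℝ≥0∞}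
    (hf : Measurable f) (hg : Measurable g) :
    ∫⁻ x, f x * g x ∂μ ≤ lpn (1 - θ) μ f * lpn θ μ g := by
  rcases h1.eq_or_lt with rfl | h1
  · rw [sub_self, lpn_zero, lpn_one, ← lintegral_const_mul _ hg]
    refine lintegral_mono_ae ?_
    filter_upwards [ENNReal.ae_le_essSup f] with x hx
    gcongr
  · have h2 : 0 < 1 - θ := by linarith
    rw [lpn_of_pos h0, lpn_of_pos h2]
    have := ENNReal.lintegral_mul_norm_pow_le (μ := μ) (hf.pow_const (1 - θ)⁻¹).aemeasurable
      (hg.pow_const θ⁻¹).aemeasurable h2.le h0.le (by ring)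
    simpa only [ENNReal.rpow_inv_rpow h0.ne', ENNReal.rpow_inv_rpow h2.ne'] using this

/-- Minkowski's integral inequality, in the form that a bound `B s` for the norm of each section
integrates to a bound for the norm of the integral. -/
theorem lpn_lintegral_le [SFinite μ] [SFinite ν] {θ : ℝ} (h0 : 0 ≤ θ) (h1 : θ ≤ 1)
    {f : X → Y → ℝ≥0∞} (hf : Measurable (Function.uncurry f)) {B : Y → ℝ≥0∞} (hB : Measurable B)
    (h : ∀ y, lpn θ μ (fun x => f x y) ≤ B y) :
    lpn θ μ (fun x => ∫⁻ y, f x y ∂ν) ≤ ∫⁻ y, B y ∂ν := by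
  rcases h0.eq_or_lt with rfl | h0
  · have hS : MeasurableSet {z : Y × X | f z.2 z.1 ≤ B z.1} :=
      measurableSet_le (hf.comp measurable_swap) (hB.comp measurable_fst)
    have h2 : ∀ᵐ z ∂(ν.prod μ), f z.2 z.1 ≤ B z.1 := by
      refine (Measure.ae_prod_iff_ae_ae hS).2 (Filter.Eventually.of_forall fun y => ?_)
      have := h y
      rw [lpn_zero] at this
      filter_upwards [ENNReal.ae_le_essSup (fun x => f x y)] with x hx using hx.trans this
    rw [lpn_zero]
    refine essSup_le_of_ae_le _ ?_
    have h3 : ∀ᵐ z ∂(μ.prod ν), f z.1 z.2 ≤ B z.2 := by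
      have := Measure.measurePreserving_swap (μ := μ) (ν := ν) |>.quasiMeasurePreserving.ae h2
      simpa using this
    filter_upwards [Measure.ae_ae_of_ae_prod h3] with x hx using lintegral_mono_ae hx
  · rcases eq_or_ne (∫⁻ y, B y ∂ν) ∞ with hT | hT
    · rw [hT]; exact le_top
    -- almost every section has finite norm, and it vanishes where the bound does
    have hfin : ∀ᵐ y ∂ν, B y < ∞ := ae_lt_top hB hT
    have hS : MeasurableSet {z : Y × X | B z.1 = 0 → f z.2 z.1 = 0} := by
      have e : {z : Y × X | B z.1 = 0 → f z.2 z.1 = 0} =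
          {z : Y × X | B z.1 = 0}ᶜ ∪ {z : Y × X | f z.2 z.1 = 0} := by
        ext z; simp [imp_iff_not_or]
      rw [e]
      exact (((hB.comp measurable_fst) (measurableSet_singleton 0)).compl).union
        ((hf.comp measurable_swap) (measurableSet_singleton 0))
    have h2 : ∀ᵐ z ∂(ν.prod μ), B z.1 = 0 → f z.2 z.1 = 0 := by
      refine (Measure.ae_prod_iff_ae_ae hS).2 (Filter.Eventually.of_forall fun y => ?_)
      by_cases hy : B y = 0
      · have h3 := h y
        rw [hy, nonpos_iff_eq_zero] at h3
        filter_upwards [lpn_eq_zero h0 (hf.comp measurable_prodMk_right) h3] with x hx _ using hx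
      · exact Filter.Eventually.of_forall fun x hx => absurd hx hy
    have h3 : ∀ᵐ z ∂(μ.prod ν), B z.2 = 0 → f z.1 z.2 = 0 := by
      have := Measure.measurePreserving_swap (μ := μ) (ν := ν) |>.quasiMeasurePreserving.ae h2
      simpa using this
    have hp : 0 ≤ θ⁻¹ - 1 := by rw [sub_nonneg]; exact (one_le_inv₀ h0).2 h1
    have hm : Measurable fun z : X × Y => f z.1 z.2 ^ θ⁻¹ * B z.2 ^ (1 - θ⁻¹) :=
      (hf.pow_const _).mul ((hB.comp measurable_snd).pow_const _)
    have key : ∀ᵐ x ∂μ, (∫⁻ y, f x y ∂ν) ^ θ⁻¹ ≤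
        (∫⁻ y, B y ∂ν) ^ (θ⁻¹ - 1) * ∫⁻ y, f x y ^ θ⁻¹ * B y ^ (1 - θ⁻¹) ∂ν := by
      filter_upwards [Measure.ae_ae_of_ae_prod h3] with x hx
      have e1 : ∫⁻ y, f x y ∂ν ≤
          ∫⁻ y, B y ^ (1 - θ) * (f x y ^ θ⁻¹ * B y ^ (1 - θ⁻¹)) ^ θ ∂ν := by
        refine lintegral_mono_ae ?_
        filter_upwards [hx, hfin] with y hy hy'
        by_cases hB0 : B y = 0
        · rw [hy hB0]; exact zero_le
        · rw [ENNReal.mul_rpow_of_nonneg _ _ h0.le, ENNReal.rpow_inv_rpow h0.ne',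
            ← ENNReal.rpow_mul, mul_left_comm, ← ENNReal.rpow_add _ _ hB0 hy'.ne]
          have : 1 - θ + (1 - θ⁻¹) * θ = 0 := by field_simp; ring
          rw [this, ENNReal.rpow_zero, mul_one]
      have e2 := ENNReal.lintegral_mul_norm_pow_le (μ := ν) hB.aemeasurable
        (hm.comp measurable_prodMk_left).aemeasurable (p := 1 - θ) (q := θ) (by linarith) h0.le
        (by ring) (g := fun y => f x y ^ θ⁻¹ * B y ^ (1 - θ⁻¹))
      refine (ENNReal.rpow_le_rpow (e1.trans e2) (inv_nonneg.2 h0.le)).trans_eq ?_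
      rw [ENNReal.mul_rpow_of_nonneg _ _ (inv_nonneg.2 h0.le), ENNReal.rpow_rpow_inv h0.ne',
        ← ENNReal.rpow_mul]
      congr 2
      field_simp
    rw [lpn_of_pos h0]
    have key2 : ∫⁻ x, (∫⁻ y, f x y ∂ν) ^ θ⁻¹ ∂μ ≤ (∫⁻ y, B y ∂ν) ^ θ⁻¹ := by
      refine (lintegral_mono_ae key).trans ?_
      rw [lintegral_const_mul _ hm.lintegral_prod_right', lintegral_lintegral_swap hm.aemeasurable]
      have e3 : ∀ᵐ y ∂ν, ∫⁻ x, f x y ^ θ⁻¹ * B y ^ (1 - θ⁻¹) ∂μ ≤ B y := by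
        filter_upwards [hfin] with y hy
        rw [lintegral_mul_const _ (hf.of_uncurry_right.pow_const _)]
        have := h y
        rw [lpn_le_iff h0] at this
        by_cases hB0 : B y = 0
        · rw [hB0, ENNReal.zero_rpow_of_pos (inv_pos.2 h0), nonpos_iff_eq_zero] at this
          rw [this, zero_mul]; exact zero_le
        · calc _ ≤ B y ^ θ⁻¹ * B y ^ (1 - θ⁻¹) := by gcongr
            _ = B y := by
              rw [← ENNReal.rpow_add _ _ hB0 hy.ne, add_sub_cancel, ENNReal.rpow_one]
      calc _ ≤ (∫⁻ y, B y ∂ν) ^ (θ⁻¹ - 1) * ∫⁻ y, B y ∂ν := by gcongr 1; exact lintegral_mono_ae e3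
        _ = (∫⁻ y, B y ∂ν) ^ (θ⁻¹ - 1) * (∫⁻ y, B y ∂ν) ^ (1 : ℝ) := by rw [ENNReal.rpow_one]
        _ = (∫⁻ y, B y ∂ν) ^ θ⁻¹ := by
          rw [← ENNReal.rpow_add_of_nonneg _ _ hp zero_le_one, sub_add_cancel]
    rw [← lpn_of_pos h0]
    exact (lpn_le_iff h0).2 key2

/-- Young's inequality for integral operators: if all rows and columns of the kernel have
`L^{1/θm}` norm at most `A` and `1 + θq = θm + θp`, the operator maps `L^{1/θp}` to `L^{1/θq}` with
norm at most `A`. -/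
theorem lpn_kernel_le [SFinite μ] [SFinite ν] {θm θp θq : ℝ} (hm0 : 0 ≤ θm)
    (hm1 : θm ≤ 1) (hp0 : 0 < θp) (hp1 : θp ≤ 1) (hq0 : 0 ≤ θq) (hq : 1 + θq = θm + θp)
    {K : X → Y → ℝ≥0∞} (hK : Measurable (Function.uncurry K)) {A : ℝ≥0∞}
    (hrow : ∀ x, lpn θm ν (K x) ≤ A) (hcol : ∀ y, lpn θm μ (fun x => K x y) ≤ A)
    {f : Y → ℝ≥0∞} (hf : Measurable f) :
    lpn θq μ (fun x => ∫⁻ y, K x y * f y ∂ν) ≤ A * lpn θp ν f := by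
  -- `θm = 0` forces the mapping from `L^1` to `L^∞`
  rcases hm0.eq_or_lt with rfl | hm
  · have hp : θp = 1 := by linarith
    have hq' : θq = 0 := by linarith
    subst hp hq'
    refine lpn_le_of_forall_le fun x => ?_
    rw [lpn_one, ← lintegral_const_mul _ hf]
    refine lintegral_mono_ae ?_
    have := hrow x
    rw [lpn_zero] at this
    filter_upwards [ENNReal.ae_le_essSup (K x)] with y hy
    gcongr
    exact hy.trans this
  set P := ∫⁻ y, f y ^ θp⁻¹ ∂ν with hP
  have hKm : Measurable (fun z : X × Y => K z.1 z.2 ^ θm⁻¹) := hK.pow_const _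
  have hrow' : ∀ x, ∫⁻ y, K x y ^ θm⁻¹ ∂ν ≤ A ^ θm⁻¹ := fun x => (lpn_le_iff hm).1 (hrow x)
  have hcol' : ∀ y, ∫⁻ x, K x y ^ θm⁻¹ ∂μ ≤ A ^ θm⁻¹ := fun y => (lpn_le_iff hm).1 (hcol y)
  have hmq : 0 ≤ θm - θq := by linarith
  have hpq : 0 ≤ θp - θq := by linarith
  have hKx : ∀ x, Measurable (K x) := fun x => hK.comp measurable_prodMk_left
  -- Hölder's inequality with three factors: the exponents `θq`, `θm - θq`, `θp - θq` sum to `1`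
  have pt : ∀ x, ∫⁻ y, K x y * f y ∂ν ≤
      (∫⁻ y, K x y ^ θm⁻¹ * f y ^ θp⁻¹ ∂ν) ^ θq * (A ^ (θm⁻¹ * (θm - θq)) * P ^ (θp - θq)) := by
    intro x
    have := ENNReal.lintegral_prod_norm_pow_le (μ := ν) (Finset.univ : Finset (Fin 3))
      (f := ![fun y => K x y ^ θm⁻¹ * f y ^ θp⁻¹, fun y => K x y ^ θm⁻¹, fun y => f y ^ θp⁻¹])
      (p := ![θq, θm - θq, θp - θq])
      (by
        intro i _
        have h1 := (hKx x).pow_const θm⁻¹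
        have h2 := hf.pow_const θp⁻¹
        fin_cases i
        · exact (h1.mul h2).aemeasurable
        · exact h1.aemeasurable
        · exact h2.aemeasurable)
      (by simp [Fin.sum_univ_three]; linarith)
      (by intro i _; fin_cases i <;> simp <;> linarith)
    simp only [Fin.prod_univ_three, Matrix.cons_val_zero, Matrix.cons_val_one,
      Matrix.cons_val] at this
    have e : ∀ y, (K x y ^ θm⁻¹ * f y ^ θp⁻¹) ^ θq * (K x y ^ θm⁻¹) ^ (θm - θq) *
        (f y ^ θp⁻¹) ^ (θp - θq) = K x y * f y := by
      intro y
      have e1 : (K x y ^ θm⁻¹) ^ θq * (K x y ^ θm⁻¹) ^ (θm - θq) = K x y := by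
        rw [← ENNReal.rpow_add_of_nonneg _ _ hq0 hmq, add_sub_cancel,
          ENNReal.rpow_inv_rpow hm.ne']
      have e2 : (f y ^ θp⁻¹) ^ θq * (f y ^ θp⁻¹) ^ (θp - θq) = f y := by
        rw [← ENNReal.rpow_add_of_nonneg _ _ hq0 hpq, add_sub_cancel,
          ENNReal.rpow_inv_rpow hp0.ne']
      rw [ENNReal.mul_rpow_of_nonneg _ _ hq0, mul_right_comm _ _ ((K x y ^ θm⁻¹) ^ (θm - θq)), e1,
        mul_assoc, e2]
    simp_rw [e] at this
    refine this.trans ?_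
    rw [mul_assoc]
    rw [ENNReal.rpow_mul]
    gcongr
    exact hrow' x
  rcases hq0.eq_or_lt with h | hq0
  · subst h
    refine lpn_le_of_forall_le fun x => (pt x).trans_eq ?_
    rw [lpn_of_pos hp0, ENNReal.rpow_zero, one_mul, sub_zero, sub_zero, inv_mul_cancel₀ hm.ne',
      ENNReal.rpow_one]
  rw [lpn_of_pos hq0]
  have hm2 : Measurable fun z : X × Y => K z.1 z.2 ^ θm⁻¹ * f z.2 ^ θp⁻¹ :=
    hKm.mul ((hf.comp measurable_snd).pow_const _)
  have key : ∫⁻ x, (∫⁻ y, K x y * f y ∂ν) ^ θq⁻¹ ∂μ ≤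
      A ^ θm⁻¹ * P * (A ^ (θm⁻¹ * (θm - θq)) * P ^ (θp - θq)) ^ θq⁻¹ := by
    calc _ ≤ ∫⁻ x, (∫⁻ y, K x y ^ θm⁻¹ * f y ^ θp⁻¹ ∂ν) *
          (A ^ (θm⁻¹ * (θm - θq)) * P ^ (θp - θq)) ^ θq⁻¹ ∂μ := by
          refine lintegral_mono fun x => ?_
          refine (ENNReal.rpow_le_rpow (pt x) (inv_nonneg.2 hq0.le)).trans_eq ?_
          rw [ENNReal.mul_rpow_of_nonneg _ _ (inv_nonneg.2 hq0.le), ENNReal.rpow_rpow_inv hq0.ne']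
      _ = (∫⁻ y, ∫⁻ x, K x y ^ θm⁻¹ * f y ^ θp⁻¹ ∂μ ∂ν) *
          (A ^ (θm⁻¹ * (θm - θq)) * P ^ (θp - θq)) ^ θq⁻¹ := by
          rw [lintegral_mul_const _ hm2.lintegral_prod_right',
            lintegral_lintegral_swap hm2.aemeasurable]
      _ ≤ (∫⁻ y, A ^ θm⁻¹ * f y ^ θp⁻¹ ∂ν) *
          (A ^ (θm⁻¹ * (θm - θq)) * P ^ (θp - θq)) ^ θq⁻¹ := by
          gcongr with y
          rw [lintegral_mul_const _ (hK.of_uncurry_right.pow_const _)]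
          gcongr
          exact hcol' y
      _ = _ := by rw [lintegral_const_mul _ (hf.pow_const _)]
  refine (ENNReal.rpow_le_rpow key hq0.le).trans_eq ?_
  rw [lpn_of_pos hp0, ENNReal.mul_rpow_of_nonneg _ _ hq0.le, ENNReal.rpow_inv_rpow hq0.ne',
    ENNReal.mul_rpow_of_nonneg _ _ hq0.le, mul_mul_mul_comm, ← ENNReal.rpow_mul,
    ← ENNReal.rpow_add_of_nonneg _ _ (by positivity) (by positivity),
    ← ENNReal.rpow_add_of_nonneg _ _ hq0.le hpq, ← mul_add, add_sub_cancel, add_sub_cancel,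
    inv_mul_cancel₀ hm.ne', ENNReal.rpow_one]

end lpn

/-! ### Power integrals, layer-cake formulas and optimisation in a parameter -/

theorem setLIntegral_Ioi_rpow {c s : ℝ} (hc : 0 < c) (hs : s < -1) :
    ∫⁻ r in Ioi c, ENNReal.ofReal r ^ s =
      ENNReal.ofReal (-(s + 1))⁻¹ * ENNReal.ofReal c ^ (s + 1) := by
  have h1 : ∫⁻ r in Ioi c, ENNReal.ofReal r ^ s = ∫⁻ r in Ioi c, ENNReal.ofReal (r ^ s) :=
    setLIntegral_congr_fun measurableSet_Ioi fun r hr =>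
      ENNReal.ofReal_rpow_of_pos (hc.trans hr)
  rw [h1, ← ofReal_integral_eq_lintegral_ofReal (integrableOn_Ioi_rpow_of_lt hs hc),
    integral_Ioi_rpow_of_lt hs hc, ENNReal.ofReal_rpow_of_pos hc, ← ENNReal.ofReal_mul]
  · congr 1
    rw [inv_neg]
    ring
  · rw [inv_nonneg]; linarith
  · filter_upwards [ae_restrict_mem measurableSet_Ioi] with r hr
    exact Real.rpow_nonneg (hc.trans hr).le _

theorem setLIntegral_Ioc_rpow {c s : ℝ} (hc : 0 < c) (hs : -1 < s) :
    ∫⁻ r in Ioc 0 c, ENNReal.ofReal r ^ s =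
      ENNReal.ofReal (s + 1)⁻¹ * ENNReal.ofReal c ^ (s + 1) := by
  have h1 : ∫⁻ r in Ioc 0 c, ENNReal.ofReal r ^ s = ∫⁻ r in Ioc 0 c, ENNReal.ofReal (r ^ s) :=
    setLIntegral_congr_fun measurableSet_Ioc fun r hr =>
      ENNReal.ofReal_rpow_of_pos hr.1
  rw [h1, ← ofReal_integral_eq_lintegral_ofReal
    (intervalIntegral.intervalIntegrable_rpow' hs (a := 0) (b := c)).1,
    ← intervalIntegral.integral_of_le hc.le, integral_rpow (Or.inl hs),
    ENNReal.ofReal_rpow_of_pos hc, ← ENNReal.ofReal_mul, Real.zero_rpow (by linarith)]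
  · congr 1
    ring
  · rw [inv_nonneg]; linarith
  · filter_upwards [ae_restrict_mem measurableSet_Ioc] with r hr
    exact Real.rpow_nonneg hr.1.le _

theorem measurable_ofReal_rpow (s : ℝ) : Measurable fun r : ℝ => ENNReal.ofReal r ^ s :=
  ENNReal.measurable_ofReal.pow_const s

theorem ENNReal.eq_top_of_forall_natCast_le {x : ℝ≥0∞} (h : ∀ k : ℕ, (k : ℝ≥0∞) ≤ x) : x = ∞ := by
  by_contra hx
  obtain ⟨k, hk⟩ := ENNReal.exists_nat_gt hx
  exact absurd (h k) (not_le.2 hk)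

/-- The layer-cake formula for a positive power of a number. -/
theorem rpow_eq_lintegral_indicator {s : ℝ} (hs : 0 < s) (z : ℝ≥0∞) :
    z ^ s = ∫⁻ r in Ioi (0 : ℝ), ENNReal.ofReal s * ENNReal.ofReal r ^ (s - 1) *
      {r : ℝ | ENNReal.ofReal r < z}.indicator 1 r := by
  have base : ∀ c : ℝ, 0 < c → ∫⁻ r in Ioc 0 c, ENNReal.ofReal s * ENNReal.ofReal r ^ (s - 1) =
      ENNReal.ofReal c ^ s := by
    intro c hc
    rw [lintegral_const_mul _ (measurable_ofReal_rpow _), setLIntegral_Ioc_rpow hc (by linarith),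
      ← mul_assoc, sub_add_cancel, ← ENNReal.ofReal_mul hs.le, mul_inv_cancel₀ hs.ne',
      ENNReal.ofReal_one, one_mul]
  induction z with
  | top =>
    rw [ENNReal.top_rpow_of_pos hs]
    refine (ENNReal.eq_top_of_forall_natCast_le fun k => ?_).symm
    have hk : (0 : ℝ) < ((k : ℝ) + 1) ^ s⁻¹ := by positivity
    calc (k : ℝ≥0∞) ≤ ENNReal.ofReal (((k : ℝ) + 1) ^ s⁻¹) ^ s := by
          rw [ENNReal.ofReal_rpow_of_pos hk, Real.rpow_inv_rpow (by positivity) hs.ne',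
            ← ENNReal.ofReal_natCast]
          exact ENNReal.ofReal_le_ofReal (by linarith)
      _ = ∫⁻ r in Ioc 0 (((k : ℝ) + 1) ^ s⁻¹), ENNReal.ofReal s * ENNReal.ofReal r ^ (s - 1) :=
          (base _ hk).symm
      _ ≤ ∫⁻ r in Ioi (0 : ℝ), ENNReal.ofReal s * ENNReal.ofReal r ^ (s - 1) :=
          lintegral_mono_set Ioc_subset_Ioi_self
      _ = _ := by simp
  | coe z =>
    rcases eq_or_ne z 0 with rfl | hz
    · simp [hs]
    have hz' : (0 : ℝ) < z := by positivity
    have e : (z : ℝ≥0∞) = ENNReal.ofReal (z : ℝ) := by simp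
    rw [e, ← base _ hz', Measure.restrict_congr_set Ioo_ae_eq_Ioc.symm]
    have : ∀ r : ℝ, ENNReal.ofReal s * ENNReal.ofReal r ^ (s - 1) *
        {r : ℝ | ENNReal.ofReal r < ENNReal.ofReal (z : ℝ)}.indicator 1 r =
        (Iio (z : ℝ)).indicator (fun r => ENNReal.ofReal s * ENNReal.ofReal r ^ (s - 1)) r := by
      intro r
      by_cases h : r < z
      · rw [indicator_of_mem, indicator_of_mem]
        · simp
        · exact h
        · exact (ENNReal.ofReal_lt_ofReal_iff hz').2 h
      · rw [indicator_of_notMem, indicator_of_notMem, mul_zero]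
        · exact h
        · exact fun h' => h (ENNReal.ofReal_lt_ofReal_iff'.1 h').1
    simp_rw [this]
    rw [setLIntegral_indicator measurableSet_Iio]
    congr 2
    ext r; simp [and_comm]

/-- The layer-cake formula for a negative power of a number. -/
theorem rpow_neg_eq_lintegral_indicator {s : ℝ} (hs : 0 < s) (z : ℝ≥0∞) :
    z ^ (-s) = ∫⁻ r in Ioi (0 : ℝ), ENNReal.ofReal s * ENNReal.ofReal r ^ (-s - 1) *
      {r : ℝ | z < ENNReal.ofReal r}.indicator 1 r := by
  have base : ∀ c : ℝ, 0 < c → ∫⁻ r in Ioi c, ENNReal.ofReal s * ENNReal.ofReal r ^ (-s - 1) =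
      ENNReal.ofReal c ^ (-s) := by
    intro c hc
    rw [lintegral_const_mul _ (measurable_ofReal_rpow _), setLIntegral_Ioi_rpow hc (by linarith),
      ← mul_assoc, sub_add_cancel, neg_neg, ← ENNReal.ofReal_mul hs.le, mul_inv_cancel₀ hs.ne',
      ENNReal.ofReal_one, one_mul]
  induction z with
  | top => simp [hs]
  | coe z =>
    rcases eq_or_ne z 0 with rfl | hz
    · rw [ENNReal.coe_zero, ENNReal.zero_rpow_of_neg (by linarith)]
      refine (ENNReal.eq_top_of_forall_natCast_le fun k => ?_).symm
      have hk : (0 : ℝ) < ((k : ℝ) + 1) ^ (-s⁻¹) := by positivity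
      calc (k : ℝ≥0∞) ≤ ENNReal.ofReal (((k : ℝ) + 1) ^ (-s⁻¹)) ^ (-s) := by
            rw [ENNReal.ofReal_rpow_of_pos hk, ← Real.rpow_mul (by positivity), neg_mul_neg,
              inv_mul_cancel₀ hs.ne', Real.rpow_one, ← ENNReal.ofReal_natCast]
            exact ENNReal.ofReal_le_ofReal (by linarith)
        _ = ∫⁻ r in Ioi (((k : ℝ) + 1) ^ (-s⁻¹)),
              ENNReal.ofReal s * ENNReal.ofReal r ^ (-s - 1) := (base _ hk).symm
        _ = ∫⁻ r in Ioi (((k : ℝ) + 1) ^ (-s⁻¹)), ENNReal.ofReal s * ENNReal.ofReal r ^ (-s - 1) *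
              {r : ℝ | 0 < ENNReal.ofReal r}.indicator 1 r := by
            refine setLIntegral_congr_fun measurableSet_Ioi fun r hr => ?_
            have : 0 < r := hk.trans hr
            simp [this]
        _ ≤ _ := lintegral_mono_set (Ioi_subset_Ioi hk.le)
    have hz' : (0 : ℝ) < z := by positivity
    have e : (z : ℝ≥0∞) = ENNReal.ofReal (z : ℝ) := by simp
    rw [e, ← base _ hz']
    have : ∀ r : ℝ, ENNReal.ofReal s * ENNReal.ofReal r ^ (-s - 1) *
        {r : ℝ | ENNReal.ofReal (z : ℝ) < ENNReal.ofReal r}.indicator 1 r =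
        (Ioi (z : ℝ)).indicator (fun r => ENNReal.ofReal s * ENNReal.ofReal r ^ (-s - 1)) r := by
      intro r
      by_cases h : z < r
      · have := hz'.trans h
        rw [indicator_of_mem, indicator_of_mem]
        · simp
        · exact h
        · exact (ENNReal.ofReal_lt_ofReal_iff this).2 h
      · rw [indicator_of_notMem, indicator_of_notMem, mul_zero]
        · exact h
        · exact fun h' => h (ENNReal.ofReal_lt_ofReal_iff'.1 h').1
    simp_rw [this]
    rw [setLIntegral_indicator measurableSet_Ioi]
    congr 2
    ext r; simp only [mem_inter_iff, mem_Ioi]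
    exact ⟨fun h => ⟨h, hz'.trans h⟩, fun h => h.1⟩

section

variable {X : Type*} [MeasurableSpace X] {μ : Measure X}

theorem lintegral_rpow_eq_lintegral_measure [SFinite μ] {s : ℝ} (hs : 0 < s) {f : X → ℝ≥0∞}
    (hf : Measurable f) :
    ∫⁻ x, f x ^ s ∂μ = ∫⁻ r in Ioi (0 : ℝ), ENNReal.ofReal s * ENNReal.ofReal r ^ (s - 1) *
      μ {x | ENNReal.ofReal r < f x} := by
  simp_rw [rpow_eq_lintegral_indicator hs]
  have hS : MeasurableSet {z : X × ℝ | ENNReal.ofReal z.2 < f z.1} :=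
    measurableSet_lt (ENNReal.measurable_ofReal.comp measurable_snd) (hf.comp measurable_fst)
  have hm : Measurable (fun z : X × ℝ => ENNReal.ofReal s * ENNReal.ofReal z.2 ^ (s - 1) *
      {z : X × ℝ | ENNReal.ofReal z.2 < f z.1}.indicator 1 z) :=
    (((measurable_ofReal_rpow _).comp measurable_snd).const_mul _).mul
      (measurable_one.indicator hS)
  refine (lintegral_lintegral_swap hm.aemeasurable).trans (lintegral_congr fun r => ?_)
  have hr : MeasurableSet {x | ENNReal.ofReal r < f x} := measurableSet_lt measurable_const hf
  rw [← lintegral_indicator_one hr, ← lintegral_const_mul _ (measurable_one.indicator hr)]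
  rfl

theorem lintegral_rpow_neg_eq_lintegral_measure [SFinite μ] {s : ℝ} (hs : 0 < s) {f : X → ℝ≥0∞}
    (hf : Measurable f) :
    ∫⁻ x, f x ^ (-s) ∂μ = ∫⁻ r in Ioi (0 : ℝ), ENNReal.ofReal s * ENNReal.ofReal r ^ (-s - 1) *
      μ {x | f x < ENNReal.ofReal r} := by
  simp_rw [rpow_neg_eq_lintegral_indicator hs]
  have hS : MeasurableSet {z : X × ℝ | f z.1 < ENNReal.ofReal z.2} :=
    measurableSet_lt (hf.comp measurable_fst) (ENNReal.measurable_ofReal.comp measurable_snd)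
  have hm : Measurable (fun z : X × ℝ => ENNReal.ofReal s * ENNReal.ofReal z.2 ^ (-s - 1) *
      {z : X × ℝ | f z.1 < ENNReal.ofReal z.2}.indicator 1 z) :=
    (((measurable_ofReal_rpow _).comp measurable_snd).const_mul _).mul
      (measurable_one.indicator hS)
  refine (lintegral_lintegral_swap hm.aemeasurable).trans (lintegral_congr fun r => ?_)
  have hr : MeasurableSet {x | f x < ENNReal.ofReal r} := measurableSet_lt hf measurable_const
  rw [← lintegral_indicator_one hr, ← lintegral_const_mul _ (measurable_one.indicator hr)]
  rfl

end

/-- Optimising `ρ^α a + ρ^{-β} b` over `ρ > 0`. The two side conditions settle the case in which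
one of `a`, `b` is zero and the other infinite. -/
theorem le_two_mul_rpow_mul_rpow {x a b : ℝ≥0∞} {α β : ℝ} (hα : 0 < α) (hβ : 0 < β)
    (h : ∀ ρ : ℝ, 0 < ρ → x ≤ ENNReal.ofReal ρ ^ α * a + ENNReal.ofReal ρ ^ (-β) * b)
    (ha : a = 0 → x = 0) (hb : b = 0 → x = 0) :
    x ≤ 2 * (a ^ (β / (α + β)) * b ^ (α / (α + β))) := by
  have hαβ : 0 < α + β := by positivity
  rcases eq_or_ne a 0 with h0 | ha0
  · simp [ha h0]
  rcases eq_or_ne b 0 with h0 | hb0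
  · simp [hb h0]
  rcases eq_or_ne a ∞ with rfl | haT
  · rw [ENNReal.top_rpow_of_pos (by positivity), ENNReal.top_mul, ENNReal.mul_top two_ne_zero]
    · exact le_top
    · simp [hb0, not_lt.2 (div_pos hα hαβ).le]
  rcases eq_or_ne b ∞ with rfl | hbT
  · rw [ENNReal.top_rpow_of_pos (by positivity), ENNReal.mul_top, ENNReal.mul_top two_ne_zero]
    · exact le_top
    · simp [ha0, not_lt.2 (div_pos hβ hαβ).le]
  -- both terms agree at `ρ = (b / a)^{1/(α + β)}`
  set R : ℝ≥0∞ := (b / a) ^ (α + β)⁻¹ with hR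
  have hd0 : b / a ≠ 0 := (ENNReal.div_pos hb0 haT).ne'
  have hdT : b / a ≠ ∞ := (ENNReal.div_lt_top hbT ha0).ne
  have hR0 : R ≠ 0 := by simp [hR, ENNReal.rpow_eq_zero_iff, hd0, hdT]
  have hRT : R ≠ ∞ := by simp [hR, ENNReal.rpow_eq_top_iff, hd0, hdT]
  have key := h R.toReal (ENNReal.toReal_pos hR0 hRT)
  rw [ENNReal.ofReal_toReal hRT] at key
  refine key.trans_eq ?_
  have e1 : R ^ α * a = a ^ (β / (α + β)) * b ^ (α / (α + β)) := by
    rw [hR, ← ENNReal.rpow_mul, ENNReal.div_rpow_of_nonneg _ _ (by positivity),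
        ENNReal.div_eq_inv_mul,
      mul_right_comm, ← ENNReal.rpow_neg, inv_mul_eq_div]
    congr 1
    nth_rewrite 2 [← ENNReal.rpow_one a]
    rw [← ENNReal.rpow_add _ _ ha0 haT]
    congr 1
    field_simp
    ring
  have e2 : R ^ (-β) * b = a ^ (β / (α + β)) * b ^ (α / (α + β)) := by
    have : -β = α - (α + β) := by ring
    rw [this, ENNReal.rpow_sub _ _ hR0 hRT]
    have : R ^ (α + β) = b / a := by rw [hR, ENNReal.rpow_inv_rpow hαβ.ne']
    rw [this, ← e1, ENNReal.div_eq_inv_mul, ENNReal.inv_div (Or.inl haT) (Or.inl ha0),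
      mul_comm _ b, mul_comm (a / b), ← mul_assoc, mul_comm b, mul_assoc,
          ENNReal.mul_div_cancel hb0 hbT]
  rw [e1, e2, two_mul]

section duality

variable {X : Type*} [MeasurableSpace X] {μ : Measure X}

/-- Cancelling a power: `I ≤ K I^{1-θ}` gives `I^θ ≤ K` for finite `I`. -/
theorem rpow_le_of_le_mul_rpow {θ : ℝ} (h0 : 0 < θ) {I K : ℝ≥0∞} (hI : I ≠ ∞)
    (h : I ≤ K * I ^ (1 - θ)) : I ^ θ ≤ K := by
  rcases eq_or_ne I 0 with rfl | hI0
  · simp [h0]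
  have hp : I ^ (1 - θ) ≠ 0 := by simp [ENNReal.rpow_eq_zero_iff, hI0, hI]
  have hT : I ^ (1 - θ) ≠ ∞ := by simp [ENNReal.rpow_eq_top_iff, hI0, hI]
  rw [← ENNReal.mul_le_mul_iff_left hp hT, ← ENNReal.rpow_add _ _ hI0 hI]
  simpa using h

/-- The converse of Hölder's inequality. -/
theorem lpn_le_of_forall_lintegral_mul_le [SigmaFinite μ] {θ : ℝ} (h0 : 0 < θ) (h1 : θ ≤ 1)
    {Φ : X → ℝ≥0∞} (hΦ : Measurable Φ) {K : ℝ≥0∞}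
    (h : ∀ w : X → ℝ≥0∞, Measurable w → ∫⁻ x, Φ x * w x ∂μ ≤ K * lpn (1 - θ) μ w) :
    lpn θ μ Φ ≤ K := by
  rcases h1.eq_or_lt with rfl | h1
  · rw [lpn_one]
    have := h 1 measurable_one
    simp only [Pi.one_apply, mul_one, sub_self] at this
    refine this.trans (mul_le_of_le_one_right' (lpn_le_of_forall_le fun x => le_rfl))
  have h2 : 0 < 1 - θ := by linarith
  have hi : 0 < θ⁻¹ := inv_pos.2 h0
  have hi1 : 0 < θ⁻¹ - 1 := by rw [sub_pos]; exact (one_lt_inv₀ h0).2 h1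
  -- truncations of `Φ` with finite norm, which increase to `Φ`
  set Ψ : ℕ → X → ℝ≥0∞ := fun k => (spanningSets μ k).indicator fun x => min (Φ x) k with hΨ
  have hΨm : ∀ k, Measurable (Ψ k) := fun k =>
    (hΦ.min measurable_const).indicator (measurableSet_spanningSets μ k)
  have hΨle : ∀ k x, Ψ k x ≤ Φ x := fun k x => by
    refine (indicator_le_self' (fun _ _ => zero_le) x).trans (min_le_left _ _)
  have hΨmono : ∀ x, Monotone fun k => Ψ k x := fun x i j hij => by
    simp only [hΨ]
    by_cases hx : x ∈ spanningSets μ i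
    · rw [indicator_of_mem hx, indicator_of_mem (monotone_spanningSets μ hij hx)]
      exact min_le_min le_rfl (by exact_mod_cast hij)
    · rw [indicator_of_notMem hx]; exact zero_le
  have hΨsup : ∀ x, ⨆ k, Ψ k x = Φ x := fun x => by
    refine le_antisymm (iSup_le fun k => hΨle k x) (le_of_forall_lt fun c hc => ?_)
    obtain ⟨k, hk⟩ := ENNReal.exists_nat_gt hc.ne_top
    set j := max k (spanningSetsIndex μ x)
    have hx : x ∈ spanningSets μ j :=
      monotone_spanningSets μ (le_max_right _ _) (mem_spanningSetsIndex μ x)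
    have hkj : (k : ℝ≥0∞) ≤ j := by exact_mod_cast le_max_left _ _
    refine lt_of_lt_of_le ?_ (le_iSup (fun i => Ψ i x) j)
    simp only [hΨ]
    rw [indicator_of_mem hx]
    exact lt_min hc (hk.trans_le hkj)
  rw [lpn_le_iff h0]
  have hlim : ∫⁻ x, Φ x ^ θ⁻¹ ∂μ = ⨆ k, ∫⁻ x, Ψ k x ^ θ⁻¹ ∂μ := by
    rw [← lintegral_iSup (fun k => (hΨm k).pow_const _)
      (fun i j hij x => ENNReal.rpow_le_rpow (hΨmono x hij) hi.le)]
    refine lintegral_congr fun x => ?_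
    rw [← hΨsup x]
    exact (ENNReal.orderIsoRpow θ⁻¹ hi).map_iSup _
  rw [hlim]
  refine iSup_le fun k => ?_
  set I := ∫⁻ x, Ψ k x ^ θ⁻¹ ∂μ with hI
  have hIT : I ≠ ∞ := by
    have : I ≤ ∫⁻ x, (spanningSets μ k).indicator (fun _ => (k : ℝ≥0∞) ^ θ⁻¹) x ∂μ := by
      refine lintegral_mono fun x => ?_
      simp only [hΨ]
      by_cases hx : x ∈ spanningSets μ k
      · rw [indicator_of_mem hx, indicator_of_mem hx]
        exact ENNReal.rpow_le_rpow (min_le_right _ _) hi.le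
      · rw [indicator_of_notMem hx, indicator_of_notMem hx, ENNReal.zero_rpow_of_pos hi]
    refine (this.trans_lt ?_).ne
    rw [lintegral_indicator_const (measurableSet_spanningSets μ k)]
    exact ENNReal.mul_lt_top (ENNReal.rpow_lt_top_of_nonneg hi.le (ENNReal.natCast_ne_top k))
      (measure_spanningSets_lt_top μ k)
  have h3 := h (fun x => Ψ k x ^ (θ⁻¹ - 1)) ((hΨm k).pow_const _)
  have h4 : I ≤ K * I ^ (1 - θ) := by
    calc I = ∫⁻ x, Ψ k x * Ψ k x ^ (θ⁻¹ - 1) ∂μ := by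
          refine lintegral_congr fun x => ?_
          nth_rewrite 2 [← ENNReal.rpow_one (Ψ k x)]
          rw [← ENNReal.rpow_add_of_nonneg _ _ zero_le_one hi1.le, add_sub_cancel]
      _ ≤ ∫⁻ x, Φ x * Ψ k x ^ (θ⁻¹ - 1) ∂μ := by
          gcongr with x; exact hΨle k x
      _ ≤ _ := h3
      _ = K * I ^ (1 - θ) := by
          rw [lpn_of_pos h2]
          simp_rw [← ENNReal.rpow_mul]
          have : (θ⁻¹ - 1) * (1 - θ)⁻¹ = θ⁻¹ := by field_simp
          rw [this]
  have h5 := rpow_le_of_le_mul_rpow h0 hIT h4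
  rwa [← ENNReal.rpow_le_rpow_iff h0, ENNReal.rpow_inv_rpow h0.ne']

end duality

/-! ### Integrals of radial powers against measures of polynomial growth -/

section growth

variable {X : Type*} [PseudoMetricSpace X] [MeasurableSpace X] [OpensMeasurableSpace X]
  {μ : Measure X}

theorem measurable_edist_const (x : X) : Measurable fun y : X => edist y x :=
  (continuous_id.edist continuous_const).measurable

/-- If balls of radius `r` around `x` have measure at most `A r^D`, the tail of a radial power
`(c + d)^{-l}` with `l > D` is controlled by the scale `c`. -/
theorem lintegral_add_edist_rpow_neg_le [SFinite μ] {x : X} {A : ℝ≥0∞} {D l c : ℝ} (hD : 0 < D)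
    (hl : D < l) (hc : 0 < c)
    (h : ∀ r : ℝ, 0 < r → μ (Metric.ball x r) ≤ A * ENNReal.ofReal r ^ D) :
    ∫⁻ y, (ENNReal.ofReal c + edist y x) ^ (-l) ∂μ ≤
      ENNReal.ofReal (l * (l - D)⁻¹) * A * ENNReal.ofReal c ^ (D - l) := by
  have hl0 : 0 < l := hD.trans hl
  rw [lintegral_rpow_neg_eq_lintegral_measure hl0 ((measurable_edist_const x).const_add _)]
  calc _ ≤ ∫⁻ r in Ioi (0 : ℝ), (Ioi c).indicator (fun r =>
        ENNReal.ofReal l * A * ENNReal.ofReal r ^ (D - l - 1)) r := by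
        refine setLIntegral_mono' measurableSet_Ioi fun r hr => ?_
        have hr : 0 < r := hr
        by_cases hcr : r ∈ Ioi c
        · rw [indicator_of_mem hcr]
          have : μ {y | ENNReal.ofReal c + edist y x < ENNReal.ofReal r} ≤
              A * ENNReal.ofReal r ^ D := by
            refine (measure_mono fun y hy => ?_).trans (h r hr)
            have : edist y x < ENNReal.ofReal r := lt_of_le_of_lt le_add_self hy
            rwa [edist_lt_ofReal] at this
          refine (mul_le_mul_right this _).trans_eq ?_
          have e : D - l - 1 = (-l - 1) + D := by ring
          rw [e, ENNReal.rpow_add _ _ (by simpa using hr) ENNReal.ofReal_ne_top]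
          ring
        · have : {y | ENNReal.ofReal c + edist y x < ENNReal.ofReal r} = ∅ := by
            ext y
            simp only [mem_ofPred_eq, mem_empty_iff_false, iff_false, not_lt]
            exact (ENNReal.ofReal_le_ofReal (not_lt.1 hcr)).trans le_self_add
          rw [this]
          simp
    _ ≤ ∫⁻ r in Ioi c, ENNReal.ofReal l * A * ENNReal.ofReal r ^ (D - l - 1) := by
        rw [setLIntegral_indicator measurableSet_Ioi]
        exact lintegral_mono_set inter_subset_left
    _ = _ := by
        rw [lintegral_const_mul _ (measurable_ofReal_rpow _),
            setLIntegral_Ioi_rpow hc (by linarith),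
          ENNReal.ofReal_mul hl0.le]
        have e1 : -(D - l - 1 + 1) = l - D := by ring
        have e2 : D - l - 1 + 1 = D - l := by ring
        rw [e1, e2]
        ring

/-- If balls of radius `r` around `x` have measure at most `A r^D`, the singular power `d^{-l}` with
`l < D` has integral `≲ ρ^{D-l}` over the ball of radius `ρ`. -/
theorem setLIntegral_ball_edist_rpow_neg_le [SFinite μ] {x : X} {A : ℝ≥0∞} {D l ρ : ℝ}
    (hl0 : 0 ≤ l) (hl : l < D) (hρ : 0 < ρ)
    (h : ∀ r : ℝ, 0 < r → μ (Metric.ball x r) ≤ A * ENNReal.ofReal r ^ D) :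
    ∫⁻ y in Metric.ball x ρ, edist y x ^ (-l) ∂μ ≤
      ENNReal.ofReal (D * (D - l)⁻¹) * A * ENNReal.ofReal ρ ^ (D - l) := by
  have hD : 0 < D := hl0.trans_lt hl
  rcases hl0.eq_or_lt with rfl | hl0
  · simpa [hD.ne'] using h ρ hρ
  rw [lintegral_rpow_neg_eq_lintegral_measure hl0 (measurable_edist_const x)]
  have hm : ∀ r, (μ.restrict (Metric.ball x ρ)) {y | edist y x < ENNReal.ofReal r} =
      μ (Metric.ball x (min r ρ)) := by
    intro r
    have e : {y | edist y x < ENNReal.ofReal r} = Metric.ball x r := by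
      ext y; simp only [mem_ofPred_eq, edist_lt_ofReal, Metric.mem_ball]
    rw [e, Measure.restrict_apply Metric.isOpen_ball.measurableSet]
    congr 1
    ext y; simp [Metric.mem_ball]
  simp_rw [hm]
  have hsplit : Ioi (0 : ℝ) = Ioc 0 ρ ∪ Ioi ρ := (Ioc_union_Ioi_eq_Ioi hρ.le).symm
  rw [hsplit, lintegral_union measurableSet_Ioi (by
    rw [Set.disjoint_left]; intro r hr hr'; exact absurd hr.2 (not_le.2 hr'))]
  have h1 : ∫⁻ r in Ioc 0 ρ, ENNReal.ofReal l * ENNReal.ofReal r ^ (-l - 1) *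
      μ (Metric.ball x (min r ρ)) ≤
      ∫⁻ r in Ioc 0 ρ, ENNReal.ofReal l * A * ENNReal.ofReal r ^ (D - l - 1) := by
    refine setLIntegral_mono' measurableSet_Ioc fun r hr => ?_
    rw [min_eq_left hr.2]
    refine (mul_le_mul_right (h r hr.1) _).trans_eq ?_
    have e : D - l - 1 = (-l - 1) + D := by ring
    rw [e, ENNReal.rpow_add _ _ (by simpa using hr.1) ENNReal.ofReal_ne_top]
    ring
  have h2 : ∫⁻ r in Ioi ρ, ENNReal.ofReal l * ENNReal.ofReal r ^ (-l - 1) *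
      μ (Metric.ball x (min r ρ)) ≤
      ∫⁻ r in Ioi ρ, ENNReal.ofReal l * (A * ENNReal.ofReal ρ ^ D) *
        ENNReal.ofReal r ^ (-l - 1) := by
    refine setLIntegral_mono' measurableSet_Ioi fun r hr => ?_
    rw [min_eq_right (le_of_lt hr)]
    refine (mul_le_mul_right (h ρ hρ) _).trans_eq ?_
    ring
  refine (add_le_add h1 h2).trans_eq ?_
  rw [lintegral_const_mul _ (measurable_ofReal_rpow _), lintegral_const_mul _
    (measurable_ofReal_rpow _), setLIntegral_Ioc_rpow hρ (by linarith),
    setLIntegral_Ioi_rpow hρ (by linarith)]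
  have e1 : D - l - 1 + 1 = D - l := by ring
  have e2 : -l - 1 + 1 = -l := by ring
  have e3 : ENNReal.ofReal ρ ^ D * ENNReal.ofReal ρ ^ (-l) = ENNReal.ofReal ρ ^ (D - l) := by
    rw [← ENNReal.rpow_add _ _ (by simpa using hρ) ENNReal.ofReal_ne_top, sub_eq_add_neg]
  have e4 : ENNReal.ofReal (D * (D - l)⁻¹) =
      ENNReal.ofReal l * ENNReal.ofReal (D - l)⁻¹ + ENNReal.ofReal l * ENNReal.ofReal l⁻¹ := by
    have : 0 < D - l := by linarith
    rw [← ENNReal.ofReal_mul hl0.le, ← ENNReal.ofReal_mul hl0.le, ← ENNReal.ofReal_add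
      (by positivity) (by positivity)]
    congr 1
    field_simp
    ring
  rw [e1, e2, neg_neg, e4, ← e3]
  ring

end growth

/-! ### The fractionally normalised Hardy–Littlewood maximal function -/

section maximal

variable {X : Type*} [PseudoMetricSpace X] [MeasurableSpace X]

/-- The maximal function `sup_{r > 0} r^{-D} ∫_{B(x, r)} f dμ`. It is normalised by the power `r^D`
instead of the measure of the ball, so that it makes sense without any lower bound on `μ`. -/
noncomputable def maxFun (D : ℝ) (μ : Measure X) (f : X → ℝ≥0∞) (x : X) : ℝ≥0∞ :=
  ⨆ r : Ioi (0 : ℝ), ENNReal.ofReal (r : ℝ) ^ (-D) * ∫⁻ y in Metric.ball x r, f y ∂μ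

variable {D : ℝ} {μ : Measure X} {f : X → ℝ≥0∞}

theorem ofReal_rpow_neg_mul_cancel {r : ℝ} (hr : 0 < r) (D : ℝ) :
    ENNReal.ofReal r ^ D * ENNReal.ofReal r ^ (-D) = 1 := by
  rw [← ENNReal.rpow_add _ _ (by simpa using hr) ENNReal.ofReal_ne_top, add_neg_cancel,
    ENNReal.rpow_zero]

theorem ofReal_rpow_neg_mul_le_iff {r : ℝ} (hr : 0 < r) {D : ℝ} {a b : ℝ≥0∞} :
    ENNReal.ofReal r ^ (-D) * a ≤ b ↔ a ≤ b * ENNReal.ofReal r ^ D := by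
  have h1 := ofReal_rpow_neg_mul_cancel hr D
  have h2 : ENNReal.ofReal r ^ (-D) * ENNReal.ofReal r ^ D = 1 := by rw [mul_comm, h1]
  constructor
  · intro h
    calc a = ENNReal.ofReal r ^ (-D) * a * ENNReal.ofReal r ^ D := by
          rw [mul_right_comm, h2, one_mul]
      _ ≤ _ := by gcongr
  · intro h
    calc _ ≤ ENNReal.ofReal r ^ (-D) * (b * ENNReal.ofReal r ^ D) := by gcongr
      _ = b := by rw [mul_left_comm, h2, mul_one]

theorem setLIntegral_ball_le_maxFun (D : ℝ) (μ : Measure X) (f : X → ℝ≥0∞) (x : X) {r : ℝ}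
    (hr : 0 < r) :
    ∫⁻ y in Metric.ball x r, f y ∂μ ≤ maxFun D μ f x * ENNReal.ofReal r ^ D :=
  (ofReal_rpow_neg_mul_le_iff hr).1
    (le_iSup (fun r : Ioi (0 : ℝ) => ENNReal.ofReal (r : ℝ) ^ (-D) *
      ∫⁻ y in Metric.ball x r, f y ∂μ) ⟨r, hr⟩)

theorem maxFun_le {x : X} {b : ℝ≥0∞}
    (h : ∀ r : ℝ, 0 < r → ∫⁻ y in Metric.ball x r, f y ∂μ ≤ b * ENNReal.ofReal r ^ D) :
    maxFun D μ f x ≤ b :=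
  iSup_le fun r => (ofReal_rpow_neg_mul_le_iff r.2).2 (h r r.2)

theorem withDensity_ball_le_maxFun [OpensMeasurableSpace X] (D : ℝ) (μ : Measure X)
    (f : X → ℝ≥0∞) (x : X) {r : ℝ} (hr : 0 < r) :
    μ.withDensity f (Metric.ball x r) ≤ maxFun D μ f x * ENNReal.ofReal r ^ D := by
  rw [withDensity_apply _ Metric.isOpen_ball.measurableSet]
  exact setLIntegral_ball_le_maxFun D μ f x hr

theorem ae_eq_zero_of_maxFun_eq_zero [OpensMeasurableSpace X] (hf : Measurable f) {x : X}
    (h : maxFun D μ f x = 0) : f =ᵐ[μ] 0 := by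
  have h1 : ∀ k : ℕ, ∫⁻ y in Metric.ball x (k + 1 : ℝ), f y ∂μ = 0 := fun k => by
    have := setLIntegral_ball_le_maxFun D μ f x (r := k + 1) (by positivity)
    rw [h, zero_mul] at this
    exact le_antisymm this zero_le
  have h2 : ∫⁻ y in ⋃ k : ℕ, Metric.ball x (k + 1 : ℝ), f y ∂μ = 0 := by
    refine le_antisymm ((lintegral_iUnion_le _ _).trans_eq ?_) zero_le
    simp [h1]
  have h3 : (⋃ k : ℕ, Metric.ball x (k + 1 : ℝ)) = univ := by
    refine eq_univ_of_forall fun y => mem_iUnion.2 ?_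
    obtain ⟨k, hk⟩ := exists_nat_gt (dist y x)
    exact ⟨k, Metric.mem_ball.2 (by linarith)⟩
  rw [h3, setLIntegral_univ, lintegral_eq_zero_iff hf] at h2
  exact h2

theorem maxFun_mono {g : X → ℝ≥0∞} (h : ∀ x, f x ≤ g x) (x : X) :
    maxFun D μ f x ≤ maxFun D μ g x :=
  iSup_mono fun r => by gcongr with y; exact h y

theorem maxFun_add_le [OpensMeasurableSpace X] {g : X → ℝ≥0∞} (hf : Measurable f) (x : X) :
    maxFun D μ (fun y => f y + g y) x ≤ maxFun D μ f x + maxFun D μ g x := by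
  refine iSup_le fun r => ?_
  rw [lintegral_add_left hf, mul_add]
  exact add_le_add (le_iSup (fun r : Ioi (0 : ℝ) => ENNReal.ofReal (r : ℝ) ^ (-D) *
      ∫⁻ y in Metric.ball x r, f y ∂μ) r) (le_iSup (fun r : Ioi (0 : ℝ) =>
      ENNReal.ofReal (r : ℝ) ^ (-D) * ∫⁻ y in Metric.ball x r, g y ∂μ) r)

/-- Integrals over open balls of a fixed radius depend lower semicontinuously on the centre. -/
theorem lowerSemicontinuous_setLIntegral_ball [OpensMeasurableSpace X] (r : ℝ) :
    LowerSemicontinuous fun x => ∫⁻ y in Metric.ball x r, f y ∂μ := by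
  rw [lowerSemicontinuous_iff_isOpen_preimage]
  intro c
  rw [Metric.isOpen_iff]
  intro x hx
  have hU : Metric.ball x r = ⋃ k : ℕ, Metric.ball x (r - 1 / (k + 1 : ℝ)) := by
    ext y
    simp only [Metric.mem_ball, mem_iUnion]
    constructor
    · intro h
      obtain ⟨k, hk⟩ := exists_nat_one_div_lt (sub_pos.2 h)
      exact ⟨k, by linarith⟩
    · rintro ⟨k, hk⟩
      have : (0 : ℝ) < 1 / (k + 1 : ℝ) := by positivity
      linarith
  have hmono : Monotone fun k : ℕ => Metric.ball x (r - 1 / (k + 1 : ℝ)) := fun i j hij =>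
    Metric.ball_subset_ball (sub_le_sub_left (Nat.one_div_le_one_div hij) r)
  have h1 : ∫⁻ y in Metric.ball x r, f y ∂μ =
      ⨆ k : ℕ, ∫⁻ y in Metric.ball x (r - 1 / (k + 1 : ℝ)), f y ∂μ := by
    have h2 := hmono.measure_iUnion (μ := μ.withDensity f)
    rw [← hU] at h2
    simpa only [withDensity_apply _ Metric.isOpen_ball.measurableSet] using h2
  have hx' : c < ∫⁻ y in Metric.ball x r, f y ∂μ := hx
  rw [h1, lt_iSup_iff] at hx'
  obtain ⟨k, hk⟩ := hx'
  refine ⟨1 / (k + 1 : ℝ), by positivity, fun z hz => hk.trans_le (lintegral_mono_set ?_)⟩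
  refine Metric.ball_subset_ball' ?_
  rw [Metric.mem_ball, dist_comm] at hz
  linarith

theorem measurable_maxFun [OpensMeasurableSpace X] : Measurable (maxFun D μ f) := by
  refine LowerSemicontinuous.measurable ?_
  refine lowerSemicontinuous_iSup fun r => ?_
  exact (ENNReal.continuous_const_mul (ENNReal.rpow_ne_top_of_ne_zero
    (by have := r.2; rw [mem_Ioi] at this; simpa using this)
      ENNReal.ofReal_ne_top)).comp_lowerSemicontinuous
      (lowerSemicontinuous_setLIntegral_ball _) (fun a b h => mul_le_mul_right h _)

/-- The weighted weak-type `(1,1)` inequality of Fefferman and Stein, by Vitali's covering lemma: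
the weight on the right is the maximal function of the weight on the left. -/
theorem setLIntegral_maxFun_lt_le [SecondCountableTopology X] [OpensMeasurableSpace X] (hD : 0 ≤ D)
    (hf : Measurable f) (w : X → ℝ≥0∞) (c : ℝ≥0∞) :
    c * (μ.withDensity w) {x | c < maxFun D μ f x} ≤
      ENNReal.ofReal 6 ^ D * ∫⁻ x, f x * maxFun D μ w x ∂μ := by
  -- points at which some ball of radius at most `k` exceeds the level
  set E : ℕ → Set X := fun k => {x | ∃ r : ℝ, 0 < r ∧ r ≤ k ∧
    c * ENNReal.ofReal r ^ D < ∫⁻ y in Metric.ball x r, f y ∂μ} with hE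
  have hEU : {x | c < maxFun D μ f x} ⊆ ⋃ k, E k := by
    intro x hx
    obtain ⟨r, hr⟩ := lt_iSup_iff.1 (show c < maxFun D μ f x from hx)
    obtain ⟨k, hk⟩ := exists_nat_ge (r : ℝ)
    refine mem_iUnion.2 ⟨k, r, r.2, hk, ?_⟩
    by_contra h
    exact absurd ((ofReal_rpow_neg_mul_le_iff r.2).2 (not_lt.1 h)) (not_le.2 hr)
  have hEm : Monotone E := fun i j hij x ⟨r, h1, h2, h3⟩ =>
    ⟨r, h1, h2.trans (by exact_mod_cast hij), h3⟩
  refine (mul_le_mul_right (measure_mono hEU) c).trans ?_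
  rw [hEm.measure_iUnion, ENNReal.mul_iSup]
  refine iSup_le fun k => ?_
  choose! r hr0 hrk hr using fun (x : X) (hx : x ∈ E k) => hx
  obtain ⟨u, huE, hdisj, hcov⟩ := Vitali.exists_disjoint_subfamily_covering_enlargement_ball (E k)
    (fun x => x) r k hrk 5 (by norm_num)
  have hcount : u.Countable := by
    refine hdisj.countable_of_isOpen (fun x _ => Metric.isOpen_ball) fun x hx => ?_
    exact Metric.nonempty_ball.2 (hr0 x (huE hx))
  have hsub : E k ⊆ ⋃ x ∈ u, Metric.ball x (5 * r x) := fun x hx => by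
    obtain ⟨b, hb, hxb⟩ := hcov x hx
    exact mem_iUnion₂.2 ⟨b, hb, hxb (Metric.mem_ball_self (hr0 x hx))⟩
  have hball : ∀ x ∈ u, c * (μ.withDensity w) (Metric.ball x (5 * r x)) ≤
      ENNReal.ofReal 6 ^ D * ∫⁻ y in Metric.ball x (r x), f y * maxFun D μ w y ∂μ := by
    intro x hx
    have hrx := hr0 x (huE hx)
    -- every point of the small ball sees the enlarged ball within distance `6 r`
    have h1 : ∀ y ∈ Metric.ball x (r x), (μ.withDensity w) (Metric.ball x (5 * r x)) ≤
        maxFun D μ w y * ENNReal.ofReal (6 * r x) ^ D := by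
      intro y hy
      refine (measure_mono ?_).trans (withDensity_ball_le_maxFun D μ w y (r := 6 * r x)
        (by positivity))
      refine Metric.ball_subset_ball' ?_
      rw [Metric.mem_ball, dist_comm] at hy
      linarith
    have hp0 : ENNReal.ofReal (r x) ^ D ≠ 0 := by
      simp [ENNReal.rpow_eq_zero_iff, hrx, hD.not_gt]
    have hpT : ENNReal.ofReal (r x) ^ D ≠ ∞ :=
        ENNReal.rpow_ne_top_of_nonneg hD ENNReal.ofReal_ne_top
    refine (ENNReal.mul_le_mul_iff_left hp0 hpT).1 ?_
    calc c * (μ.withDensity w) (Metric.ball x (5 * r x)) * ENNReal.ofReal (r x) ^ D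
        = c * ENNReal.ofReal (r x) ^ D * (μ.withDensity w) (Metric.ball x (5 * r x)) := by ring
      _ ≤ (∫⁻ y in Metric.ball x (r x), f y ∂μ) *
            (μ.withDensity w) (Metric.ball x (5 * r x)) := by
          gcongr; exact (hr x (huE hx)).le
      _ = ∫⁻ y in Metric.ball x (r x), f y *
            (μ.withDensity w) (Metric.ball x (5 * r x)) ∂μ := (lintegral_mul_const _ hf).symm
      _ ≤ ∫⁻ y in Metric.ball x (r x), f y * maxFun D μ w y *
            ENNReal.ofReal (6 * r x) ^ D ∂μ := by
          refine setLIntegral_mono' Metric.isOpen_ball.measurableSet fun y hy => ?_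
          rw [mul_assoc]
          exact mul_le_mul_right (h1 y hy) _
      _ = _ := by
          have hm : Measurable fun y => f y * maxFun D μ w y := hf.mul measurable_maxFun
          rw [lintegral_mul_const _ hm, ENNReal.ofReal_mul (by norm_num),
            ENNReal.mul_rpow_of_nonneg _ _ hD]
          ring
  calc c * (μ.withDensity w) (E k) ≤ c * ∑' x : u, (μ.withDensity w) (Metric.ball x (5 * r x)) := by
        gcongr
        exact (measure_mono hsub).trans (measure_biUnion_le _ hcount _)
    _ = ∑' x : u, c * (μ.withDensity w) (Metric.ball x (5 * r x)) := ENNReal.tsum_mul_left.symm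
    _ ≤ ∑' x : u, ENNReal.ofReal 6 ^ D * ∫⁻ y in Metric.ball (x : X) (r x),
          f y * maxFun D μ w y ∂μ := ENNReal.tsum_le_tsum fun x => hball x x.2
    _ = ENNReal.ofReal 6 ^ D * ∑' x : u, ∫⁻ y in Metric.ball (x : X) (r x),
          f y * maxFun D μ w y ∂μ := ENNReal.tsum_mul_left
    _ = ENNReal.ofReal 6 ^ D * ∫⁻ y in ⋃ x ∈ u, Metric.ball x (r x), f y * maxFun D μ w y ∂μ := by
        rw [lintegral_biUnion hcount (fun x _ => Metric.isOpen_ball.measurableSet) hdisj]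
    _ ≤ _ := by gcongr; exact Measure.restrict_le_self

/-- The weighted maximal inequality
`∫ (Mf)^q w ≤ C ∫ f^q Mw` for `1 < q < ∞`, when balls of radius `r` have measure at most `A r^D`. -/
theorem exists_lintegral_maxFun_rpow_mul_le [SecondCountableTopology X] [OpensMeasurableSpace X]
    [SFinite μ] (hD : 0 ≤ D) {q : ℝ} (hq : 1 < q) {A : ℝ≥0} (hA : 0 < A)
    (hμ : ∀ (x : X) (r : ℝ), 0 < r → μ (Metric.ball x r) ≤ A * ENNReal.ofReal r ^ D) :
    ∃ C : ℝ≥0, ∀ f w : X → ℝ≥0∞, Measurable f → Measurable w →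
      ∫⁻ x, maxFun D μ f x ^ q * w x ∂μ ≤ C * ∫⁻ x, f x ^ q * maxFun D μ w x ∂μ := by
  have hq0 : 0 < q := one_pos.trans hq
  have hq1 : 0 < q - 1 := sub_pos.2 hq
  have hA2 : (2 * A : ℝ≥0∞) ≠ ∞ := ENNReal.mul_ne_top (by simp) (by simp)
  set C : ℝ≥0∞ := ENNReal.ofReal q * ENNReal.ofReal (q - 1)⁻¹ * (2 * ENNReal.ofReal 6 ^ D) *
    (2 * A) ^ (q - 1) with hC
  have hCT : C ≠ ∞ := by
    refine ENNReal.mul_ne_top (ENNReal.mul_ne_top (ENNReal.mul_ne_top (by simp) (by simp))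
      (ENNReal.mul_ne_top (by simp) (ENNReal.rpow_ne_top_of_nonneg hD (by simp))))
      (ENNReal.rpow_ne_top_of_nonneg hq1.le hA2)
  refine ⟨C.toNNReal, fun f w hf hw => ?_⟩
  rw [ENNReal.coe_toNNReal hCT]
  have hfw : Measurable fun x => f x * maxFun D μ w x := hf.mul measurable_maxFun
  set m := μ.withDensity fun x => f x * maxFun D μ w x with hm
  -- only the part of `f` above a multiple of the level contributes to the level set
  have hlevel : ∀ r : ℝ, 0 < r → ENNReal.ofReal r * (μ.withDensity w)
      {x | ENNReal.ofReal r < maxFun D μ f x} ≤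
      2 * ENNReal.ofReal 6 ^ D * m {x | ENNReal.ofReal r < 2 * A * f x} := by
    intro r hr
    set S := {x | ENNReal.ofReal r < 2 * A * f x} with hS
    have hSm : MeasurableSet S := measurableSet_lt measurable_const (hf.const_mul _)
    have hlow : ∀ x, maxFun D μ (Sᶜ.indicator f) x ≤ ENNReal.ofReal (r / 2) := by
      intro x
      refine maxFun_le fun s hs => ?_
      calc ∫⁻ y in Metric.ball x s, Sᶜ.indicator f y ∂μ
          ≤ ∫⁻ y in Metric.ball x s, ENNReal.ofReal r / (2 * A) ∂μ := by
            refine lintegral_mono fun y => ?_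
            by_cases hy : y ∈ S
            · rw [indicator_of_notMem (by simpa using hy)]; exact zero_le
            · rw [indicator_of_mem (by simpa using hy)]
              rw [ENNReal.le_div_iff_mul_le (Or.inl (by simp [hA.ne'])) (Or.inl hA2), mul_comm]
              exact not_lt.1 hy
        _ = ENNReal.ofReal r / (2 * A) * μ (Metric.ball x s) := by simp
        _ ≤ ENNReal.ofReal r / (2 * A) * (A * ENNReal.ofReal s ^ D) := by gcongr; exact hμ x s hs
        _ = _ := by
            rw [ENNReal.div_eq_inv_mul, ENNReal.mul_inv (by simp) (by simp),
              ENNReal.ofReal_div_of_pos two_pos, ENNReal.div_eq_inv_mul, ENNReal.ofReal_ofNat]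
            have : (A : ℝ≥0∞)⁻¹ * A = 1 := ENNReal.inv_mul_cancel (by simp [hA.ne']) (by simp)
            calc _ = (2 : ℝ≥0∞)⁻¹ * ENNReal.ofReal r * ((A : ℝ≥0∞)⁻¹ * A) *
                  ENNReal.ofReal s ^ D := by ring
              _ = _ := by rw [this, mul_one]
    have hsub : {x | ENNReal.ofReal r < maxFun D μ f x} ⊆
        {x | ENNReal.ofReal (r / 2) < maxFun D μ (S.indicator f) x} := by
      intro x hx
      by_contra h
      have h1 : maxFun D μ f x ≤ ENNReal.ofReal r := by
        calc maxFun D μ f x ≤ maxFun D μ (fun y => S.indicator f y + Sᶜ.indicator f y) x :=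
              maxFun_mono (fun y => by rw [indicator_self_add_compl_apply]) x
          _ ≤ _ := maxFun_add_le (hf.indicator hSm) x
          _ ≤ ENNReal.ofReal (r / 2) + ENNReal.ofReal (r / 2) :=
              add_le_add (not_lt.1 h) (hlow x)
          _ = ENNReal.ofReal r := by
              rw [← ENNReal.ofReal_add (by positivity) (by positivity), add_halves]
      exact absurd hx (not_lt.2 h1)
    have hweak := setLIntegral_maxFun_lt_le (μ := μ) hD (hf.indicator hSm) w
      (ENNReal.ofReal (r / 2))
    have hmS : m S = ∫⁻ x, S.indicator f x * maxFun D μ w x ∂μ := by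
      rw [hm, withDensity_apply _ hSm, ← lintegral_indicator hSm]
      refine lintegral_congr fun x => ?_
      by_cases hx : x ∈ S <;> simp [hx]
    calc ENNReal.ofReal r * (μ.withDensity w) {x | ENNReal.ofReal r < maxFun D μ f x}
        ≤ ENNReal.ofReal r * (μ.withDensity w)
            {x | ENNReal.ofReal (r / 2) < maxFun D μ (S.indicator f) x} := by gcongr
      _ = 2 * (ENNReal.ofReal (r / 2) * (μ.withDensity w)
            {x | ENNReal.ofReal (r / 2) < maxFun D μ (S.indicator f) x}) := by
          rw [← mul_assoc]
          congr 1
          rw [← ENNReal.ofReal_ofNat 2, ← ENNReal.ofReal_mul (by norm_num)]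
          congr 1
          ring
      _ ≤ 2 * (ENNReal.ofReal 6 ^ D * m S) := by rw [hmS]; gcongr
      _ = _ := by ring
  calc ∫⁻ x, maxFun D μ f x ^ q * w x ∂μ
      = ∫⁻ x, maxFun D μ f x ^ q ∂(μ.withDensity w) := by
        rw [lintegral_withDensity_eq_lintegral_mul _ hw (measurable_maxFun.pow_const _)]
        exact lintegral_congr fun x => mul_comm _ _
    _ = ∫⁻ r in Ioi (0 : ℝ), ENNReal.ofReal q * ENNReal.ofReal r ^ (q - 1) *
          (μ.withDensity w) {x | ENNReal.ofReal r < maxFun D μ f x} :=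
        lintegral_rpow_eq_lintegral_measure hq0 measurable_maxFun
    _ ≤ ∫⁻ r in Ioi (0 : ℝ), ENNReal.ofReal q * ENNReal.ofReal (q - 1)⁻¹ *
          (2 * ENNReal.ofReal 6 ^ D) * (ENNReal.ofReal (q - 1) * ENNReal.ofReal r ^ (q - 1 - 1) *
            m {x | ENNReal.ofReal r < 2 * A * f x}) := by
        refine setLIntegral_mono' measurableSet_Ioi fun r hr => ?_
        have hr : 0 < r := hr
        have e : ENNReal.ofReal r ^ (q - 1) = ENNReal.ofReal r ^ (q - 1 - 1) *
            ENNReal.ofReal r := by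
          nth_rewrite 3 [← ENNReal.rpow_one (ENNReal.ofReal r)]
          rw [← ENNReal.rpow_add _ _ (by simpa using hr) ENNReal.ofReal_ne_top, sub_add_cancel]
        have e2 : ENNReal.ofReal (q - 1)⁻¹ * ENNReal.ofReal (q - 1) = 1 := by
          rw [← ENNReal.ofReal_mul (by positivity), inv_mul_cancel₀ hq1.ne', ENNReal.ofReal_one]
        calc _ = ENNReal.ofReal q * ENNReal.ofReal r ^ (q - 1 - 1) * (ENNReal.ofReal r *
              (μ.withDensity w) {x | ENNReal.ofReal r < maxFun D μ f x}) := by rw [e]; ring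
          _ ≤ ENNReal.ofReal q * ENNReal.ofReal r ^ (q - 1 - 1) *
              (2 * ENNReal.ofReal 6 ^ D * m {x | ENNReal.ofReal r < 2 * A * f x}) := by
              exact mul_le_mul_right (hlevel r hr) _
          _ = ENNReal.ofReal q * (ENNReal.ofReal (q - 1)⁻¹ * ENNReal.ofReal (q - 1)) *
              ENNReal.ofReal r ^ (q - 1 - 1) *
              (2 * ENNReal.ofReal 6 ^ D * m {x | ENNReal.ofReal r < 2 * A * f x}) := by
              rw [e2, mul_one]
          _ = _ := by ring
    _ = ENNReal.ofReal q * ENNReal.ofReal (q - 1)⁻¹ * (2 * ENNReal.ofReal 6 ^ D) *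
          ∫⁻ x, (2 * A * f x) ^ (q - 1) ∂m := by
        rw [lintegral_const_mul' _ _ (ENNReal.mul_ne_top (ENNReal.mul_ne_top (by simp) (by simp))
          (ENNReal.mul_ne_top (by simp) (ENNReal.rpow_ne_top_of_nonneg hD (by simp)))),
          ← lintegral_rpow_eq_lintegral_measure hq1 (hf.const_mul _)]
    _ = _ := by
        rw [hm, lintegral_withDensity_eq_lintegral_mul _ hfw ((hf.const_mul _).pow_const _), hC,
          mul_assoc _ ((2 * (A : ℝ≥0∞)) ^ (q - 1)), ← lintegral_const_mul' _ _
            (ENNReal.rpow_ne_top_of_nonneg hq1.le hA2)]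
        congr 1
        refine lintegral_congr fun x => ?_
        have e : f x ^ q = f x * f x ^ (q - 1) := by
          nth_rewrite 2 [← ENNReal.rpow_one (f x)]
          rw [← ENNReal.rpow_add_of_nonneg _ _ zero_le_one hq1.le, add_sub_cancel]
        rw [Pi.mul_apply, ENNReal.mul_rpow_of_nonneg _ _ hq1.le, e]
        ring

end maximal

/-! ### One-dimensional estimates -/

theorem Real.volume_ball_le (x r : ℝ) :
    volume (Metric.ball x r) ≤ ((2 : ℝ≥0) : ℝ≥0∞) * ENNReal.ofReal r ^ (1 : ℝ) := by
  rw [Real.volume_ball, ENNReal.ofReal_mul zero_le_two, ENNReal.rpow_one]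
  simp

theorem maxFun_one_le (t : ℝ) : maxFun 1 (volume : Measure ℝ) 1 t ≤ 2 :=
  maxFun_le fun r _ => by simp

/-- The Hardy–Littlewood maximal theorem on the line. -/
theorem exists_lpn_maxFun_le {θ : ℝ} (h0 : 0 < θ) (h1 : θ < 1) :
    ∃ C : ℝ≥0, ∀ F : ℝ → ℝ≥0∞, Measurable F →
      lpn θ volume (maxFun 1 volume F) ≤ C * lpn θ volume F := by
  obtain ⟨C, hC⟩ := exists_lintegral_maxFun_rpow_mul_le (μ := (volume : Measure ℝ)) zero_le_one
    ((one_lt_inv₀ h0).2 h1) two_pos (fun x r _ => Real.volume_ball_le x r)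
  refine ⟨(C * 2) ^ θ, fun F hF => ?_⟩
  have h := hC F 1 hF measurable_one
  simp only [Pi.one_apply, mul_one] at h
  rw [lpn_of_pos h0, lpn_of_pos h0, ENNReal.coe_rpow_of_nonneg _ h0.le,
    ← ENNReal.mul_rpow_of_nonneg _ _ h0.le]
  refine ENNReal.rpow_le_rpow (h.trans ?_) h0.le
  rw [ENNReal.coe_mul, mul_assoc]
  gcongr
  rw [← lintegral_const_mul _ (hF.pow_const _)]
  refine lintegral_mono fun t => ?_
  rw [mul_comm]
  gcongr
  exact maxFun_one_le t

theorem setLIntegral_ball_edist_rpow_mul_le_maxFun {l ρ : ℝ} (h0 : 0 ≤ l) (h1 : l < 1) (hρ : 0 < ρ)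
    {F : ℝ → ℝ≥0∞} (hF : Measurable F) (t : ℝ) :
    ∫⁻ s in Metric.ball t ρ, edist s t ^ (-l) * F s ≤
      ENNReal.ofReal (1 - l)⁻¹ * maxFun 1 volume F t * ENNReal.ofReal ρ ^ (1 - l) := by
  have := setLIntegral_ball_edist_rpow_neg_le (μ := (volume : Measure ℝ).withDensity F) h0 h1 hρ
    (fun r hr => withDensity_ball_le_maxFun 1 volume F t hr)
  rw [restrict_withDensity Metric.isOpen_ball.measurableSet,
    lintegral_withDensity_eq_lintegral_mul _ hF ((measurable_edist_const t).pow_const _),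
    one_mul] at this
  simpa only [Pi.mul_apply, mul_comm] using this

theorem lintegral_add_edist_rpow_mul_le_maxFun {l ρ : ℝ} (hl : 1 < l) (hρ : 0 < ρ)
    {F : ℝ → ℝ≥0∞} (hF : Measurable F) (t : ℝ) :
    ∫⁻ s, (ENNReal.ofReal ρ + edist s t) ^ (-l) * F s ≤
      ENNReal.ofReal (l * (l - 1)⁻¹) * maxFun 1 volume F t * ENNReal.ofReal ρ ^ (1 - l) := by
  have := lintegral_add_edist_rpow_neg_le (μ := (volume : Measure ℝ).withDensity F) one_pos hl hρ
    (fun r hr => withDensity_ball_le_maxFun 1 volume F t hr)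
  rw [lintegral_withDensity_eq_lintegral_mul _ hF
    (((measurable_edist_const t).const_add _).pow_const _)] at this
  simpa only [Pi.mul_apply, mul_comm] using this

theorem ENNReal.rpow_neg_le_rpow_neg {a b : ℝ≥0∞} {l : ℝ} (hl : 0 ≤ l) (h : a ≤ b) :
    b ^ (-l) ≤ a ^ (-l) := by
  rw [ENNReal.rpow_neg, ENNReal.rpow_neg]
  exact ENNReal.inv_le_inv.2 (ENNReal.rpow_le_rpow h hl)

/-- `b ≤ 2a` gives `a^{-l} ≤ 2^l b^{-l}`. -/
theorem ENNReal.rpow_neg_le_two_rpow_mul {a b : ℝ≥0∞} {l : ℝ} (hl : 0 ≤ l) (h : b ≤ 2 * a) :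
    a ^ (-l) ≤ 2 ^ l * b ^ (-l) := by
  have h1 := ENNReal.rpow_neg_le_rpow_neg hl h
  rw [ENNReal.rpow_neg (2 * a), ENNReal.mul_rpow_of_nonneg _ _ hl,
    ENNReal.mul_inv (Or.inl (by simp)) (Or.inl (by simp)), ← ENNReal.rpow_neg a] at h1
  calc a ^ (-l) = 2 ^ l * ((2 ^ l)⁻¹ * a ^ (-l)) := by
        rw [← mul_assoc, ENNReal.mul_inv_cancel (by simp) (by simp), one_mul]
    _ ≤ _ := by gcongr

/-- The Hardy–Littlewood–Sobolev inequality on the line, by Hedberg's argument. -/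
theorem exists_lpn_lintegral_edist_rpow_le {θp θs : ℝ} (hs : 0 < θs) (hsp : θs < θp)
    (hp : θp < 1) :
    ∃ C : ℝ≥0, ∀ F : ℝ → ℝ≥0∞, Measurable F →
      lpn θs volume (fun t => ∫⁻ s, edist s t ^ (-(1 + θs - θp)) * F s) ≤ C * lpn θp volume F := by
  set κ := 1 + θs - θp with hκ
  have hp0 : 0 < θp := hs.trans hsp
  have hκ0 : 0 < κ := by linarith
  have hκ1 : κ < 1 := by linarith
  obtain ⟨CM, hCM⟩ := exists_lpn_maxFun_le hp0 hp
  have h1p : 0 < 1 - θp := by linarith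
  have hκp : 1 < κ * (1 - θp)⁻¹ := by
    rw [← div_eq_mul_inv, one_lt_div h1p]; linarith
  set l := κ * (1 - θp)⁻¹ with hl
  set C1 : ℝ≥0 := (1 - κ)⁻¹.toNNReal with hC1
  set C2 : ℝ≥0 := 2 ^ κ * ((l * (l - 1)⁻¹).toNNReal * 2) ^ (1 - θp) with hC2
  set φ := θs / θp with hφ
  have hφ0 : 0 < φ := by positivity
  have hφ1 : φ < 1 := (div_lt_one hp0).2 hsp
  refine ⟨2 * (C1 ^ φ * C2 ^ (1 - φ)) * CM ^ φ, fun F hF => ?_⟩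
  set Y := lpn θp volume F with hY
  -- Hedberg: split at distance `ρ` from `t`, bound the near part by the maximal function and the
  -- far part by Hölder's inequality, and optimise in `ρ`
  have hpt : ∀ t, ∫⁻ s, edist s t ^ (-κ) * F s ≤
      2 * ((C1 * maxFun 1 volume F t) ^ φ * (C2 * Y) ^ (1 - φ)) := by
    intro t
    have hzero : F =ᵐ[volume] 0 → ∫⁻ s, edist s t ^ (-κ) * F s = 0 := by
      intro h
      rw [← lintegral_zero (μ := (volume : Measure ℝ))]
      refine lintegral_congr_ae ?_
      filter_upwards [h] with s hs
      simp [hs]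
    have e1 : φ = θs / ((θp - θs) + θs) := by rw [sub_add_cancel]
    have e2 : 1 - φ = (θp - θs) / ((θp - θs) + θs) := by
      rw [sub_add_cancel, hφ]; field_simp
    rw [e2, e1]
    have hκe1 : ((1 - κ)⁻¹.toNNReal : ℝ≥0∞) ≠ 0 := by
      have : 0 < (1 - κ)⁻¹ := inv_pos.2 (by linarith)
      simpa using hκ1
    have hC2' : (C2 : ℝ≥0∞) ≠ 0 := by
      have : 0 < l * (l - 1)⁻¹ := by
        have : 0 < l - 1 := by linarith
        positivity
      have : 0 < (l * (l - 1)⁻¹).toNNReal := Real.toNNReal_pos.2 this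
      have : 0 < C2 := by positivity
      exact_mod_cast this.ne'
    refine le_two_mul_rpow_mul_rpow (by linarith) hs (fun ρ hρ => ?_) (fun h => ?_) fun h => ?_
    · rw [← lintegral_add_compl _ (Metric.isOpen_ball (x := t) (ε := ρ)).measurableSet]
      refine add_le_add ?_ ?_
      · refine (setLIntegral_ball_edist_rpow_mul_le_maxFun hκ0.le hκ1 hρ hF t).trans_eq ?_
        have : 1 - κ = θp - θs := by rw [hκ]; ring
        rw [hC1, this, mul_comm]
        rfl
      · have h3 : ∀ s ∈ (Metric.ball t ρ)ᶜ, edist s t ^ (-κ) * F s ≤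
            2 ^ κ * ((ENNReal.ofReal ρ + edist s t) ^ (-κ) * F s) := by
          intro s hs
          rw [← mul_assoc]
          gcongr
          refine ENNReal.rpow_neg_le_two_rpow_mul hκ0.le ?_
          rw [two_mul]
          gcongr
          rw [mem_compl_iff, Metric.mem_ball, ← edist_lt_ofReal, not_lt] at hs
          exact hs
        calc _ ≤ ∫⁻ s in (Metric.ball t ρ)ᶜ,
                2 ^ κ * ((ENNReal.ofReal ρ + edist s t) ^ (-κ) * F s) :=
              setLIntegral_mono' Metric.isOpen_ball.measurableSet.compl h3
          _ ≤ ∫⁻ s, 2 ^ κ * ((ENNReal.ofReal ρ + edist s t) ^ (-κ) * F s) :=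
              setLIntegral_le_lintegral _ _
          _ = 2 ^ κ * ∫⁻ s, (ENNReal.ofReal ρ + edist s t) ^ (-κ) * F s :=
              lintegral_const_mul' _ _ (by simp)
          _ ≤ 2 ^ κ * (lpn (1 - θp) volume (fun s => (ENNReal.ofReal ρ + edist s t) ^ (-κ)) *
              Y) := by
              gcongr
              exact lintegral_mul_le_lpn hp0 hp.le
                (((measurable_edist_const t).const_add _).pow_const _) hF
          _ ≤ 2 ^ κ * (((ENNReal.ofReal (l * (l - 1)⁻¹) * (2 : ℝ≥0)) *
                ENNReal.ofReal ρ ^ (1 - l)) ^ (1 - θp) * Y) := by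
              gcongr
              rw [lpn_of_pos h1p]
              refine ENNReal.rpow_le_rpow ?_ h1p.le
              simp_rw [← ENNReal.rpow_mul, neg_mul]
              exact lintegral_add_edist_rpow_neg_le one_pos hκp hρ
                (fun r _ => Real.volume_ball_le t r)
          _ = _ := by
              have h4 : (1 - l) * (1 - θp) = -θs := by
                rw [hl, sub_mul, mul_assoc, inv_mul_cancel₀ h1p.ne', hκ]; ring
              rw [ENNReal.mul_rpow_of_nonneg _ _ h1p.le, ← ENNReal.rpow_mul, h4, hC2,
                ENNReal.coe_mul, ENNReal.coe_rpow_of_nonneg _ h1p.le, ENNReal.coe_mul,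
                ENNReal.coe_rpow_of_nonneg _ hκ0.le]
              simp only [ENNReal.ofReal, ENNReal.coe_ofNat]
              ring
    · refine hzero (ae_eq_zero_of_maxFun_eq_zero (D := 1) hF (x := t) ?_)
      exact (mul_eq_zero.1 h).resolve_left hκe1
    · refine hzero (lpn_eq_zero hp0 hF ?_)
      exact (mul_eq_zero.1 h).resolve_left hC2'
  calc _ ≤ lpn θs volume (fun t => (2 * (C1 ^ φ * (C2 * Y) ^ (1 - φ))) *
          maxFun 1 volume F t ^ φ) := by
        refine lpn_mono fun t => (hpt t).trans_eq ?_
        rw [ENNReal.mul_rpow_of_nonneg _ _ hφ0.le]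
        ring
    _ ≤ (2 * (C1 ^ φ * (C2 * Y) ^ (1 - φ))) * (CM * Y) ^ φ := by
        rw [lpn_const_mul' _ _ (measurable_maxFun.pow_const _), lpn_rpow hs hφ0]
        have : θs / φ = θp := by rw [hφ]; field_simp
        rw [this]
        gcongr
        exact hCM F hF
    _ = _ := by
        have hY1 : Y ^ (1 - φ) * Y ^ φ = Y := by
          rw [← ENNReal.rpow_add_of_nonneg _ _ (by linarith) hφ0.le, sub_add_cancel,
            ENNReal.rpow_one]
        rw [ENNReal.mul_rpow_of_nonneg _ _ hφ0.le, ENNReal.mul_rpow_of_nonneg _ _ (by linarith)]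
        push_cast
        rw [ENNReal.coe_rpow_of_nonneg _ hφ0.le, ENNReal.coe_rpow_of_nonneg _ hφ0.le,
          ENNReal.coe_rpow_of_nonneg _ (by linarith)]
        calc _ = 2 * ((C1 : ℝ≥0∞) ^ φ * (C2 : ℝ≥0∞) ^ (1 - φ)) * (CM : ℝ≥0∞) ^ φ *
              (Y ^ (1 - φ) * Y ^ φ) := by ring
          _ = _ := by rw [hY1]

/-! ### Potentials on the cylinder: slices and the non-critical ranges -/

/-- Balls of radius `r` have measure at most `A r^N`. -/
def UpperRegular {S : Type*} [PseudoMetricSpace S] [MeasurableSpace S] (ν : Measure S) (N : ℝ)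
    (A : ℝ≥0) : Prop :=
  ∀ (x : S) (r : ℝ), 0 < r → ν (Metric.ball x r) ≤ A * ENNReal.ofReal r ^ N

/-- The potential `z ↦ ∫ d(w, z)^{-l} g(w) dw` on the cylinder `ℝ × S` with the maximum metric. -/
noncomputable def cylPot {S : Type*} [PseudoMetricSpace S] [MeasurableSpace S] (ν : Measure S)
    (l : ℝ) (g : ℝ × S → ℝ≥0∞) (z : ℝ × S) : ℝ≥0∞ :=
  ∫⁻ s, ∫⁻ ω, edist (s, ω) z ^ (-l) * g (s, ω) ∂ν

/-- The potential `cylPot` with a kernel that also decays quadratically along the axis. -/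
noncomputable def cylPotDecay {S : Type*} [PseudoMetricSpace S] [MeasurableSpace S] (ν : Measure S)
    (l : ℝ) (g : ℝ × S → ℝ≥0∞) (z : ℝ × S) : ℝ≥0∞ :=
  ∫⁻ s, ∫⁻ ω, (1 + edist s z.1) ^ (-2 : ℝ) * edist (s, ω) z ^ (-l) * g (s, ω) ∂ν

theorem ENNReal.rpow_neg_add_le {a b M : ℝ≥0∞} {l₁ l₂ : ℝ} (h1 : 0 ≤ l₁) (h2 : 0 ≤ l₂) (ha : a ≤ M)
    (hb : b ≤ M) (haT : a ≠ ∞) (hbT : b ≠ ∞) : M ^ (-(l₁ + l₂)) ≤ a ^ (-l₁) * b ^ (-l₂) := by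
  rw [ENNReal.rpow_neg, ENNReal.rpow_neg, ENNReal.rpow_neg, ENNReal.rpow_add_of_nonneg _ _ h1 h2,
    ← ENNReal.mul_inv (Or.inr (ENNReal.rpow_ne_top_of_nonneg h2 hbT))
      (Or.inl (ENNReal.rpow_ne_top_of_nonneg h1 haT)), ENNReal.inv_le_inv]
  gcongr

theorem ENNReal.rpow_neg_le_one {x : ℝ≥0∞} {l : ℝ} (hl : 0 ≤ l) (hx : 1 ≤ x) : x ^ (-l) ≤ 1 := by
  rw [ENNReal.rpow_neg, ENNReal.inv_le_one]
  simpa using ENNReal.rpow_le_rpow hx hl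

section cylinder

variable {S : Type*} [PseudoMetricSpace S] [MeasurableSpace S] [BorelSpace S]
  [SecondCountableTopology S] {ν : Measure S} [IsFiniteMeasure ν] {N : ℝ} {A : ℝ≥0}

/-- The norm over `S` of the kernel `(c + d)^{-l}`, regularised at the scale `c`. -/
theorem lpn_add_edist_rpow_le (hν : UpperRegular ν N A) (hN : 0 < N) {θ l : ℝ} (hθ : 0 ≤ θ)
    (hl : N * θ < l) :
    ∃ C : ℝ≥0, ∀ (x : S) (c : ℝ), 0 < c →
      lpn θ ν (fun y => (ENNReal.ofReal c + edist y x) ^ (-l)) ≤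
        C * ENNReal.ofReal c ^ (N * θ - l) := by
  have hl0 : 0 < l := lt_of_le_of_lt (by positivity) hl
  rcases hθ.eq_or_lt with rfl | hθ
  · refine ⟨1, fun x c hc => ?_⟩
    rw [ENNReal.coe_one, one_mul, mul_zero, zero_sub]
    exact lpn_le_of_forall_le fun y => ENNReal.rpow_neg_le_rpow_neg hl0.le le_self_add
  · have hl' : N < l * θ⁻¹ := by rwa [← div_eq_mul_inv, lt_div_iff₀ hθ]
    refine ⟨((l * θ⁻¹ * (l * θ⁻¹ - N)⁻¹).toNNReal * A) ^ θ, fun x c hc => ?_⟩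
    have := lintegral_add_edist_rpow_neg_le hN hl' hc (hν x)
    rw [lpn_of_pos hθ]
    simp_rw [← ENNReal.rpow_mul, neg_mul]
    refine (ENNReal.rpow_le_rpow this hθ.le).trans_eq ?_
    rw [ENNReal.mul_rpow_of_nonneg _ _ hθ.le, ← ENNReal.rpow_mul,
      ENNReal.coe_rpow_of_nonneg _ hθ.le, ENNReal.coe_mul]
    congr 2
    field_simp

/-- The norm over `S` of the kernel `d^{-l}` below the critical exponent; it is bounded because `S`
is. -/
theorem lpn_edist_rpow_le (hν : UpperRegular ν N A) (hN : 0 < N) (hS : ∀ x y : S, dist x y < 3)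
    {θ l : ℝ} (hθ : 0 ≤ θ) (hl0 : 0 ≤ l) (hl : l = 0 ∨ l < N * θ) :
    ∃ C : ℝ≥0, ∀ x : S, lpn θ ν (fun y => edist y x ^ (-l)) ≤ C := by
  rcases hθ.eq_or_lt with rfl | hθ
  · have hl1 : l = 0 := by
      rcases hl with h | h
      · exact h
      · linarith
    refine ⟨1, fun x => lpn_le_of_forall_le fun y => ?_⟩
    simp [hl1]
  · have hl' : l * θ⁻¹ < N := by
      rw [← div_eq_mul_inv, div_lt_iff₀ hθ]
      rcases hl with rfl | h
      · positivity
      · exact h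
    refine ⟨((N * (N - l * θ⁻¹)⁻¹).toNNReal * A * (Real.toNNReal 3) ^ (N - l * θ⁻¹)) ^ θ,
      fun x => ?_⟩
    have := setLIntegral_ball_edist_rpow_neg_le (by positivity) hl' three_pos (hν x)
    have hu : Metric.ball x 3 = univ := eq_univ_of_forall fun y => hS y x
    rw [hu, setLIntegral_univ] at this
    rw [lpn_of_pos hθ]
    simp_rw [← ENNReal.rpow_mul, neg_mul]
    refine (ENNReal.rpow_le_rpow this hθ.le).trans_eq ?_
    rw [ENNReal.coe_rpow_of_nonneg _ hθ.le, ENNReal.coe_mul, ENNReal.coe_mul,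
      ENNReal.coe_rpow_of_ne_zero (by simp)]
    rfl

theorem measurable_lpn_slice {θ : ℝ} (hθ : 0 < θ) {g : ℝ × S → ℝ≥0∞} (hg : Measurable g) :
    Measurable fun s => lpn θ ν (fun ω => g (s, ω)) := by
  simp_rw [lpn_of_pos hθ]
  exact ((hg.pow_const _).lintegral_prod_right').pow_const _

/-- Young's inequality on each slice, integrated along the axis by Minkowski's inequality. -/
theorem lpn_lintegral_slice_le {θm θp θq : ℝ} (hm0 : 0 ≤ θm) (hm1 : θm ≤ 1) (hp0 : 0 < θp)
    (hp1 : θp ≤ 1) (hq0 : 0 ≤ θq) (hq1 : θq ≤ 1) (hq : 1 + θq = θm + θp)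
    {K : ℝ → S → S → ℝ≥0∞} (hK : Measurable fun z : (ℝ × S) × S => K z.1.1 z.1.2 z.2)
    {κ : ℝ → ℝ≥0∞} (hκ : Measurable κ) (hrow : ∀ s θ, lpn θm ν (K s θ) ≤ κ s)
    (hcol : ∀ s ω, lpn θm ν (fun θ => K s θ ω) ≤ κ s) {g : ℝ × S → ℝ≥0∞} (hg : Measurable g) :
    lpn θq ν (fun θ => ∫⁻ s, ∫⁻ ω, K s θ ω * g (s, ω) ∂ν) ≤
      ∫⁻ s, κ s * lpn θp ν (fun ω => g (s, ω)) := by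
  have h1 : Measurable fun z : (ℝ × S) × S => K z.1.1 z.1.2 z.2 * g (z.1.1, z.2) :=
    hK.mul (hg.comp ((measurable_fst.comp measurable_fst).prodMk measurable_snd))
  have h2 : Measurable (Function.uncurry fun (θ : S) (s : ℝ) => ∫⁻ ω, K s θ ω * g (s, ω) ∂ν) :=
    (h1.lintegral_prod_right').comp measurable_swap
  refine lpn_lintegral_le hq0 hq1 h2 (hκ.mul (measurable_lpn_slice hp0 hg)) fun s => ?_
  refine lpn_kernel_le hm0 hm1 hp0 hp1 hq0 hq ?_ (hrow s) (hcol s) (hg.comp measurable_prodMk_left)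
  exact hK.comp ((measurable_const.prodMk measurable_fst).prodMk measurable_snd)

theorem measurable_edist_slice (t : ℝ) (l : ℝ) :
    Measurable fun z : (ℝ × S) × S => edist (z.1.1, z.2) (t, z.1.2) ^ (-l) := by
  refine Measurable.pow_const ?_ _
  exact ((measurable_fst.comp measurable_fst).prodMk measurable_snd).edist
    (measurable_const.prodMk (measurable_snd.comp measurable_fst))

theorem measurable_cylPot {l : ℝ} {g : ℝ × S → ℝ≥0∞} (hg : Measurable g) :
    Measurable (cylPot ν l g) := by
  have h1 : Measurable fun z : ((ℝ × S) × ℝ) × S =>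
      edist (z.1.2, z.2) z.1.1 ^ (-l) * g (z.1.2, z.2) := by
    have h2 : Measurable fun z : ((ℝ × S) × ℝ) × S => (z.1.2, z.2) :=
      (measurable_snd.comp measurable_fst).prodMk measurable_snd
    exact ((h2.edist (measurable_fst.comp measurable_fst)).pow_const _).mul (hg.comp h2)
  exact (h1.lintegral_prod_right').lintegral_prod_right'

theorem cylPotDecay_le_cylPot (l : ℝ) (g : ℝ × S → ℝ≥0∞) (z : ℝ × S) :
    cylPotDecay ν l g z ≤ cylPot ν l g z := by
  refine lintegral_mono fun s => lintegral_mono fun ω => ?_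
  rw [mul_assoc]
  exact mul_le_of_le_one_left' (ENNReal.rpow_neg_le_one zero_le_two le_self_add)

theorem edist_fst_le (z w : ℝ × S) : edist z.1 w.1 ≤ edist z w := le_max_left _ _

theorem edist_snd_le (z w : ℝ × S) : edist z.2 w.2 ≤ edist z w := le_max_right _ _

theorem edist_add_edist_le (z w : ℝ × S) : edist z.1 w.1 + edist z.2 w.2 ≤ 2 * edist z w := by
  rw [two_mul]
  exact add_le_add (edist_fst_le z w) (edist_snd_le z w)

/-- The `L^{1/θm}` norm of the kernel `d^{-l}` over a slice at distance `|s - t|`. -/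
theorem lpn_edist_slice_le (hν : UpperRegular ν N A) (hN : 0 < N) {θm l : ℝ} (hm : 0 ≤ θm)
    (hl : N * θm < l) :
    ∃ C : ℝ≥0, ∀ (s t : ℝ), s ≠ t → ∀ (x : S),
      lpn θm ν (fun y => edist (s, y) (t, x) ^ (-l)) ≤ C * edist s t ^ (-(l - N * θm)) := by
  have hl0 : 0 < l := lt_of_le_of_lt (by positivity) hl
  obtain ⟨C, hC⟩ := lpn_add_edist_rpow_le hν hN hm hl
  refine ⟨2 ^ l * C, fun s t hst x => ?_⟩
  have hd : 0 < dist s t := dist_pos.2 hst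
  calc _ ≤ lpn θm ν (fun y => 2 ^ l * (ENNReal.ofReal (dist s t) + edist y x) ^ (-l)) := by
        refine lpn_mono fun y => ENNReal.rpow_neg_le_two_rpow_mul hl0.le ?_
        rw [← edist_dist]
        exact edist_add_edist_le (s, y) (t, x)
    _ = 2 ^ l * lpn θm ν (fun y => (ENNReal.ofReal (dist s t) + edist y x) ^ (-l)) :=
        lpn_const_mul _ (by simp) _
    _ ≤ 2 ^ l * (C * ENNReal.ofReal (dist s t) ^ (N * θm - l)) := by gcongr; exact hC x _ hd
    _ = _ := by
        rw [← edist_dist, ENNReal.coe_mul, ENNReal.coe_rpow_of_nonneg _ hl0.le, neg_sub, mul_assoc]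
        rfl

/-- The range of exponents in which the singularity has room to spare: the kernel is dominated by a
product of a kernel on the axis and a kernel on the slices, each covered by Young's inequality. -/
theorem exists_slice_bound_of_lt (hν : UpperRegular ν N A) (hN : 0 < N)
    (hS : ∀ x y : S, dist x y < 3) {θp θs θpt θst l : ℝ} (hp0 : 0 < θp) (hp1 : θp ≤ 1)
    (hs0 : 0 ≤ θs) (hsp : θs ≤ θp) (hpt0 : 0 < θpt) (hpt1 : θpt ≤ 1) (hst0 : 0 ≤ θst)
    (hstp : θst ≤ θpt) (hl0 : 0 < l) (hl : l < N * (1 + θst - θpt) + (1 + θs - θp)) :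
    ∃ C : ℝ≥0, ∀ g : ℝ × S → ℝ≥0∞, Measurable g → ∃ H : ℝ → ℝ≥0∞, Measurable H ∧
      lpn θs volume H ≤ C * lpn θp volume (fun s => lpn θpt ν (fun ω => g (s, ω))) ∧
      ∀ t, lpn θst ν (fun x => cylPotDecay ν l g (t, x)) ≤ H t := by
  set θm := 1 + θst - θpt with hθm
  set θ₁ := 1 + θs - θp with hθ₁
  have hm0 : 0 ≤ θm := by linarith
  have h10 : 0 ≤ θ₁ := by linarith
  have hT : 0 < N * θm + θ₁ := hl0.trans hl
  set T := N * θm + θ₁ with hTdef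
  -- `l = l₁ + l₂` is split in proportion to the critical values `θ₁` on the axis and `N θm` on
  -- `S`, so that both parts are strictly subcritical, or vanish together with their critical value
  set l₁ := l * (θ₁ / T) with hl₁
  set l₂ := l * (N * θm / T) with hl₂
  have hlT : l / T < 1 := (div_lt_one hT).2 hl
  have hsum : l₁ + l₂ = l := by
    rw [hl₁, hl₂, ← mul_add, ← add_div, add_comm, ← hTdef, div_self hT.ne', mul_one]
  have hl10 : 0 ≤ l₁ := by positivity
  have hl20 : 0 ≤ l₂ := by positivity
  have hc1 : l₁ = 0 ∨ l₁ < 1 * θ₁ := by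
    rcases h10.eq_or_lt with h | h
    · left; rw [hl₁, ← h]; simp
    · right
      have : l₁ = l / T * θ₁ := by rw [hl₁]; ring
      rw [this]
      gcongr
  have hc2 : l₂ = 0 ∨ l₂ < N * θm := by
    rcases hm0.eq_or_lt with h | h
    · left; rw [hl₂, ← h]; simp
    · right
      have : l₂ = l / T * (N * θm) := by rw [hl₂]; ring
      rw [this]
      exact mul_lt_of_lt_one_left (by positivity) hlT
  clear_value l₁ l₂
  obtain ⟨C2, hC2⟩ := lpn_edist_rpow_le hν hN hS hm0 hl20 hc2
  -- the kernel on the axis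
  set κ : ℝ → ℝ → ℝ≥0∞ := fun t s => (1 + edist s t) ^ (-2 : ℝ) * edist s t ^ (-l₁) with hκ
  have hκm : Measurable (Function.uncurry κ) := by
    have : Measurable fun z : ℝ × ℝ => edist z.2 z.1 := measurable_snd.edist measurable_fst
    exact ((this.const_add _).pow_const _).mul (this.pow_const _)
  obtain ⟨C1, hC1⟩ : ∃ C1 : ℝ≥0, ∀ t, lpn θ₁ volume (κ t) ≤ C1 := by
    have hone : ∀ x : ℝ≥0∞, (1 + x) ^ (-2 : ℝ) ≤ 1 := fun x =>
      ENNReal.rpow_neg_le_one zero_le_two le_self_add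
    rcases h10.eq_or_lt with h | h
    · have hl1 : l₁ = 0 := by rw [hl₁, ← h]; simp
      refine ⟨1, fun t => ?_⟩
      rw [← h]
      refine lpn_le_of_forall_le fun s => ?_
      simp only [hκ, hl1, neg_zero, ENNReal.rpow_zero, mul_one]
      exact hone _
    · have hθ1 : θ₁ ≤ 1 := by linarith
      have hl' : l₁ * θ₁⁻¹ < 1 := by
        rw [← div_eq_mul_inv, div_lt_one h]
        rcases hc1 with h' | h'
        · rw [h']; exact h
        · linarith
      have hl'0 : 0 ≤ l₁ * θ₁⁻¹ := by positivity
      set B : ℝ≥0∞ := ENNReal.ofReal (1 * (1 - l₁ * θ₁⁻¹)⁻¹) * (2 : ℝ≥0) *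
          ENNReal.ofReal 1 ^ (1 - l₁ * θ₁⁻¹) + ENNReal.ofReal (2 * (2 - 1)⁻¹) * (2 : ℝ≥0) *
          ENNReal.ofReal 1 ^ (1 - 2 : ℝ) with hB
      have hBT : B ≠ ∞ := by simp [hB, ENNReal.mul_eq_top]
      refine ⟨(B ^ θ₁).toNNReal, fun t => ?_⟩
      rw [ENNReal.coe_toNNReal (ENNReal.rpow_ne_top_of_nonneg h.le hBT), lpn_of_pos h]
      refine ENNReal.rpow_le_rpow ?_ h.le
      rw [← lintegral_add_compl _ (Metric.isOpen_ball (x := t) (ε := 1)).measurableSet]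
      refine add_le_add ?_ ?_
      · refine le_trans ?_ (setLIntegral_ball_edist_rpow_neg_le hl'0 hl' one_pos
          (fun r _ => Real.volume_ball_le t r))
        refine lintegral_mono fun s => ?_
        simp only [hκ]
        rw [← neg_mul, ENNReal.rpow_mul]
        refine ENNReal.rpow_le_rpow ?_ (inv_nonneg.2 h.le)
        exact mul_le_of_le_one_left' (hone _)
      · refine le_trans ?_ (lintegral_add_edist_rpow_neg_le one_pos one_lt_two one_pos
          (fun r _ => Real.volume_ball_le t r))
        refine le_trans ?_ (setLIntegral_le_lintegral (Metric.ball t 1)ᶜ _)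
        refine setLIntegral_mono' Metric.isOpen_ball.measurableSet.compl fun s hs => ?_
        have hs1 : 1 ≤ edist s t := by
          rw [mem_compl_iff, Metric.mem_ball, ← edist_lt_ofReal, not_lt] at hs
          simpa using hs
        have h3 : edist s t ^ (-l₁) ≤ 1 := ENNReal.rpow_neg_le_one hl10 hs1
        simp only [hκ]
        calc _ ≤ ((1 + edist s t) ^ (-2 : ℝ)) ^ θ₁⁻¹ :=
              ENNReal.rpow_le_rpow (mul_le_of_le_one_right' h3) (inv_nonneg.2 h.le)
          _ ≤ ((1 + edist s t) ^ (-2 : ℝ)) ^ (1 : ℝ) :=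
              ENNReal.rpow_le_rpow_of_exponent_ge (hone _) ((one_le_inv₀ h).2 hθ1)
          _ = _ := by rw [ENNReal.rpow_one, ENNReal.ofReal_one]
  refine ⟨C1 * C2, fun g hg => ?_⟩
  have hF := measurable_lpn_slice (ν := ν) hpt0 hg
  set F := fun s => lpn θpt ν (fun ω => g (s, ω)) with hFdef
  refine ⟨fun t => ∫⁻ s, κ t s * (C2 * F s), ?_, ?_, fun t => ?_⟩
  · exact (hκm.mul ((hF.comp measurable_snd).const_mul _)).lintegral_prod_right'
  · refine (lpn_kernel_le (A := C1) h10 (by linarith) hp0 hp1 hs0 (by linarith) hκm hC1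
      (fun s => ?_) (hF.const_mul _)).trans_eq ?_
    · simp only [hκ]
      simp_rw [edist_comm s]
      exact hC1 s
    · rw [lpn_const_mul _ (by simp), ENNReal.coe_mul, mul_assoc]
  · have hle : ∀ x, cylPotDecay ν l g (t, x) ≤
        ∫⁻ s, ∫⁻ ω, κ t s * edist ω x ^ (-l₂) * g (s, ω) ∂ν := by
      intro x
      refine lintegral_mono fun s => lintegral_mono fun ω => ?_
      simp only [hκ]
      rw [mul_assoc (_ ^ (-2 : ℝ)) (_ ^ (-l₁))]
      gcongr
      rw [← hsum]
      exact ENNReal.rpow_neg_add_le hl10 hl20 (edist_fst_le (s, ω) (t, x))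
        (edist_snd_le (s, ω) (t, x)) (edist_ne_top _ _) (edist_ne_top _ _)
    refine (lpn_mono hle).trans ?_
    have hκt : Measurable (κ t) := hκm.of_uncurry_left
    have hrow : ∀ s x, lpn θm ν (fun ω => κ t s * edist ω x ^ (-l₂)) ≤ κ t s * C2 := fun s x => by
      rw [lpn_const_mul' _ _ ((measurable_edist_const x).pow_const _)]
      gcongr
      exact hC2 x
    have := lpn_lintegral_slice_le (ν := ν) hm0 (by linarith) hpt0 hpt1 hst0 (by linarith)
      (by linarith : 1 + θst = θm + θpt) (K := fun s x ω => κ t s * edist ω x ^ (-l₂))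
      (κ := fun s => κ t s * C2) ?_ (hκt.mul_const _) hrow (fun s ω => ?_) hg
    · refine this.trans_eq (lintegral_congr fun s => by rw [mul_assoc])
    · exact (hκt.comp (measurable_fst.comp measurable_fst)).mul
        ((measurable_snd.edist (measurable_snd.comp measurable_fst)).pow_const _)
    · simp_rw [edist_comm ω]
      exact hrow s ω

/-- The critical singularity with a gain of integrability along the axis: Young's inequality on the
slices leaves a Hardy–Littlewood–Sobolev kernel on the axis. -/
theorem exists_slice_bound_of_eq (hν : UpperRegular ν N A) (hN : 0 < N)
    {θp θs θpt θst l : ℝ} (hs0 : 0 < θs) (hsp : θs < θp) (hp1 : θp < 1) (hpt0 : 0 < θpt)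
    (hpt1 : θpt ≤ 1) (hst0 : 0 ≤ θst)
    (hstp : θst ≤ θpt) (hl : l = N * (1 + θst - θpt) + (1 + θs - θp)) :
    ∃ C : ℝ≥0, ∀ g : ℝ × S → ℝ≥0∞, Measurable g → ∃ H : ℝ → ℝ≥0∞, Measurable H ∧
      lpn θs volume H ≤ C * lpn θp volume (fun s => lpn θpt ν (fun ω => g (s, ω))) ∧
      ∀ t, lpn θst ν (fun x => cylPot ν l g (t, x)) ≤ H t := by
  set θm := 1 + θst - θpt with hθm
  have hm0 : 0 ≤ θm := by linarith
  have hlm : N * θm < l := by linarith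
  obtain ⟨C1, hC1⟩ := lpn_edist_slice_le hν hN hm0 hlm
  obtain ⟨C2, hC2⟩ := exists_lpn_lintegral_edist_rpow_le hs0 hsp hp1
  have hle : l - N * θm = 1 + θs - θp := by linarith
  rw [hle] at hC1
  refine ⟨C2 * (C1 + 1), fun g hg => ?_⟩
  have hF := measurable_lpn_slice (ν := ν) hpt0 hg
  set F := fun s => lpn θpt ν (fun ω => g (s, ω)) with hFdef
  have hκm : Measurable fun z : ℝ × ℝ => edist z.2 z.1 ^ (-(1 + θs - θp)) :=
    (measurable_snd.edist measurable_fst).pow_const _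
  refine ⟨fun t => ∫⁻ s, edist s t ^ (-(1 + θs - θp)) * ((C1 + 1 : ℝ≥0) * F s), ?_, ?_,
    fun t => ?_⟩
  · exact (hκm.mul ((hF.comp measurable_snd).const_mul _)).lintegral_prod_right'
  · refine (hC2 _ (hF.const_mul _)).trans_eq ?_
    rw [lpn_const_mul _ (by simp), ENNReal.coe_mul, mul_assoc]
  · have hrow : ∀ s x, lpn θm ν (fun ω => edist (s, ω) (t, x) ^ (-l)) ≤
        edist s t ^ (-(1 + θs - θp)) * (C1 + 1 : ℝ≥0) := fun s x => by
      rcases eq_or_ne s t with rfl | hst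
      · rw [edist_self, ENNReal.zero_rpow_of_neg (by linarith), ENNReal.top_mul]
        · exact le_top
        · exact_mod_cast (by positivity : (0 : ℝ≥0) < C1 + 1).ne'
      · refine (hC1 s t hst x).trans ?_
        rw [mul_comm]
        gcongr
        exact le_self_add
    have := lpn_lintegral_slice_le (ν := ν) hm0 (by linarith) hpt0 hpt1 hst0 (by linarith)
      (by linarith : 1 + θst = θm + θpt) (K := fun s x ω => edist (s, ω) (t, x) ^ (-l))
      (κ := fun s => edist s t ^ (-(1 + θs - θp)) * (C1 + 1 : ℝ≥0)) (measurable_edist_slice t l)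
      (((measurable_edist_const t).pow_const _).mul_const _) hrow (fun s ω => ?_) hg
    · refine this.trans_eq (lintegral_congr fun s => by rw [mul_assoc])
    · have e : ∀ x, edist (s, ω) (t, x) = edist (s, x) (t, ω) := fun x => by
        simp only [Prod.edist_eq, edist_comm ω]
      simp_rw [e]
      exact hrow s ω

end cylinder

/-! ### The critical exponent without gain along the axis: strong estimates -/

theorem lpn_iSup {X : Type*} [MeasurableSpace X] {μ : Measure X} {θ : ℝ} (hθ : 0 < θ)
    {f : ℕ → X → ℝ≥0∞} (hf : ∀ k, Measurable (f k)) (hm : ∀ x, Monotone fun k => f k x) :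
    lpn θ μ (fun x => ⨆ k, f k x) = ⨆ k, lpn θ μ (f k) := by
  have hi : 0 < θ⁻¹ := inv_pos.2 hθ
  simp_rw [lpn_of_pos hθ]
  have h1 : ∀ y : ℕ → ℝ≥0∞, ∀ b : ℝ, 0 < b → (⨆ k, y k) ^ b = ⨆ k, y k ^ b := fun y b hb =>
    (ENNReal.orderIsoRpow b hb).map_iSup _
  simp_rw [h1 _ _ hi]
  rw [lintegral_iSup (fun k => (hf k).pow_const _)
    (fun i j hij x => ENNReal.rpow_le_rpow (hm x hij) hi.le), h1 _ _ hθ]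

theorem ENNReal.iSup_min_natCast (x : ℝ≥0∞) : ⨆ k : ℕ, min x k = x := by
  refine le_antisymm (iSup_le fun k => min_le_left _ _) (le_of_forall_lt fun c hc => ?_)
  obtain ⟨k, hk⟩ := ENNReal.exists_nat_gt hc.ne_top
  exact (lt_min hc hk).trans_le (le_iSup (fun k : ℕ => min x k) k)

/-- The maximal theorem on the line, including the exponent `∞`. -/
theorem exists_lpn_maxFun_le' {θ : ℝ} (h0 : 0 ≤ θ) (h1 : θ < 1) :
    ∃ C : ℝ≥0, ∀ F : ℝ → ℝ≥0∞, Measurable F →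
      lpn θ volume (maxFun 1 volume F) ≤ C * lpn θ volume F := by
  rcases h0.eq_or_lt with rfl | h0
  · refine ⟨2, fun F _ => lpn_le_of_forall_le fun t => maxFun_le fun r _ => ?_⟩
    rw [lpn_zero]
    calc ∫⁻ s in Metric.ball t r, F s ≤ ∫⁻ s in Metric.ball t r, essSup F volume :=
          lintegral_mono_ae (ae_restrict_of_ae (ENNReal.ae_le_essSup F))
      _ = essSup F volume * volume (Metric.ball t r) := by simp
      _ ≤ essSup F volume * (((2 : ℝ≥0) : ℝ≥0∞) * ENNReal.ofReal r ^ (1 : ℝ)) := by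
          gcongr; exact Real.volume_ball_le t r
      _ = _ := by ring
  · exact exists_lpn_maxFun_le h0 h1

section cylinder

variable {S : Type*} [PseudoMetricSpace S] [MeasurableSpace S] [BorelSpace S]
  [SecondCountableTopology S] {ν : Measure S} [IsFiniteMeasure ν] {N : ℝ} {A : ℝ≥0}

theorem UpperRegular.prod (hν : UpperRegular ν N A) :
    UpperRegular ((volume : Measure ℝ).prod ν) (N + 1) (2 * A) := by
  rintro ⟨t, x⟩ r hr
  rw [← ball_prod_same, Measure.prod_prod]
  refine (mul_le_mul' (Real.volume_ball_le t r) (hν x r hr)).trans_eq ?_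
  rw [ENNReal.rpow_add _ _ (by simpa using hr) ENNReal.ofReal_ne_top, ENNReal.coe_mul]
  ring

theorem cylPot_eq_lintegral_prod {l : ℝ} {g : ℝ × S → ℝ≥0∞} (hg : Measurable g) (z : ℝ × S) :
    cylPot ν l g z = ∫⁻ w, edist w z ^ (-l) * g w ∂((volume : Measure ℝ).prod ν) := by
  have hm : Measurable fun w => edist w z ^ (-l) * g w :=
    ((measurable_edist_const z).pow_const _).mul hg
  rw [lintegral_prod _ hm.aemeasurable]
  rfl

theorem cylPot_eq_zero {l : ℝ} {g : ℝ × S → ℝ≥0∞} (hg : Measurable g)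
    (h : g =ᵐ[(volume : Measure ℝ).prod ν] 0) (z : ℝ × S) : cylPot ν l g z = 0 := by
  rw [cylPot_eq_lintegral_prod hg, ← lintegral_zero (μ := (volume : Measure ℝ).prod ν)]
  refine lintegral_congr_ae ?_
  filter_upwards [h] with w hw
  simp [hw]

theorem ae_eq_zero_of_slice {θ : ℝ} (hθ : 0 < θ) {g : ℝ × S → ℝ≥0∞} (hg : Measurable g)
    (h : (fun s => lpn θ ν (fun ω => g (s, ω))) =ᵐ[volume] 0) :
    g =ᵐ[(volume : Measure ℝ).prod ν] 0 := by
  refine (Measure.ae_prod_iff_ae_ae (hg (measurableSet_singleton 0))).2 ?_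
  filter_upwards [h] with s hs
  exact lpn_eq_zero hθ (hg.comp measurable_prodMk_left) hs

/-- The part of the potential near `z` is controlled by the maximal function on the cylinder. -/
theorem setLIntegral_ball_cyl_le {l : ℝ} (h0 : 0 ≤ l) (h1 : l < N + 1) {g : ℝ × S → ℝ≥0∞}
    (hg : Measurable g) (z : ℝ × S) {ρ : ℝ} (hρ : 0 < ρ) :
    ∫⁻ w in Metric.ball z ρ, edist w z ^ (-l) * g w ∂((volume : Measure ℝ).prod ν) ≤
      ENNReal.ofReal ((N + 1) * (N + 1 - l)⁻¹) *
        maxFun (N + 1) ((volume : Measure ℝ).prod ν) g z * ENNReal.ofReal ρ ^ (N + 1 - l) := by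
  have := setLIntegral_ball_edist_rpow_neg_le
    (μ := ((volume : Measure ℝ).prod ν).withDensity g) h0 h1 hρ
    (fun r hr => withDensity_ball_le_maxFun (N + 1) _ g z hr)
  rw [restrict_withDensity Metric.isOpen_ball.measurableSet,
    lintegral_withDensity_eq_lintegral_mul _ hg ((measurable_edist_const z).pow_const _)] at this
  simpa only [Pi.mul_apply, mul_comm] using this

/-- The part of the potential away from `z`, estimated by Hölder's inequality on each slice. -/
theorem exists_setLIntegral_ball_compl_cyl_le (hν : UpperRegular ν N A) (hN : 0 < N) {θpt l : ℝ}
    (hpt0 : 0 < θpt) (hpt1 : θpt ≤ 1) (hl : 1 + N * (1 - θpt) < l) :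
    ∃ C : ℝ≥0, ∀ g : ℝ × S → ℝ≥0∞, Measurable g → ∀ (z : ℝ × S) (ρ : ℝ), 0 < ρ →
      ∫⁻ w in (Metric.ball z ρ)ᶜ, edist w z ^ (-l) * g w ∂((volume : Measure ℝ).prod ν) ≤
        C * maxFun 1 volume (fun s => lpn θpt ν (fun ω => g (s, ω))) z.1 *
          ENNReal.ofReal ρ ^ (1 + N * (1 - θpt) - l) := by
  have h1p : 0 ≤ 1 - θpt := by linarith
  have hNp : 0 ≤ N * (1 - θpt) := by positivity
  have hl0 : 0 ≤ l := by linarith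
  set b := l - N * (1 - θpt) with hb
  have hb1 : 1 < b := by linarith
  obtain ⟨C, hC⟩ := lpn_add_edist_rpow_le hν hN h1p (by linarith : N * (1 - θpt) < l)
  refine ⟨2 ^ l * (2 ^ l * (C * (b * (b - 1)⁻¹).toNNReal)), fun g hg z ρ hρ => ?_⟩
  have hF := measurable_lpn_slice (ν := ν) hpt0 hg
  set F := fun s => lpn θpt ν (fun ω => g (s, ω)) with hFdef
  obtain ⟨t, x⟩ := z
  have hm : Measurable fun w : ℝ × S =>
      (ENNReal.ofReal ρ + edist w.1 t + edist w.2 x) ^ (-l) * g w := by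
    have h1 : Measurable fun w : ℝ × S => edist w.1 t :=
      (measurable_edist_const t).comp measurable_fst
    have h2 : Measurable fun w : ℝ × S => edist w.2 x :=
      (measurable_edist_const x).comp measurable_snd
    exact (((h1.const_add _).add h2).pow_const _).mul hg
  -- off the ball the kernel is comparable with one regularised at the scale `ρ`
  calc _ ≤ ∫⁻ w in (Metric.ball (t, x) ρ)ᶜ, 2 ^ l * (2 ^ l *
          ((ENNReal.ofReal ρ + edist w.1 t + edist w.2 x) ^ (-l) * g w))
            ∂((volume : Measure ℝ).prod ν) := by
        refine setLIntegral_mono' Metric.isOpen_ball.measurableSet.compl fun w hw => ?_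
        rw [mem_compl_iff, Metric.mem_ball, ← edist_lt_ofReal, not_lt] at hw
        rw [← mul_assoc, ← mul_assoc]
        gcongr
        refine (ENNReal.rpow_neg_le_two_rpow_mul (b := 2 * edist w (t, x)) hl0 le_rfl).trans ?_
        rw [mul_assoc]
        gcongr
        refine ENNReal.rpow_neg_le_two_rpow_mul hl0 ?_
        rw [add_assoc, two_mul (2 * edist w (t, x))]
        refine add_le_add (hw.trans ?_) (edist_add_edist_le w (t, x))
        rw [two_mul]
        exact le_self_add
    _ ≤ ∫⁻ w, 2 ^ l * (2 ^ l * ((ENNReal.ofReal ρ + edist w.1 t + edist w.2 x) ^ (-l) * g w))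
          ∂((volume : Measure ℝ).prod ν) := setLIntegral_le_lintegral _ _
    _ = 2 ^ l * (2 ^ l * ∫⁻ s, ∫⁻ ω, (ENNReal.ofReal ρ + edist s t + edist ω x) ^ (-l) * g (s, ω)
          ∂ν) := by
        rw [lintegral_const_mul' _ _ (by simp), lintegral_const_mul' _ _ (by simp),
          lintegral_prod _ hm.aemeasurable]
    _ ≤ 2 ^ l * (2 ^ l * ∫⁻ s, C * ((ENNReal.ofReal ρ + edist s t) ^ (-b) * F s)) := by
        gcongr with s
        refine (lintegral_mul_le_lpn hpt0 hpt1 (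
            ((measurable_edist_const x).const_add _).pow_const _)
          (hg.comp measurable_prodMk_left)).trans ?_
        have h2 := hC x (ρ + dist s t) (by positivity)
        rw [ENNReal.ofReal_add hρ.le dist_nonneg, ← edist_dist] at h2
        have h3 : N * (1 - θpt) - l = -b := by rw [hb]; ring
        rw [h3] at h2
        rw [← mul_assoc]
        exact mul_le_mul' h2 le_rfl
    _ ≤ 2 ^ l * (2 ^ l * (C * (ENNReal.ofReal (b * (b - 1)⁻¹) * maxFun 1 volume F t *
          ENNReal.ofReal ρ ^ (1 - b)))) := by
        rw [lintegral_const_mul' _ _ (by simp)]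
        gcongr
        exact lintegral_add_edist_rpow_mul_le_maxFun hb1 hρ hF t
    _ = _ := by
        have h3 : 1 + N * (1 - θpt) - l = 1 - b := by rw [hb]; ring
        rw [h3]
        push_cast
        rw [ENNReal.coe_rpow_of_nonneg _ hl0]
        simp only [ENNReal.ofReal, ENNReal.coe_ofNat]
        ring

theorem maxFun_prod_comp_fst_le (hν : UpperRegular ν N A) {w : ℝ → ℝ≥0∞} (hw : Measurable w)
    (z : ℝ × S) :
    maxFun (N + 1) ((volume : Measure ℝ).prod ν) (fun y => w y.1) z ≤
      A * maxFun 1 volume w z.1 := by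
  refine maxFun_le fun r hr => ?_
  rw [← Prod.mk.eta (p := z), ← ball_prod_same, ← Measure.prod_restrict]
  have := lintegral_prod_mul (μ := (volume : Measure ℝ).restrict (Metric.ball z.1 r))
    (ν := ν.restrict (Metric.ball z.2 r)) (f := w) (g := 1) hw.aemeasurable
    measurable_one.aemeasurable
  simp only [Pi.one_apply, mul_one, lintegral_one, Measure.restrict_apply_univ] at this
  rw [this]
  refine (mul_le_mul' (setLIntegral_ball_le_maxFun 1 volume w z.1 hr) (hν z.2 r hr)).trans_eq ?_
  rw [ENNReal.rpow_add _ _ (by simpa using hr) ENNReal.ofReal_ne_top]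
  ring

/-- The maximal function on the cylinder is bounded on `L^p(ℝ; L^{p̃}(S))` for `p ≥ p̃ > 1`. By
duality in the axial variable this is the weighted inequality for weights depending on that
variable only. -/
theorem exists_lpn_lpn_maxFun_le (hν : UpperRegular ν N A) (hN : 0 < N) (hA : 0 < A)
    {θp θpt : ℝ} (hp0 : 0 < θp) (hppt : θp ≤ θpt) (hpt1 : θpt < 1) :
    ∃ C : ℝ≥0, ∀ g : ℝ × S → ℝ≥0∞, Measurable g →
      lpn θp volume (fun t => lpn θpt ν (fun x =>
        maxFun (N + 1) ((volume : Measure ℝ).prod ν) g (t, x))) ≤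
        C * lpn θp volume (fun s => lpn θpt ν (fun ω => g (s, ω))) := by
  have hpt0 : 0 < θpt := hp0.trans_le hppt
  set η := θp / θpt with hη
  have hη0 : 0 < η := by positivity
  have hη1 : η ≤ 1 := (div_le_one hpt0).2 hppt
  obtain ⟨C1, hC1⟩ := exists_lintegral_maxFun_rpow_mul_le (μ := (volume : Measure ℝ).prod ν)
    (by linarith : 0 ≤ N + 1) ((one_lt_inv₀ hpt0).2 hpt1) (by positivity : 0 < 2 * A) hν.prod
  obtain ⟨C2, hC2⟩ := exists_lpn_maxFun_le' (by linarith : 0 ≤ 1 - η) (by linarith : 1 - η < 1)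
  refine ⟨(C1 * A * C2) ^ θpt, fun g hg => ?_⟩
  have hM : Measurable (maxFun (N + 1) ((volume : Measure ℝ).prod ν) g) := measurable_maxFun
  -- the claim is an `L^{1/η}` estimate on the axis for the slice integrals of the power `θpt⁻¹`
  have key : ∀ f : ℝ × S → ℝ≥0∞, lpn θp volume (fun t => lpn θpt ν (fun x => f (t, x))) =
      lpn η volume (fun t => ∫⁻ x, f (t, x) ^ θpt⁻¹ ∂ν) ^ θpt := fun f => by
    simp_rw [lpn_of_pos hpt0]
    rw [lpn_rpow hp0 hpt0]
  rw [key, key, ENNReal.coe_rpow_of_nonneg _ hpt0.le, ← ENNReal.mul_rpow_of_nonneg _ _ hpt0.le]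
  refine ENNReal.rpow_le_rpow ?_ hpt0.le
  have hΨ : Measurable fun t => ∫⁻ x, g (t, x) ^ θpt⁻¹ ∂ν :=
    (hg.pow_const _).lintegral_prod_right'
  -- test it against a function `w` of the axial variable
  refine lpn_le_of_forall_lintegral_mul_le hη0 hη1 ((hM.pow_const _).lintegral_prod_right')
    fun w hw => ?_
  have hw1 : Measurable fun y : ℝ × S => w y.1 := hw.comp measurable_fst
  calc ∫⁻ t, (∫⁻ x, maxFun (N + 1) ((volume : Measure ℝ).prod ν) g (t, x) ^ θpt⁻¹ ∂ν) * w t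
      = ∫⁻ y, maxFun (N + 1) ((volume : Measure ℝ).prod ν) g y ^ θpt⁻¹ * w y.1
          ∂((volume : Measure ℝ).prod ν) := by
        have hm : Measurable fun y =>
            maxFun (N + 1) ((volume : Measure ℝ).prod ν) g y ^ θpt⁻¹ * w y.1 :=
          (hM.pow_const _).mul hw1
        rw [lintegral_prod _ hm.aemeasurable]
        refine lintegral_congr fun t => ?_
        exact (lintegral_mul_const _ ((hM.pow_const _).comp measurable_prodMk_left)).symm
    _ ≤ C1 * ∫⁻ y, g y ^ θpt⁻¹ * maxFun (N + 1) ((volume : Measure ℝ).prod ν) (fun y => w y.1) y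
          ∂((volume : Measure ℝ).prod ν) := hC1 g _ hg hw1
    _ ≤ C1 * ∫⁻ y, g y ^ θpt⁻¹ * (A * maxFun 1 volume w y.1) ∂((volume : Measure ℝ).prod ν) := by
        gcongr with y; exact maxFun_prod_comp_fst_le hν hw y
    _ = C1 * ∫⁻ t, (A * maxFun 1 volume w t) * ∫⁻ x, g (t, x) ^ θpt⁻¹ ∂ν := by
        have hm : Measurable fun y : ℝ × S => g y ^ θpt⁻¹ * (A * maxFun 1 volume w y.1) :=
          (hg.pow_const _).mul ((measurable_maxFun.const_mul _).comp measurable_fst)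
        rw [lintegral_prod _ hm.aemeasurable]
        congr 1
        refine lintegral_congr fun t => ?_
        have hm : Measurable fun x => g (t, x) ^ θpt⁻¹ :=
          (hg.comp measurable_prodMk_left).pow_const _
        rw [mul_comm]
        exact lintegral_mul_const (A * maxFun 1 volume w t) hm
    _ ≤ C1 * (lpn (1 - η) volume (fun t => A * maxFun 1 volume w t) *
          lpn η volume (fun t => ∫⁻ x, g (t, x) ^ θpt⁻¹ ∂ν)) := by
        gcongr
        exact lintegral_mul_le_lpn hη0 hη1 (measurable_maxFun.const_mul _) hΨ
    _ ≤ C1 * ((A * (C2 * lpn (1 - η) volume w)) *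
          lpn η volume (fun t => ∫⁻ x, g (t, x) ^ θpt⁻¹ ∂ν)) := by
        rw [lpn_const_mul _ (by simp)]
        gcongr
        exact hC2 w hw
    _ = _ := by push_cast; ring

/-- Hedberg's argument on the cylinder, for `p ≥ p̃`. -/
theorem exists_lpn_cylPot_le_of_le (hν : UpperRegular ν N A) (hN : 0 < N) (hA : 0 < A)
    {θp θpt θst l : ℝ} (hp0 : 0 < θp) (hppt : θp ≤ θpt) (hpt1 : θpt < 1) (hst0 : 0 < θst)
    (hstp : θst < θpt) (hl : l = N * (1 + θst - θpt) + 1) :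
    ∃ C : ℝ≥0, ∀ g : ℝ × S → ℝ≥0∞, Measurable g →
      lpn θp volume (fun t => lpn θst ν (fun x => cylPot ν l g (t, x))) ≤
        C * lpn θp volume (fun s => lpn θpt ν (fun ω => g (s, ω))) := by
  have hpt0 : 0 < θpt := hp0.trans_le hppt
  have hl0 : 0 ≤ l := by
    have : 0 ≤ N * (1 + θst - θpt) := mul_nonneg hN.le (by linarith)
    linarith
  have hα : N + 1 - l = N * (θpt - θst) := by rw [hl]; ring
  have hα0 : 0 < N * (θpt - θst) := mul_pos hN (by linarith)
  have hβ : 1 + N * (1 - θpt) - l = -(N * θst) := by rw [hl]; ring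
  have hβ0 : 0 < N * θst := by positivity
  obtain ⟨C2, hC2⟩ := exists_setLIntegral_ball_compl_cyl_le hν hN (l := l) hpt0 hpt1.le
    (by linarith)
  obtain ⟨C3, hC3⟩ := exists_lpn_lpn_maxFun_le hν hN hA hp0 hppt hpt1
  obtain ⟨C4, hC4⟩ := exists_lpn_maxFun_le hp0 (hppt.trans_lt hpt1)
  set C1 : ℝ≥0 := ((N + 1) * (N + 1 - l)⁻¹).toNNReal with hC1
  have hC10 : (C1 : ℝ≥0∞) ≠ 0 := by
    have : 0 < (N + 1) * (N + 1 - l)⁻¹ := by rw [hα]; positivity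
    exact_mod_cast (Real.toNNReal_pos.2 this).ne'
  set φ := θst / θpt with hφ
  have hφ0 : 0 < φ := by positivity
  have hφ1 : φ < 1 := (div_lt_one hpt0).2 hstp
  refine ⟨2 * (C1 ^ φ * (C2 + 1) ^ (1 - φ)) * (C3 ^ φ * C4 ^ (1 - φ)), fun g hg => ?_⟩
  have hF := measurable_lpn_slice (ν := ν) hpt0 hg
  set F := fun s => lpn θpt ν (fun ω => g (s, ω)) with hFdef
  set Mg := maxFun (N + 1) ((volume : Measure ℝ).prod ν) g with hMg
  have hMgm : Measurable Mg := measurable_maxFun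
  -- near part by the maximal function on the cylinder, far part by the one on the axis
  have hpt : ∀ z : ℝ × S, cylPot ν l g z ≤
      2 * ((C1 * Mg z) ^ φ * ((C2 + 1 : ℝ≥0) * maxFun 1 volume F z.1) ^ (1 - φ)) := by
    intro z
    have e1 : φ = N * θst / (N * (θpt - θst) + N * θst) := by
      rw [hφ, ← mul_add, sub_add_cancel]; field_simp
    have e2 : 1 - φ = N * (θpt - θst) / (N * (θpt - θst) + N * θst) := by
      rw [hφ, ← mul_add, sub_add_cancel]; field_simp
    rw [e2, e1]
    refine le_two_mul_rpow_mul_rpow hα0 hβ0 (fun ρ hρ => ?_) (fun h => ?_) fun h => ?_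
    · rw [cylPot_eq_lintegral_prod hg,
        ← lintegral_add_compl _ (Metric.isOpen_ball (x := z) (ε := ρ)).measurableSet]
      refine add_le_add ?_ ?_
      · refine (setLIntegral_ball_cyl_le (N := N) (ν := ν) hl0 (by linarith) hg z hρ).trans_eq ?_
        rw [mul_comm, hα, hC1, hα]
        rfl
      · refine (hC2 g hg z ρ hρ).trans ?_
        rw [hβ, mul_comm]
        gcongr
        exact_mod_cast le_self_add
    · exact cylPot_eq_zero hg (ae_eq_zero_of_maxFun_eq_zero hg
        ((mul_eq_zero.1 h).resolve_left hC10)) z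
    · refine cylPot_eq_zero hg (ae_eq_zero_of_slice hpt0 hg ?_) z
      refine ae_eq_zero_of_maxFun_eq_zero hF ((mul_eq_zero.1 h).resolve_left ?_)
      exact_mod_cast (by positivity : 0 < C2 + 1).ne'
  have hMslice := measurable_lpn_slice (ν := ν) hpt0 hMgm
  have hslice : ∀ t, lpn θst ν (fun x => cylPot ν l g (t, x)) ≤
      2 * (C1 ^ φ * (C2 + 1 : ℝ≥0) ^ (1 - φ)) *
        (lpn θpt ν (fun x => Mg (t, x)) ^ φ * maxFun 1 volume F t ^ (1 - φ)) := by
    intro t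
    calc _ ≤ lpn θst ν (fun x => (2 * (C1 ^ φ * ((C2 + 1 : ℝ≥0) * maxFun 1 volume F t) ^ (1 - φ))) *
            Mg (t, x) ^ φ) := by
          refine lpn_mono fun x => (hpt (t, x)).trans_eq ?_
          rw [ENNReal.mul_rpow_of_nonneg _ _ hφ0.le]
          ring
      _ = (2 * (C1 ^ φ * ((C2 + 1 : ℝ≥0) * maxFun 1 volume F t) ^ (1 - φ))) *
            lpn θpt ν (fun x => Mg (t, x)) ^ φ := by
          have hm : Measurable fun x => Mg (t, x) := hMgm.comp measurable_prodMk_left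
          rw [lpn_const_mul' _ _ (hm.pow_const _), lpn_rpow hst0 hφ0]
          have : θst / φ = θpt := by rw [hφ]; field_simp
          rw [this]
      _ = _ := by
          rw [ENNReal.mul_rpow_of_nonneg _ _ (by linarith)]
          ring
  calc _ ≤ lpn θp volume (fun t => 2 * (C1 ^ φ * (C2 + 1 : ℝ≥0) ^ (1 - φ)) *
        (lpn θpt ν (fun x => Mg (t, x)) ^ φ * maxFun 1 volume F t ^ (1 - φ))) := lpn_mono hslice
    _ = 2 * (C1 ^ φ * (C2 + 1 : ℝ≥0) ^ (1 - φ)) * lpn (φ * θp + (1 - φ) * θp) volume (fun t =>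
        lpn θpt ν (fun x => Mg (t, x)) ^ φ * maxFun 1 volume F t ^ (1 - φ)) := by
        have hm : Measurable fun t =>
            lpn θpt ν (fun x => Mg (t, x)) ^ φ * maxFun 1 volume F t ^ (1 - φ) :=
          (hMslice.pow_const _).mul (measurable_maxFun.pow_const _)
        rw [lpn_const_mul' _ _ hm]
        congr 2
        ring
    _ ≤ 2 * (C1 ^ φ * (C2 + 1 : ℝ≥0) ^ (1 - φ)) * ((C3 * lpn θp volume F) ^ φ *
          (C4 * lpn θp volume F) ^ (1 - φ)) := by
        gcongr
        refine (lpn_rpow_mul_rpow_le hφ0 hφ1.le hp0.le hp0 hMslice measurable_maxFun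
          (by nlinarith)).trans ?_
        gcongr
        · exact hC3 g hg
        · exact hC4 F hF
    _ = _ := by
        have hY1 : lpn θp volume F ^ φ * lpn θp volume F ^ (1 - φ) = lpn θp volume F := by
          rw [← ENNReal.rpow_add_of_nonneg _ _ hφ0.le (by linarith), add_sub_cancel,
            ENNReal.rpow_one]
        rw [ENNReal.mul_rpow_of_nonneg _ _ hφ0.le, ENNReal.mul_rpow_of_nonneg _ _ (by linarith)]
        push_cast
        rw [ENNReal.coe_rpow_of_nonneg _ hφ0.le, ENNReal.coe_rpow_of_nonneg _ hφ0.le,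
          ENNReal.coe_rpow_of_nonneg _ (by linarith), ENNReal.coe_rpow_of_nonneg _ (by linarith)]
        push_cast
        calc _ = 2 * ((C1 : ℝ≥0∞) ^ φ * (C2 + 1 : ℝ≥0∞) ^ (1 - φ)) *
              ((C3 : ℝ≥0∞) ^ φ * (C4 : ℝ≥0∞) ^ (1 - φ)) *
              (lpn θp volume F ^ φ * lpn θp volume F ^ (1 - φ)) := by ring
          _ = _ := by rw [hY1]

/-- The converse of Hölder's inequality for mixed norms. -/
theorem lpn_lpn_le_of_forall_lintegral_mul_le {θ θ' : ℝ} (h0 : 0 < θ) (h1 : θ ≤ 1) (h0' : 0 < θ')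
    (h1' : θ' < 1) {H : ℝ × S → ℝ≥0∞} (hH : Measurable H) {K : ℝ≥0∞}
    (h : ∀ φ : ℝ × S → ℝ≥0∞, Measurable φ →
      ∫⁻ t, ∫⁻ x, H (t, x) * φ (t, x) ∂ν ≤
        K * lpn (1 - θ) volume (fun t => lpn (1 - θ') ν (fun x => φ (t, x)))) :
    lpn θ volume (fun t => lpn θ' ν (fun x => H (t, x))) ≤ K := by
  have h2' : 0 < 1 - θ' := by linarith
  have hi' : 0 < θ'⁻¹ - 1 := by rw [sub_pos]; exact (one_lt_inv₀ h0').2 h1'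
  have hHk : ∀ k : ℕ, Measurable fun z => min (H z) (k : ℝ≥0∞) := fun k => hH.min measurable_const
  -- it suffices to treat the truncations of `H`, whose slices have finite norm
  have hsup : lpn θ volume (fun t => lpn θ' ν (fun x => H (t, x))) =
      ⨆ k : ℕ, lpn θ volume (fun t => lpn θ' ν (fun x => min (H (t, x)) k)) := by
    have hmono : ∀ z, Monotone fun k : ℕ => min (H z) (k : ℝ≥0∞) := fun z i j hij =>
      min_le_min le_rfl (by exact_mod_cast hij)
    rw [← lpn_iSup h0 (fun k => measurable_lpn_slice h0' (hHk k))
      (fun t i j hij => lpn_mono fun x => hmono (t, x) hij)]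
    congr 1
    ext t
    have hmk : ∀ k : ℕ, Measurable fun x => min (H (t, x)) (k : ℝ≥0∞) := fun k =>
      (hHk k).comp measurable_prodMk_left
    rw [← lpn_iSup h0' hmk (fun x => hmono (t, x))]
    congr 1
    ext x
    exact (ENNReal.iSup_min_natCast _).symm
  rw [hsup]
  refine iSup_le fun k => ?_
  set Hk : ℝ × S → ℝ≥0∞ := fun z => min (H z) (k : ℝ≥0∞) with hHkdef
  set Φ : ℝ → ℝ≥0∞ := fun t => lpn θ' ν (fun x => Hk (t, x)) with hΦ
  have hΦm : Measurable Φ := measurable_lpn_slice h0' (hHk k)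
  have hΦT : ∀ t, Φ t ≠ ∞ := fun t => by
    have : Φ t ≤ lpn θ' ν (fun _ : S => (k : ℝ≥0∞)) := lpn_mono fun x => min_le_right _ _
    refine (this.trans_lt ?_).ne
    rw [lpn_of_pos h0', lintegral_const]
    exact ENNReal.rpow_lt_top_of_nonneg h0'.le (ENNReal.mul_ne_top
      (ENNReal.rpow_ne_top_of_nonneg (by positivity) (by simp)) (measure_ne_top _ _))
  have hΦi : ∀ t, ∫⁻ x, Hk (t, x) ^ θ'⁻¹ ∂ν = Φ t ^ θ'⁻¹ := fun t => (lpn_rpow_inv h0' _).symm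
  refine lpn_le_of_forall_lintegral_mul_le h0 h1 hΦm fun w hw => ?_
  -- the extremal test function on each slice
  set φ : ℝ × S → ℝ≥0∞ := fun z => w z.1 * Φ z.1 ^ (1 - θ'⁻¹) * Hk z ^ (θ'⁻¹ - 1) with hφ
  have hφm : Measurable φ := (((hw.comp measurable_fst).mul
    ((hΦm.comp measurable_fst).pow_const _))).mul ((hHk k).pow_const _)
  have e1 : ∀ t, Φ t * w t = ∫⁻ x, Hk (t, x) * φ (t, x) ∂ν := by
    intro t
    have e : ∀ x, Hk (t, x) * φ (t, x) = w t * Φ t ^ (1 - θ'⁻¹) * Hk (t, x) ^ θ'⁻¹ := by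
      intro x
      have : Hk (t, x) ^ θ'⁻¹ = Hk (t, x) * Hk (t, x) ^ (θ'⁻¹ - 1) := by
        nth_rewrite 2 [← ENNReal.rpow_one (Hk (t, x))]
        rw [← ENNReal.rpow_add_of_nonneg _ _ zero_le_one hi'.le, add_sub_cancel]
      rw [this]
      simp only [hφ]
      ring
    simp_rw [e]
    have hm : Measurable fun x => Hk (t, x) := (hHk k).comp measurable_prodMk_left
    rw [lintegral_const_mul _ (hm.pow_const _), hΦi, mul_assoc]
    rcases eq_or_ne (Φ t) 0 with h0 | h0
    · rw [h0, ENNReal.zero_rpow_of_pos (inv_pos.2 h0')]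
      simp
    · rw [← ENNReal.rpow_add _ _ h0 (hΦT t), sub_add_cancel, ENNReal.rpow_one, mul_comm]
  have e2 : ∀ t, lpn (1 - θ') ν (fun x => φ (t, x)) ≤ w t := by
    intro t
    simp only [hφ]
    have hm : Measurable fun x => Hk (t, x) := (hHk k).comp measurable_prodMk_left
    rw [lpn_const_mul' _ _ (hm.pow_const _), lpn_of_pos h2']
    have e3 : ∀ x, (Hk (t, x) ^ (θ'⁻¹ - 1)) ^ (1 - θ')⁻¹ = Hk (t, x) ^ θ'⁻¹ := fun x => by
      rw [← ENNReal.rpow_mul]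
      congr 1
      field_simp
    simp_rw [e3]
    rw [hΦi, ← ENNReal.rpow_mul, mul_assoc]
    refine mul_le_of_le_one_right' ?_
    have e4 : θ'⁻¹ * (1 - θ') = θ'⁻¹ - 1 := by field_simp
    rw [e4]
    rcases eq_or_ne (Φ t) 0 with h0 | h0
    · rw [h0, ENNReal.zero_rpow_of_pos hi', mul_zero]; exact zero_le
    · rw [← ENNReal.rpow_add _ _ h0 (hΦT t)]
      simp
  calc ∫⁻ t, Φ t * w t = ∫⁻ t, ∫⁻ x, Hk (t, x) * φ (t, x) ∂ν := lintegral_congr e1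
    _ ≤ ∫⁻ t, ∫⁻ x, H (t, x) * φ (t, x) ∂ν := by
        gcongr with t x
        exact min_le_left _ _
    _ ≤ _ := h φ hφm
    _ ≤ K * lpn (1 - θ) volume w := by gcongr; exact lpn_mono e2

/-- The critical estimate without gain along the axis, for all `1 < p < ∞`. For `p < p̃` it follows
from the case `p ≥ p̃` by duality, since the kernel is symmetric. -/
theorem exists_lpn_cylPot_le (hν : UpperRegular ν N A) (hN : 0 < N) (hA : 0 < A)
    {θp θpt θst l : ℝ} (hp0 : 0 < θp) (hp1 : θp < 1) (hpt1 : θpt < 1) (hst0 : 0 < θst)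
    (hstp : θst < θpt) (hl : l = N * (1 + θst - θpt) + 1) :
    ∃ C : ℝ≥0, ∀ g : ℝ × S → ℝ≥0∞, Measurable g →
      lpn θp volume (fun t => lpn θst ν (fun x => cylPot ν l g (t, x))) ≤
        C * lpn θp volume (fun s => lpn θpt ν (fun ω => g (s, ω))) := by
  rcases le_or_gt θp θpt with h | h
  · exact exists_lpn_cylPot_le_of_le hν hN hA hp0 h hpt1 hst0 hstp hl
  have hpt0 : 0 < θpt := hst0.trans hstp
  -- the dual exponents satisfy the same relation with the same `l`, and have `p ≥ p̃`
  obtain ⟨C, hC⟩ := exists_lpn_cylPot_le_of_le hν hN hA (θp := 1 - θp) (θpt := 1 - θst)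
    (θst := 1 - θpt) (l := l) (by linarith) (by linarith) (by linarith) (by linarith)
    (by linarith) (by rw [hl]; ring)
  refine ⟨C, fun g hg => ?_⟩
  have hpg : Measurable (cylPot ν l g) := measurable_cylPot hg
  refine lpn_lpn_le_of_forall_lintegral_mul_le hp0 hp1.le hst0 (hstp.trans hpt1) hpg
    fun φ hφ => ?_
  have hpφ : Measurable (cylPot ν l φ) := measurable_cylPot hφ
  have hsymm : ∫⁻ t, ∫⁻ x, cylPot ν l g (t, x) * φ (t, x) ∂ν =
      ∫⁻ t, ∫⁻ x, cylPot ν l φ (t, x) * g (t, x) ∂ν := by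
    rw [← lintegral_prod (fun z => cylPot ν l g z * φ z) (hpg.mul hφ).aemeasurable,
      ← lintegral_prod (fun z => cylPot ν l φ z * g z) (hpφ.mul hg).aemeasurable]
    have hd : Measurable fun p : (ℝ × S) × (ℝ × S) => edist p.2 p.1 ^ (-l) :=
      (measurable_snd.edist measurable_fst).pow_const _
    have h1 : ∀ z, cylPot ν l g z * φ z =
        ∫⁻ w, edist w z ^ (-l) * g w * φ z ∂((volume : Measure ℝ).prod ν) := fun z => by
      have hm : Measurable fun w => edist w z ^ (-l) * g w :=
        ((measurable_edist_const z).pow_const _).mul hg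
      rw [cylPot_eq_lintegral_prod hg, lintegral_mul_const _ hm]
    have h2 : ∀ w, cylPot ν l φ w * g w =
        ∫⁻ z, edist w z ^ (-l) * g w * φ z ∂((volume : Measure ℝ).prod ν) := fun w => by
      have hm : Measurable fun z => edist z w ^ (-l) * φ z :=
        ((measurable_edist_const w).pow_const _).mul hφ
      rw [cylPot_eq_lintegral_prod hφ, ← lintegral_mul_const _ hm]
      refine lintegral_congr fun z => ?_
      rw [edist_comm z w]
      ring
    simp_rw [h1, h2]
    exact lintegral_lintegral_swap
      ((hd.mul (hg.comp measurable_snd)).mul (hφ.comp measurable_fst)).aemeasurable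
  rw [hsymm]
  have hpφs := measurable_lpn_slice (ν := ν) (by linarith : 0 < 1 - θpt) hpφ
  have hgs := measurable_lpn_slice (ν := ν) hpt0 hg
  calc _ ≤ ∫⁻ t, lpn (1 - θpt) ν (fun x => cylPot ν l φ (t, x)) *
      lpn θpt ν (fun x => g (t, x)) := by
        refine lintegral_mono fun t => ?_
        exact lintegral_mul_le_lpn hpt0 hpt1.le (hpφ.comp measurable_prodMk_left)
          (hg.comp measurable_prodMk_left)
    _ ≤ lpn (1 - θp) volume (fun t => lpn (1 - θpt) ν (fun x => cylPot ν l φ (t, x))) *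
          lpn θp volume (fun t => lpn θpt ν (fun x => g (t, x))) :=
        lintegral_mul_le_lpn hp0 hp1.le hpφs hgs
    _ ≤ (C * lpn (1 - θp) volume (fun t => lpn (1 - θst) ν (fun x => φ (t, x)))) *
          lpn θp volume (fun t => lpn θpt ν (fun x => g (t, x))) := by gcongr; exact hC φ hφ
    _ = _ := by ring

end cylinder

/-! ### Weak-type interpolation -/

section weak

variable {X : Type*} [MeasurableSpace X] {μ : Measure X}

/-- Two weak-type bounds imply a strong bound for the exponents in between. -/
theorem lintegral_rpow_le_of_measure_le [SFinite μ] {s₀ r s₁ : ℝ} (h0 : 0 < s₀) (h1 : s₀ < r)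
    (h2 : r < s₁) {f : X → ℝ≥0∞} (hf : Measurable f) {K₀ K₁ : ℝ≥0∞}
    (hK₀ : ∀ c : ℝ, 0 < c → μ {x | ENNReal.ofReal c < f x} ≤ K₀ * ENNReal.ofReal c ^ (-s₀))
    (hK₁ : ∀ c : ℝ, 0 < c → μ {x | ENNReal.ofReal c < f x} ≤ K₁ * ENNReal.ofReal c ^ (-s₁)) :
    ∫⁻ x, f x ^ r ∂μ ≤ 2 * ((ENNReal.ofReal (r * (r - s₀)⁻¹) * K₀) ^ ((s₁ - r) / (s₁ - s₀)) *
      (ENNReal.ofReal (r * (s₁ - r)⁻¹) * K₁) ^ ((r - s₀) / (s₁ - s₀))) := by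
  have hr : 0 < r := h0.trans h1
  have hα : 0 < r - s₀ := by linarith
  have hβ : 0 < s₁ - r := by linarith
  have hsum : s₁ - s₀ = (r - s₀) + (s₁ - r) := by ring
  have hzero : (∀ c : ℝ, 0 < c → μ {x | ENNReal.ofReal c < f x} = 0) → ∫⁻ x, f x ^ r ∂μ = 0 := by
    intro h
    rw [lintegral_rpow_eq_lintegral_measure hr hf,
      ← lintegral_zero (μ := volume.restrict (Ioi (0 : ℝ)))]
    refine setLIntegral_congr_fun measurableSet_Ioi fun c hc => ?_
    simp only [h c hc, mul_zero]
  have hpos : ∀ x : ℝ, 0 < x → ENNReal.ofReal (r * x⁻¹) ≠ 0 := fun x hx => by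
    have : 0 < r * x⁻¹ := by positivity
    simpa using this
  -- split the layer-cake integral at a level `L`, use one bound on each side, and optimise in `L`
  rw [hsum]
  refine le_two_mul_rpow_mul_rpow hα hβ (fun L hL => ?_) (fun h => hzero fun c hc => ?_)
    fun h => hzero fun c hc => ?_
  · rw [lintegral_rpow_eq_lintegral_measure hr hf, ← Ioc_union_Ioi_eq_Ioi hL.le]
    refine (lintegral_union_le _ _ _).trans (add_le_add ?_ ?_)
    · calc _ ≤ ∫⁻ c in Ioc 0 L, ENNReal.ofReal r * K₀ * ENNReal.ofReal c ^ (r - s₀ - 1) := by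
            refine setLIntegral_mono' measurableSet_Ioc fun c hc => ?_
            refine (mul_le_mul' le_rfl (hK₀ c hc.1)).trans_eq ?_
            have hc0 : ENNReal.ofReal c ≠ 0 := by simpa using hc.1
            have : r - s₀ - 1 = (r - 1) + -s₀ := by ring
            rw [this, ENNReal.rpow_add _ _ hc0 ENNReal.ofReal_ne_top]
            ring
        _ = _ := by
            rw [lintegral_const_mul _ (measurable_ofReal_rpow _),
              setLIntegral_Ioc_rpow hL (by linarith), sub_add_cancel,
              ENNReal.ofReal_mul hr.le]
            ring
    · calc _ ≤ ∫⁻ c in Ioi L, ENNReal.ofReal r * K₁ * ENNReal.ofReal c ^ (r - s₁ - 1) := by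
            refine setLIntegral_mono' measurableSet_Ioi fun c hc => ?_
            have hc1 : 0 < c := hL.trans hc
            refine (mul_le_mul' le_rfl (hK₁ c hc1)).trans_eq ?_
            have hc0 : ENNReal.ofReal c ≠ 0 := by simpa using hc1
            have : r - s₁ - 1 = (r - 1) + -s₁ := by ring
            rw [this, ENNReal.rpow_add _ _ hc0 ENNReal.ofReal_ne_top]
            ring
        _ = _ := by
            rw [lintegral_const_mul _ (measurable_ofReal_rpow _),
              setLIntegral_Ioi_rpow hL (by linarith), sub_add_cancel, neg_sub,
              ENNReal.ofReal_mul hr.le]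
            ring
  · have := (mul_eq_zero.1 h).resolve_left (hpos _ hα)
    simpa [this] using hK₀ c hc
  · have := (mul_eq_zero.1 h).resolve_left (hpos _ hβ)
    simpa [this] using hK₁ c hc

/-- Chebyshev's inequality. -/
theorem measure_lt_le_lpn {θ : ℝ} (hθ : 0 < θ) {f : X → ℝ≥0∞} (hf : Measurable f) {c : ℝ}
    (hc : 0 < c) :
    μ {x | ENNReal.ofReal c < f x} ≤ lpn θ μ f ^ θ⁻¹ * ENNReal.ofReal c ^ (-θ⁻¹) := by
  have hi : 0 < θ⁻¹ := inv_pos.2 hθ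
  have h1 := mul_meas_ge_le_lintegral (μ := μ) (hf.pow_const θ⁻¹) (ENNReal.ofReal c ^ θ⁻¹)
  have h2 : μ {x | ENNReal.ofReal c < f x} ≤
      μ {x | ENNReal.ofReal c ^ θ⁻¹ ≤ f x ^ θ⁻¹} :=
    measure_mono fun x hx => ENNReal.rpow_le_rpow (le_of_lt hx) hi.le
  rw [lpn_rpow_inv hθ, mul_comm]
  calc _ = ENNReal.ofReal c ^ (-θ⁻¹) * (ENNReal.ofReal c ^ θ⁻¹ *
      μ {x | ENNReal.ofReal c < f x}) := by
        rw [← mul_assoc, mul_comm (ENNReal.ofReal c ^ (-θ⁻¹)), ofReal_rpow_neg_mul_cancel hc,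
          one_mul]
    _ ≤ _ := by
        gcongr
        exact (mul_le_mul' le_rfl h2).trans h1

/-- Interpolation between a weak-type and a strong bound. -/
theorem exists_lpn_le_of_measure_le [SFinite μ] {a θ₁ θ₂ : ℝ} (ha0 : 0 < a) (ha1 : a < 1)
    (h1 : 0 < θ₁) (h2 : 0 < θ₂) (h12 : θ₁ ≠ θ₂) :
    ∃ C : ℝ≥0, ∀ f : X → ℝ≥0∞, Measurable f → ∀ G : ℝ≥0∞,
      (∀ c : ℝ, 0 < c → μ {x | ENNReal.ofReal c < f x} ≤ G ^ θ₁⁻¹ * ENNReal.ofReal c ^ (-θ₁⁻¹)) →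
      lpn (a * θ₁ + (1 - a) * θ₂) μ f ≤ C * (G ^ a * lpn θ₂ μ f ^ (1 - a)) := by
  set θ := a * θ₁ + (1 - a) * θ₂ with hθ
  have ha1' : 0 < 1 - a := by linarith
  have hθ0 : 0 < θ := by positivity
  -- the two exponents play symmetric roles once the strong bound is weakened by Chebyshev's
  -- inequality
  have key : ∀ {b σ₁ σ₂ : ℝ}, 0 < b → b < 1 → 0 < σ₁ → σ₁ < σ₂ → θ = b * σ₁ + (1 - b) * σ₂ →
      ∃ C : ℝ≥0, ∀ f : X → ℝ≥0∞, Measurable f → ∀ G₁ G₂ : ℝ≥0∞,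
      (∀ c : ℝ, 0 < c → μ {x | ENNReal.ofReal c < f x} ≤ G₁ ^ σ₁⁻¹ * ENNReal.ofReal c ^ (-σ₁⁻¹)) →
      (∀ c : ℝ, 0 < c → μ {x | ENNReal.ofReal c < f x} ≤ G₂ ^ σ₂⁻¹ * ENNReal.ofReal c ^ (-σ₂⁻¹)) →
      lpn θ μ f ≤ C * (G₁ ^ b * G₂ ^ (1 - b)) := by
    intro b σ₁ σ₂ hb0 hb1 hσ1 hσ12 hb
    have hσ2 : 0 < σ₂ := hσ1.trans hσ12
    have hb1' : 0 < 1 - b := by linarith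
    have hθσ1 : σ₁ < θ := by nlinarith
    have hθσ2 : θ < σ₂ := by nlinarith
    have hi1 : σ₂⁻¹ < θ⁻¹ := inv_strictAnti₀ hθ0 hθσ2
    have hi2 : θ⁻¹ < σ₁⁻¹ := inv_strictAnti₀ hσ1 hθσ1
    have e0 : (σ₁⁻¹ - θ⁻¹) / (σ₁⁻¹ - σ₂⁻¹) = (1 - b) * (σ₂ * θ⁻¹) := by
      have : σ₂ - σ₁ ≠ 0 := by linarith
      have h3 : θ - σ₁ = (1 - b) * (σ₂ - σ₁) := by rw [hb]; ring
      have h4 : σ₁⁻¹ - θ⁻¹ = (θ - σ₁) * (σ₁⁻¹ * θ⁻¹) := by field_simp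
      have h5 : σ₁⁻¹ - σ₂⁻¹ = (σ₂ - σ₁) * (σ₁⁻¹ * σ₂⁻¹) := by field_simp
      rw [h4, h5, h3]
      field_simp
    have e1 : (θ⁻¹ - σ₂⁻¹) / (σ₁⁻¹ - σ₂⁻¹) = b * (σ₁ * θ⁻¹) := by
      have : σ₂ - σ₁ ≠ 0 := by linarith
      have h3 : σ₂ - θ = b * (σ₂ - σ₁) := by rw [hb]; ring
      have h4 : θ⁻¹ - σ₂⁻¹ = (σ₂ - θ) * (θ⁻¹ * σ₂⁻¹) := by field_simp
      have h5 : σ₁⁻¹ - σ₂⁻¹ = (σ₂ - σ₁) * (σ₁⁻¹ * σ₂⁻¹) := by field_simp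
      rw [h4, h5, h3]
      field_simp
    refine ⟨(2 * ((θ⁻¹ * (θ⁻¹ - σ₂⁻¹)⁻¹).toNNReal ^ ((1 - b) * (σ₂ * θ⁻¹)) *
      (θ⁻¹ * (σ₁⁻¹ - θ⁻¹)⁻¹).toNNReal ^ (b * (σ₁ * θ⁻¹)))) ^ θ, fun f hf G₁ G₂ hG₁ hG₂ => ?_⟩
    have p0 : 0 ≤ (1 - b) * (σ₂ * θ⁻¹) := by positivity
    have p1 : 0 ≤ b * (σ₁ * θ⁻¹) := by positivity
    have := lintegral_rpow_le_of_measure_le (by positivity) hi1 hi2 hf hG₂ hG₁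
    rw [e0, e1, ENNReal.mul_rpow_of_nonneg _ _ p0, ENNReal.mul_rpow_of_nonneg _ _ p1,
      ← ENNReal.rpow_mul, ← ENNReal.rpow_mul] at this
    rw [lpn_of_pos hθ0]
    refine (ENNReal.rpow_le_rpow this hθ0.le).trans_eq ?_
    have q0 : σ₂⁻¹ * ((1 - b) * (σ₂ * θ⁻¹)) = (1 - b) * θ⁻¹ := by field_simp
    have q1 : σ₁⁻¹ * (b * (σ₁ * θ⁻¹)) = b * θ⁻¹ := by field_simp
    have q2 : ∀ G : ℝ≥0∞, ∀ x : ℝ, G ^ x = (G ^ (x * θ⁻¹)) ^ θ := fun G x => by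
      rw [← ENNReal.rpow_mul, mul_assoc, inv_mul_cancel₀ hθ0.ne', mul_one]
    rw [q0, q1, q2 G₁ b, q2 G₂ (1 - b), ENNReal.coe_rpow_of_nonneg _ hθ0.le,
      ← ENNReal.mul_rpow_of_nonneg _ _ hθ0.le, ← ENNReal.mul_rpow_of_nonneg _ _ hθ0.le]
    push_cast
    rw [ENNReal.coe_rpow_of_nonneg _ p0, ENNReal.coe_rpow_of_nonneg _ p1]
    simp only [ENNReal.ofReal]
    congr 1
    ring
  rcases lt_or_gt_of_ne h12 with h | h
  · obtain ⟨C, hC⟩ := key ha0 ha1 h1 h hθ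
    exact ⟨C, fun f hf G hG => hC f hf G _ hG fun c hc => measure_lt_le_lpn h2 hf hc⟩
  · obtain ⟨C, hC⟩ := key ha1' (by linarith) h2 h (by rw [hθ]; ring)
    refine ⟨C, fun f hf G hG => ?_⟩
    have := hC f hf _ G (fun c hc => measure_lt_le_lpn h2 hf hc) hG
    rwa [sub_sub_cancel, mul_comm (lpn θ₂ μ f ^ (1 - a))] at this

end weak

section cylinder

variable {S : Type*} [PseudoMetricSpace S] [MeasurableSpace S] [BorelSpace S]
  [SecondCountableTopology S] {ν : Measure S} [IsFiniteMeasure ν] {N : ℝ} {A : ℝ≥0}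

/-! ### The critical exponent for integrable slices -/

/-- Near part of the potential, integrated over a slice. -/
theorem exists_lintegral_setLIntegral_ball_le (hν : UpperRegular ν N A) {l : ℝ}
    (hl1 : 1 ≤ l) (hl : l < N + 1) :
    ∃ C : ℝ≥0, ∀ g : ℝ × S → ℝ≥0∞, Measurable g → ∀ (t ρ : ℝ), 0 < ρ →
      ∫⁻ x, ∫⁻ w in Metric.ball (t, x) ρ, edist w (t, x) ^ (-l) * g w
        ∂((volume : Measure ℝ).prod ν) ∂ν ≤
        C * maxFun 1 volume (fun s => ∫⁻ ω, g (s, ω) ∂ν) t * ENNReal.ofReal ρ ^ (N + 1 - l) := by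
  -- `ε` makes room to split `l` into subcritical exponents `l₁ < 1` on the axis and `l₂ < N` on `S`
  obtain ⟨ε, hε0, hε1, hεN⟩ : ∃ ε, 0 < ε ∧ ε ≤ 1 ∧ l - 1 + ε < N :=
    ⟨min 1 ((N + 1 - l) / 2), lt_min one_pos (by linarith), min_le_left _ _, by
      have := min_le_right 1 ((N + 1 - l) / 2); linarith⟩
  set l₁ := 1 - ε with hl₁
  set l₂ := l - 1 + ε with hl₂
  have h1 : 0 ≤ l₁ := by linarith
  have h2 : 0 ≤ l₂ := by linarith
  have hsum : l = l₁ + l₂ := by rw [hl₁, hl₂]; ring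
  refine ⟨(N * (N - l₂)⁻¹).toNNReal * A * ((1 - l₁)⁻¹).toNNReal, fun g hg t ρ hρ => ?_⟩
  set F := fun s => ∫⁻ ω, g (s, ω) ∂ν with hF
  have hFm : Measurable F := hg.lintegral_prod_right'
  set κ : ℝ × S → S → ℝ≥0∞ := fun w x =>
    (Metric.ball t ρ).indicator (fun s => edist s t ^ (-l₁)) w.1 *
      {p : S × S | dist p.1 p.2 < ρ}.indicator (fun p => edist p.1 p.2 ^ (-l₂)) (x, w.2) * g w
    with hκ
  have hm1 : Measurable ((Metric.ball t ρ).indicator fun s => edist s t ^ (-l₁)) :=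
    ((measurable_edist_const t).pow_const _).indicator Metric.isOpen_ball.measurableSet
  have hm2 : Measurable ({p : S × S | dist p.1 p.2 < ρ}.indicator
      fun p => edist p.1 p.2 ^ (-l₂)) :=
    ((measurable_fst.edist measurable_snd).pow_const _).indicator
      (measurableSet_lt (measurable_fst.dist measurable_snd) measurable_const)
  have hκm : Measurable fun p : S × (ℝ × S) => κ p.2 p.1 :=
    ((hm1.comp (measurable_fst.comp measurable_snd)).mul
      (hm2.comp (measurable_fst.prodMk (measurable_snd.comp measurable_snd)))).mul
      (hg.comp measurable_snd)
  calc _ ≤ ∫⁻ x, ∫⁻ w, κ w x ∂((volume : Measure ℝ).prod ν) ∂ν := by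
        refine lintegral_mono fun x => ?_
        rw [← lintegral_indicator Metric.isOpen_ball.measurableSet]
        refine lintegral_mono fun w => ?_
        refine indicator_apply_le' (fun hw => ?_) fun _ => zero_le
        rw [← ball_prod_same] at hw
        have hw1 : w.1 ∈ Metric.ball t ρ := hw.1
        have hw2 : (x, w.2) ∈ {p : S × S | dist p.1 p.2 < ρ} := by
          have : dist w.2 x < ρ := hw.2
          rwa [dist_comm] at this
        simp only [hκ]
        rw [indicator_of_mem hw1, indicator_of_mem hw2]
        gcongr
        rw [hsum, edist_comm x]
        exact ENNReal.rpow_neg_add_le h1 h2 (edist_fst_le w (t, x)) (edist_snd_le w (t, x))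
          (edist_ne_top _ _) (edist_ne_top _ _)
    _ = ∫⁻ w, ∫⁻ x, κ w x ∂ν ∂((volume : Measure ℝ).prod ν) :=
        lintegral_lintegral_swap hκm.aemeasurable
    _ ≤ ∫⁻ w, (Metric.ball t ρ).indicator (fun s => edist s t ^ (-l₁)) w.1 *
          (ENNReal.ofReal (N * (N - l₂)⁻¹) * A * ENNReal.ofReal ρ ^ (N - l₂)) * g w
            ∂((volume : Measure ℝ).prod ν) := by
        refine lintegral_mono fun w => ?_
        simp only [hκ]
        have hmx : Measurable fun x => {p : S × S | dist p.1 p.2 < ρ}.indicator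
            (fun p => edist p.1 p.2 ^ (-l₂)) (x, w.2) := hm2.comp measurable_prodMk_right
        rw [lintegral_mul_const _ (hmx.const_mul _), lintegral_const_mul _ hmx]
        gcongr
        refine le_trans (le_of_eq ?_) (setLIntegral_ball_edist_rpow_neg_le h2 hεN hρ (hν w.2))
        rw [← lintegral_indicator Metric.isOpen_ball.measurableSet]
        rfl
    _ = (ENNReal.ofReal (N * (N - l₂)⁻¹) * A * ENNReal.ofReal ρ ^ (N - l₂)) *
          ∫⁻ s in Metric.ball t ρ, edist s t ^ (-l₁) * F s := by
        have hm3 : Measurable fun w : ℝ × S => (Metric.ball t ρ).indicator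
          (fun s => edist s t ^ (-l₁)) w.1 * g w := (hm1.comp measurable_fst).mul hg
        have : ∀ w : ℝ × S, (Metric.ball t ρ).indicator (fun s => edist s t ^ (-l₁)) w.1 *
          (ENNReal.ofReal (N * (N - l₂)⁻¹) * A * ENNReal.ofReal ρ ^ (N - l₂)) * g w =
          (ENNReal.ofReal (N * (N - l₂)⁻¹) * A * ENNReal.ofReal ρ ^ (N - l₂)) *
            ((Metric.ball t ρ).indicator (fun s => edist s t ^ (-l₁)) w.1 * g w) := fun w => by ring
        simp_rw [this]
        rw [lintegral_const_mul _ hm3, lintegral_prod _ hm3.aemeasurable,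
          ← lintegral_indicator Metric.isOpen_ball.measurableSet]
        congr 1
        refine lintegral_congr fun s => ?_
        have hgs : Measurable fun ω => g (s, ω) := hg.comp measurable_prodMk_left
        dsimp only
        rw [lintegral_const_mul _ hgs]
        by_cases hs : s ∈ Metric.ball t ρ
        · rw [indicator_of_mem hs, indicator_of_mem hs]
        · rw [indicator_of_notMem hs, indicator_of_notMem hs, zero_mul]
    _ ≤ (ENNReal.ofReal (N * (N - l₂)⁻¹) * A * ENNReal.ofReal ρ ^ (N - l₂)) *
          (ENNReal.ofReal (1 - l₁)⁻¹ * maxFun 1 volume F t * ENNReal.ofReal ρ ^ (1 - l₁)) := by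
        gcongr
        exact setLIntegral_ball_edist_rpow_mul_le_maxFun h1 (by linarith) hρ hFm t
    _ = _ := by
        have : N + 1 - l = (N - l₂) + (1 - l₁) := by rw [hsum]; ring
        rw [this, ENNReal.rpow_add _ _ (by simpa using hρ) ENNReal.ofReal_ne_top]
        push_cast
        simp only [ENNReal.ofReal]
        ring

/-- On each slice the critical potential of a function with integrable slices is of weak type. -/
theorem exists_measure_cylPot_lt_le (hν : UpperRegular ν N A) (hN : 0 < N) {θst l : ℝ}
    (h0 : 0 < θst) (h1 : θst < 1) (hl : l = N * θst + 1) :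
    ∃ C : ℝ≥0, ∀ g : ℝ × S → ℝ≥0∞, Measurable g → ∀ (t c : ℝ), 0 < c →
      ν {x | ENNReal.ofReal c < cylPot ν l g (t, x)} ≤
        (C * maxFun 1 volume (fun s => ∫⁻ ω, g (s, ω) ∂ν) t) ^ θst⁻¹ *
          ENNReal.ofReal c ^ (-θst⁻¹) := by
  have hNθ : 0 < N * θst := by positivity
  obtain ⟨C1, hC1⟩ := exists_lintegral_setLIntegral_ball_le hν (l := l) (by linarith)
    (by nlinarith)
  obtain ⟨C2, hC2⟩ := exists_setLIntegral_ball_compl_cyl_le hν hN (θpt := 1) (l := l) one_pos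
    le_rfl (by linarith)
  have e1 : N + 1 - l = N * (1 - θst) := by rw [hl]; ring
  have e2 : 1 + N * (1 - 1) - l = -(N * θst) := by rw [hl]; ring
  simp only [e1] at hC1
  simp only [e2, lpn_one] at hC2
  set B : ℝ≥0 := 2 * (C1 + 1) with hB
  set D : ℝ≥0 := 2 * (C2 + 1) with hD
  have hi : 0 < θst⁻¹ := inv_pos.2 h0
  have hi1 : 0 < θst⁻¹ - 1 := by rw [sub_pos]; exact (one_lt_inv₀ h0).2 h1
  have hB0 : 0 < B := by positivity
  have hD0 : 0 < D := by positivity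
  refine ⟨(B * D ^ (θst⁻¹ - 1)) ^ θst, fun g hg t c hc => ?_⟩
  set F := fun s => ∫⁻ ω, g (s, ω) ∂ν with hF
  have hFm : Measurable F := hg.lintegral_prod_right'
  set G := maxFun 1 volume F t with hG
  have hc0 : ENNReal.ofReal c ≠ 0 := by simpa using hc
  rcases eq_or_ne G 0 with h | hG0
  · have hF0 : (fun s => lpn 1 ν (fun ω => g (s, ω))) =ᵐ[volume] 0 := by
      simp only [lpn_one]
      exact ae_eq_zero_of_maxFun_eq_zero hFm h
    have := cylPot_eq_zero (l := l) hg (ae_eq_zero_of_slice one_pos hg hF0)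
    simp [this]
  rcases eq_or_ne G ∞ with h | hGT
  · rw [h, ENNReal.mul_top (by positivity), ENNReal.top_rpow_of_pos hi, ENNReal.top_mul]
    · exact le_top
    · exact (ENNReal.rpow_pos (pos_iff_ne_zero.2 hc0) ENNReal.ofReal_ne_top).ne'
  -- the radius at which the far part is at most half of the level `c`
  set ρ : ℝ := (D * G.toReal / c) ^ (N * θst)⁻¹ with hρ
  have hG' : 0 < G.toReal := ENNReal.toReal_pos hG0 hGT
  have hq : 0 < D * G.toReal / c := by positivity
  have hρ0 : 0 < ρ := Real.rpow_pos_of_pos hq _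
  have hρpow : ∀ x : ℝ, ENNReal.ofReal ρ ^ (N * θst * x) =
      (D * G * (ENNReal.ofReal c)⁻¹) ^ x := fun x => by
    rw [ENNReal.rpow_mul, ENNReal.ofReal_rpow_of_pos hρ0, hρ, Real.rpow_inv_rpow hq.le hNθ.ne',
      div_eq_mul_inv, ENNReal.ofReal_mul (by positivity), ENNReal.ofReal_mul (by positivity),
      ENNReal.ofReal_toReal hGT, ENNReal.ofReal_inv_of_pos hc, ENNReal.ofReal_coe_nnreal]
  have hfar : ∀ x, ∫⁻ w in (Metric.ball (t, x) ρ)ᶜ, edist w (t, x) ^ (-l) * g w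
      ∂((volume : Measure ℝ).prod ν) ≤ ENNReal.ofReal c / 2 := by
    intro x
    refine (hC2 g hg (t, x) ρ hρ0).trans ?_
    have e3 : -(N * θst) = N * θst * (-1) := by ring
    rw [e3, hρpow, ENNReal.rpow_neg_one, ENNReal.le_div_iff_mul_le (by simp) (by simp)]
    have hDG : (D : ℝ≥0∞) * G ≠ 0 := mul_ne_zero (by positivity) hG0
    have hDGT : (D : ℝ≥0∞) * G ≠ ∞ := ENNReal.mul_ne_top (by simp) hGT
    rw [ENNReal.mul_inv (Or.inl hDG) (Or.inl hDGT), inv_inv]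
    calc (C2 : ℝ≥0∞) * G * (((D : ℝ≥0∞) * G)⁻¹ * ENNReal.ofReal c) * 2
        = (2 * C2 * G) * ((D : ℝ≥0∞) * G)⁻¹ * ENNReal.ofReal c := by ring
      _ ≤ ((D : ℝ≥0∞) * G) * ((D : ℝ≥0∞) * G)⁻¹ * ENNReal.ofReal c := by
          gcongr
          rw [hD]
          push_cast
          gcongr
          exact le_self_add
      _ = ENNReal.ofReal c := by rw [ENNReal.mul_inv_cancel hDG hDGT, one_mul]
  set near : S → ℝ≥0∞ := fun x => ∫⁻ w in Metric.ball (t, x) ρ, edist w (t, x) ^ (-l) * g w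
      ∂((volume : Measure ℝ).prod ν) with hnear
  have hsub : {x | ENNReal.ofReal c < cylPot ν l g (t, x)} ⊆
      {x | ENNReal.ofReal c / 2 ≤ near x} := by
    intro x hx
    rw [mem_ofPred_eq, cylPot_eq_lintegral_prod hg,
      ← lintegral_add_compl _ (Metric.isOpen_ball (x := (t, x)) (ε := ρ)).measurableSet] at hx
    rw [mem_ofPred_eq]
    by_contra! hlt
    refine absurd hx (not_lt.2 ?_)
    refine (add_le_add hlt.le (hfar x)).trans_eq (ENNReal.add_halves _)
  have hcheb : ENNReal.ofReal c / 2 * ν {x | ENNReal.ofReal c / 2 ≤ near x} ≤ ∫⁻ x, near x ∂ν := by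
    refine mul_meas_ge_le_lintegral ?_ _
    have hz : Measurable fun p : S × (ℝ × S) => ((t, p.1) : ℝ × S) :=
      measurable_const.prodMk measurable_fst
    have hm : Measurable ({p : S × (ℝ × S) | dist p.2 (t, p.1) < ρ}.indicator fun p =>
        edist p.2 (t, p.1) ^ (-l) * g p.2) :=
      (((measurable_snd.edist hz).pow_const _).mul (hg.comp measurable_snd)).indicator
        (measurableSet_lt (measurable_snd.dist hz) measurable_const)
    convert hm.lintegral_prod_right' (ν := (volume : Measure ℝ).prod ν) using 2 with x
    rw [hnear]
    dsimp only
    rw [← lintegral_indicator Metric.isOpen_ball.measurableSet]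
    rfl
  calc _ ≤ ν {x | ENNReal.ofReal c / 2 ≤ near x} := measure_mono hsub
    _ = 2 * (ENNReal.ofReal c)⁻¹ *
        (ENNReal.ofReal c / 2 * ν {x | ENNReal.ofReal c / 2 ≤ near x}) := by
        rw [← mul_assoc, ENNReal.div_eq_inv_mul]
        have : 2 * (ENNReal.ofReal c)⁻¹ * (2⁻¹ * ENNReal.ofReal c) =
            (2 * 2⁻¹) * ((ENNReal.ofReal c)⁻¹ * ENNReal.ofReal c) := by ring
        rw [this, ENNReal.mul_inv_cancel (by simp) (by simp),
          ENNReal.inv_mul_cancel hc0 ENNReal.ofReal_ne_top, one_mul, one_mul]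
    _ ≤ 2 * (ENNReal.ofReal c)⁻¹ * (C1 * G * ENNReal.ofReal ρ ^ (N * (1 - θst))) := by
        exact mul_le_mul' le_rfl (hcheb.trans (hC1 g hg t ρ hρ0))
    _ ≤ B * (G * (ENNReal.ofReal c)⁻¹) * ENNReal.ofReal ρ ^ (N * (1 - θst)) := by
        have : (2 : ℝ≥0∞) * C1 ≤ B := by
          rw [hB]; push_cast; gcongr; exact le_self_add
        calc _ = 2 * C1 * (G * (ENNReal.ofReal c)⁻¹) * ENNReal.ofReal ρ ^ (N * (1 - θst)) := by ring
          _ ≤ _ := by gcongr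
    _ = _ := by
        have e3 : N * (1 - θst) = N * θst * (θst⁻¹ - 1) := by field_simp
        rw [e3, hρpow, mul_assoc (D : ℝ≥0∞), ENNReal.mul_rpow_of_nonneg _ _ hi1.le,
          ENNReal.coe_rpow_of_nonneg _ h0.le, ENNReal.mul_rpow_of_nonneg _ _ hi.le,
          ← ENNReal.rpow_mul, mul_inv_cancel₀ h0.ne', ENNReal.rpow_one,
          ENNReal.rpow_neg, ← ENNReal.inv_rpow, mul_assoc (((_ : ℝ≥0) : ℝ≥0∞)) (G ^ _),
          ← ENNReal.mul_rpow_of_nonneg _ _ hi.le]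
        push_cast
        rw [ENNReal.coe_rpow_of_nonneg _ hi1.le]
        set Y := G * (ENNReal.ofReal c)⁻¹
        have hY : Y * Y ^ (θst⁻¹ - 1) = Y ^ θst⁻¹ := by
          nth_rewrite 1 [← ENNReal.rpow_one Y]
          rw [← ENNReal.rpow_add_of_nonneg _ _ zero_le_one hi1.le, add_sub_cancel]
        rw [← hY]
        ring

end cylinder

/-! ### The critical exponent with bounded slices -/

/-- The potential whose kernel is `d^{-l}` up to axial distance `ρ` and `ρ d^{-l-1}` beyond. It
controls differences `U(t, x) - U(t, y)` of potentials for `d(x, y) ≤ ρ`. -/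
noncomputable def splitPot {S : Type*} [PseudoMetricSpace S] [MeasurableSpace S] (ν : Measure S)
    (l ρ : ℝ) (g : ℝ × S → ℝ≥0∞) (z : ℝ × S) : ℝ≥0∞ :=
  ∫⁻ s, ∫⁻ ω, (if edist s z.1 < ENNReal.ofReal ρ then edist (s, ω) z ^ (-l) else
    ENNReal.ofReal ρ * edist (s, ω) z ^ (-(l + 1))) * g (s, ω) ∂ν

section cylinder

variable {S : Type*} [PseudoMetricSpace S] [MeasurableSpace S] [BorelSpace S]
  [SecondCountableTopology S] {ν : Measure S} [IsFiniteMeasure ν] {N : ℝ} {A : ℝ≥0}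

theorem measurable_splitPot_kernel (l ρ t : ℝ) : Measurable fun z : (ℝ × S) × S =>
    if edist z.1.1 t < ENNReal.ofReal ρ then edist (z.1.1, z.2) (t, z.1.2) ^ (-l) else
      ENNReal.ofReal ρ * edist (z.1.1, z.2) (t, z.1.2) ^ (-(l + 1)) := by
  refine Measurable.ite ?_ (measurable_edist_slice t l)
    ((measurable_edist_slice t (l + 1)).const_mul _)
  exact measurableSet_lt
    ((measurable_edist_const t).comp (measurable_fst.comp measurable_fst)) measurable_const

theorem measurable_splitPot_slice {l ρ : ℝ} {g : ℝ × S → ℝ≥0∞} (hg : Measurable g) (t : ℝ) :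
    Measurable fun x => splitPot ν l ρ g (t, x) := by
  have h1 : Measurable fun z : (ℝ × S) × S =>
      (if edist z.1.1 t < ENNReal.ofReal ρ then edist (z.1.1, z.2) (t, z.1.2) ^ (-l) else
        ENNReal.ofReal ρ * edist (z.1.1, z.2) (t, z.1.2) ^ (-(l + 1))) * g (z.1.1, z.2) :=
    (measurable_splitPot_kernel l ρ t).mul
      (hg.comp ((measurable_fst.comp measurable_fst).prodMk measurable_snd))
  exact ((h1.lintegral_prod_right').comp measurable_swap).lintegral_prod_right'

/-- The norm of `splitPot` over a slice gains the factor `ρ^{Nθ}`: each of the two regimes of its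
kernel leaves a kernel on the axis that is controlled by the maximal function. -/
theorem exists_lpn_splitPot_le (hν : UpperRegular ν N A) (hN : 0 < N) {θpt θ l : ℝ}
    (hpt0 : 0 < θpt) (hpt1 : θpt ≤ 1) (h0 : 0 < θ) (h1 : θ ≤ θpt) (hNθ : N * θ < 1)
    (hl : l = N * (1 - θpt) + 1) :
    ∃ C : ℝ≥0, ∀ g : ℝ × S → ℝ≥0∞, Measurable g → ∀ t ρ : ℝ, 0 < ρ →
      lpn θ ν (fun x => splitPot ν l ρ g (t, x)) ≤
        C * maxFun 1 volume (fun s => lpn θpt ν (fun ω => g (s, ω))) t *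
          ENNReal.ofReal ρ ^ (N * θ) := by
  have hNθ0 : 0 < N * θ := by positivity
  set b := 1 - N * θ with hb
  have hb0 : 0 < b := by linarith
  set θm := 1 + θ - θpt with hθm
  have hm0 : 0 ≤ θm := by linarith
  have e1 : l - N * θm = b := by rw [hl, hb, hθm]; ring
  have e2 : l + 1 - N * θm = b + 1 := by rw [← e1]; ring
  obtain ⟨C1, hC1⟩ := lpn_edist_slice_le (l := l) hν hN hm0 (by linarith)
  obtain ⟨C2, hC2⟩ := lpn_edist_slice_le (l := l + 1) hν hN hm0 (by linarith)
  rw [e1] at hC1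
  rw [e2] at hC2
  refine ⟨(C1 + 1) * ((1 - b)⁻¹).toNNReal +
    (C2 + 1) * 2 ^ (b + 1) * ((b + 1) * (b + 1 - 1)⁻¹).toNNReal, fun g hg t ρ hρ => ?_⟩
  have hF := measurable_lpn_slice (ν := ν) hpt0 hg
  set F := fun s => lpn θpt ν (fun ω => g (s, ω)) with hFdef
  set κ : ℝ → ℝ≥0∞ := fun s => if edist s t < ENNReal.ofReal ρ then (C1 + 1) * edist s t ^ (-b) else
    ENNReal.ofReal ρ * ((C2 + 1) * edist s t ^ (-(b + 1))) with hκ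
  have hball : MeasurableSet {s | edist s t < ENNReal.ofReal ρ} :=
    measurableSet_lt (measurable_edist_const t) measurable_const
  have hκm : Measurable κ := Measurable.ite hball
    (((measurable_edist_const t).pow_const _).const_mul _)
    ((((measurable_edist_const t).pow_const _).const_mul _).const_mul _)
  have hcol : ∀ s x, lpn θm ν (fun ω => if edist s t < ENNReal.ofReal ρ then
      edist (s, ω) (t, x) ^ (-l) else ENNReal.ofReal ρ * edist (s, ω) (t, x) ^ (-(l + 1))) ≤
          κ s := by
    intro s x
    simp only [hκ]
    -- on the slice through the pole the bound is infinite, whence the constants `C1 + 1`, `C2 + 1`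
    rcases eq_or_ne s t with rfl | hst
    · rw [edist_self, if_pos (by simpa using hρ), ENNReal.zero_rpow_of_neg (by linarith),
        ENNReal.mul_top (by simp)]
      exact le_top
    · split_ifs with h
      · refine (hC1 s t hst x).trans ?_
        gcongr
        exact le_self_add
      · rw [lpn_const_mul _ ENNReal.ofReal_ne_top]
        gcongr
        refine (hC2 s t hst x).trans ?_
        gcongr
        exact le_self_add
  calc _ ≤ ∫⁻ s, κ s * F s := by
        refine lpn_lintegral_slice_le (K := fun s x ω => if edist s t < ENNReal.ofReal ρ then
          edist (s, ω) (t, x) ^ (-l) else ENNReal.ofReal ρ * edist (s, ω) (t, x) ^ (-(l + 1)))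
          hm0 (by linarith) hpt0 hpt1 h0.le (h1.trans hpt1) (by rw [hθm]; ring)
          (measurable_splitPot_kernel l ρ t) hκm hcol (fun s ω => ?_) hg
        have := hcol s ω
        convert this using 4 with x <;>
        · rw [Prod.edist_eq, Prod.edist_eq]
          simp only [edist_comm x ω]
    _ ≤ (C1 + 1) * (∫⁻ s in Metric.ball t ρ, edist s t ^ (-b) * F s) +
          ENNReal.ofReal ρ * ((C2 + 1) * (2 ^ (b + 1) *
            ∫⁻ s, (ENNReal.ofReal ρ + edist s t) ^ (-(b + 1)) * F s)) := by
        rw [← lintegral_const_mul' _ _ (by simp), ← lintegral_const_mul' _ _ (by simp),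
          ← lintegral_const_mul' _ _ (by simp), ← lintegral_const_mul' _ _ (by simp),
          ← lintegral_add_compl _ (Metric.isOpen_ball (x := t) (ε := ρ)).measurableSet]
        refine add_le_add ?_ (le_trans ?_ (setLIntegral_le_lintegral (Metric.ball t ρ)ᶜ _))
        · refine setLIntegral_mono' Metric.isOpen_ball.measurableSet fun s hs => ?_
          rw [Metric.mem_ball, ← edist_lt_ofReal] at hs
          simp only [hκ, if_pos hs, mul_assoc, le_refl]
        · refine setLIntegral_mono' Metric.isOpen_ball.measurableSet.compl fun s hs => ?_
          rw [mem_compl_iff, Metric.mem_ball, ← edist_lt_ofReal] at hs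
          simp only [hκ, if_neg hs, mul_assoc]
          refine mul_le_mul' le_rfl (mul_le_mul' le_rfl ?_)
          rw [← mul_assoc]
          refine mul_le_mul' ?_ le_rfl
          refine ENNReal.rpow_neg_le_two_rpow_mul (by linarith) ?_
          rw [two_mul]
          exact add_le_add (not_lt.1 hs) le_rfl
    _ ≤ (C1 + 1) * (ENNReal.ofReal (1 - b)⁻¹ * maxFun 1 volume F t * ENNReal.ofReal ρ ^ (1 - b)) +
          ENNReal.ofReal ρ * ((C2 + 1) * (2 ^ (b + 1) *
            (ENNReal.ofReal ((b + 1) * (b + 1 - 1)⁻¹) * maxFun 1 volume F t *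
              ENNReal.ofReal ρ ^ (1 - (b + 1))))) := by
        refine add_le_add (mul_le_mul' le_rfl ?_)
          (mul_le_mul' le_rfl (mul_le_mul' le_rfl (mul_le_mul' le_rfl ?_)))
        · exact setLIntegral_ball_edist_rpow_mul_le_maxFun hb0.le (by linarith) hρ hF t
        · exact lintegral_add_edist_rpow_mul_le_maxFun (by linarith) hρ hF t
    _ = _ := by
        have e3 : 1 - b = N * θ := by rw [hb]; ring
        have e4 : ENNReal.ofReal ρ * ENNReal.ofReal ρ ^ (1 - (b + 1)) =
            ENNReal.ofReal ρ ^ (N * θ) := by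
          nth_rewrite 1 [← ENNReal.rpow_one (ENNReal.ofReal ρ)]
          rw [← ENNReal.rpow_add _ _ (by simpa using hρ) ENNReal.ofReal_ne_top]
          congr 1
          rw [hb]; ring
        rw [← e4, e3, ← e4]
        push_cast
        rw [ENNReal.coe_rpow_of_nonneg _ (by linarith)]
        simp only [ENNReal.ofReal, ENNReal.coe_ofNat]
        ring

/-- Averages over balls of radius `ρ`, by Young's inequality. -/
theorem lpn_setLIntegral_ball_le (hν : UpperRegular ν N A) {θ₁ θ₂ : ℝ} (h0 : 0 < θ₂)
    (h12 : θ₂ ≤ θ₁) (h1 : θ₁ ≤ 1) {f : S → ℝ≥0∞} (hf : Measurable f) {ρ : ℝ} (hρ : 0 < ρ) :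
    lpn θ₂ ν (fun x => ∫⁻ y in Metric.ball x ρ, f y ∂ν) ≤
      (A ^ (1 + θ₂ - θ₁) : ℝ≥0) * ENNReal.ofReal ρ ^ (N * (1 + θ₂ - θ₁)) * lpn θ₁ ν f := by
  set θm := 1 + θ₂ - θ₁ with hθm
  have hm0 : 0 < θm := by linarith
  have hm : Measurable ({p : S × S | dist p.2 p.1 < ρ}.indicator (1 : S × S → ℝ≥0∞)) :=
    measurable_one.indicator
      (measurableSet_lt (measurable_snd.dist measurable_fst) measurable_const)
  have hcol : ∀ x, lpn θm ν (fun y => {p : S × S | dist p.2 p.1 < ρ}.indicator (1 : S × S → ℝ≥0∞)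
      (x, y)) ≤ (A ^ θm : ℝ≥0) * ENNReal.ofReal ρ ^ (N * θm) := by
    intro x
    rw [lpn_of_pos hm0, ENNReal.coe_rpow_of_nonneg _ hm0.le, ENNReal.rpow_mul,
      ← ENNReal.mul_rpow_of_nonneg _ _ hm0.le]
    refine ENNReal.rpow_le_rpow ?_ hm0.le
    refine le_trans (le_of_eq ?_) (hν x ρ hρ)
    rw [← lintegral_indicator_one Metric.isOpen_ball.measurableSet]
    refine lintegral_congr fun y => ?_
    by_cases h : dist y x < ρ <;> simp [indicator, h, inv_pos.2 hm0]
  refine le_trans (le_of_eq ?_) (lpn_kernel_le (μ := ν) (ν := ν) (θm := θm) (θp := θ₁) (θq := θ₂)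
    (K := fun x y => {p : S × S | dist p.2 p.1 < ρ}.indicator 1 (x, y)) hm0.le (by linarith)
    (h0.trans_le h12) h1 h0.le (by rw [hθm]; ring) hm hcol (fun y => ?_) hf)
  · congr 1
    ext x
    rw [← lintegral_indicator Metric.isOpen_ball.measurableSet]
    refine lintegral_congr fun y => ?_
    by_cases h : dist y x < ρ <;> simp [indicator, h]
  · refine le_trans (le_of_eq ?_) (hcol y)
    congr 1
    ext x
    simp only [indicator, mem_ofPred_eq, dist_comm, Pi.one_apply]

/-- The kernel bound on differences along a slice, in the form used to compare a function with its
averages. -/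
def SliceDiffBound (ν : Measure S) (l : ℝ) (g U : ℝ × S → ℝ≥0∞) : Prop :=
  ∀ t x y, U (t, x) ≤ U (t, y) + ∫⁻ s, ∫⁻ ω,
    min (edist (s, ω) (t, x) ^ (-l) + edist (s, ω) (t, y) ^ (-l))
      (edist x y * (edist (s, ω) (t, x) ^ (-(l + 1)) + edist (s, ω) (t, y) ^ (-(l + 1)))) *
      g (s, ω) ∂ν

/-- The increment kernel is dominated by its first entry up to axial distance `ρ`, and by its second
entry beyond. -/
theorem SliceDiffBound.le_splitPot {l : ℝ} {g U : ℝ × S → ℝ≥0∞} (h : SliceDiffBound ν l g U)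
    (hg : Measurable g) {t ρ : ℝ} {x y : S} (hxy : edist x y ≤ ENNReal.ofReal ρ) :
    U (t, x) ≤ U (t, y) + (splitPot ν l ρ g (t, x) + splitPot ν l ρ g (t, y)) := by
  refine (h t x y).trans ?_
  gcongr
  have hm : ∀ x : S, Measurable fun z : ℝ × S =>
      (if edist z.1 t < ENNReal.ofReal ρ then edist (z.1, z.2) (t, x) ^ (-l) else
        ENNReal.ofReal ρ * edist (z.1, z.2) (t, x) ^ (-(l + 1))) * g (z.1, z.2) := fun x => by
    have h1 : Measurable fun z : ℝ × S => (((z.1, x), z.2) : (ℝ × S) × S) :=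
      (measurable_fst.prodMk measurable_const).prodMk measurable_snd
    exact ((measurable_splitPot_kernel l ρ t).comp h1).mul hg
  unfold splitPot
  rw [← lintegral_add_left ((hm x).lintegral_prod_right')]
  refine lintegral_mono fun s => ?_
  have hms : Measurable fun ω => (if edist s t < ENNReal.ofReal ρ then
      edist (s, ω) (t, x) ^ (-l) else ENNReal.ofReal ρ * edist (s, ω) (t, x) ^ (-(l + 1))) *
        g (s, ω) := (hm x).comp measurable_prodMk_left
  refine le_of_le_of_eq ?_ (lintegral_add_left hms _)
  refine lintegral_mono fun ω => ?_
  rw [← add_mul]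
  gcongr
  split_ifs with hs
  · exact min_le_left _ _
  · refine (min_le_right _ _).trans ?_
    rw [← mul_add]
    gcongr

/-- A function satisfying `SliceDiffBound` is compared with its average over a ball of a slice. -/
theorem le_avg_add_splitPot {l : ℝ} {g U : ℝ × S → ℝ≥0∞} (h : SliceDiffBound ν l g U)
    (hg : Measurable g) (hU : Measurable U) {c : ℝ≥0} (hc : c ≠ 0) {t ρ : ℝ} (hρ : 0 < ρ) (x : S)
    (hx : c * ENNReal.ofReal ρ ^ N ≤ ν (Metric.ball x ρ)) :
    U (t, x) ≤ splitPot ν l ρ g (t, x) + (c : ℝ≥0∞)⁻¹ * ENNReal.ofReal ρ ^ (-N) *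
      (∫⁻ y in Metric.ball x ρ, U (t, y) ∂ν +
        ∫⁻ y in Metric.ball x ρ, splitPot ν l ρ g (t, y) ∂ν) := by
  set m := ν (Metric.ball x ρ) with hm
  have hρ0 : ENNReal.ofReal ρ ≠ 0 := by simpa using hρ
  have hpos : (c : ℝ≥0∞) * ENNReal.ofReal ρ ^ N ≠ 0 :=
    mul_ne_zero (by simpa using hc) (ENNReal.rpow_pos (pos_iff_ne_zero.2 hρ0)
        ENNReal.ofReal_ne_top).ne'
  have hm0 : m ≠ 0 := fun h => hpos (le_antisymm (h ▸ hx) zero_le)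
  have hmT : m ≠ ∞ := measure_ne_top _ _
  have hUt : Measurable fun y => U (t, y) := hU.comp measurable_prodMk_left
  -- integrate the pointwise comparison over the ball in its second point
  have h1 : m * U (t, x) ≤ m * splitPot ν l ρ g (t, x) +
      (∫⁻ y in Metric.ball x ρ, U (t, y) ∂ν +
        ∫⁻ y in Metric.ball x ρ, splitPot ν l ρ g (t, y) ∂ν) := by
    calc m * U (t, x) = ∫⁻ y in Metric.ball x ρ, U (t, x) ∂ν := by
          rw [setLIntegral_const, mul_comm]
      _ ≤ ∫⁻ y in Metric.ball x ρ, (splitPot ν l ρ g (t, x) +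
            (U (t, y) + splitPot ν l ρ g (t, y))) ∂ν := by
          refine setLIntegral_mono' Metric.isOpen_ball.measurableSet fun y hy => ?_
          refine (h.le_splitPot hg (ρ := ρ) (y := y) ?_).trans_eq (by ring)
          rw [edist_comm]
          exact (edist_lt_ofReal.2 hy).le
      _ = _ := by
          rw [lintegral_add_left measurable_const, lintegral_add_left hUt, setLIntegral_const,
              mul_comm]
  calc U (t, x) = m⁻¹ * (m * U (t, x)) := by
        rw [← mul_assoc, ENNReal.inv_mul_cancel hm0 hmT, one_mul]
    _ ≤ m⁻¹ * (m * splitPot ν l ρ g (t, x) +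
      (∫⁻ y in Metric.ball x ρ, U (t, y) ∂ν +
        ∫⁻ y in Metric.ball x ρ, splitPot ν l ρ g (t, y) ∂ν)) := by
        gcongr
    _ = splitPot ν l ρ g (t, x) + m⁻¹ * (∫⁻ y in Metric.ball x ρ, U (t, y) ∂ν +
          ∫⁻ y in Metric.ball x ρ, splitPot ν l ρ g (t, y) ∂ν) := by
        rw [mul_add, ← mul_assoc, ENNReal.inv_mul_cancel hm0 hmT, one_mul]
    _ ≤ _ := by
        gcongr
        rw [ENNReal.rpow_neg, ← ENNReal.mul_inv (Or.inl (by simpa using hc)) (Or.inl (by simp))]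
        exact ENNReal.inv_le_inv.2 hx

theorem cylPotDecay_le_splitPot (hS : ∀ x y : S, dist x y < 3) {l : ℝ}
    (g : ℝ × S → ℝ≥0∞) (z : ℝ × S) :
    cylPotDecay ν l g z ≤ 3 * splitPot ν l 1 g z := by
  unfold cylPotDecay splitPot
  rw [← lintegral_const_mul' _ _ (by simp)]
  refine lintegral_mono fun s => ?_
  rw [← lintegral_const_mul' _ _ (by simp)]
  refine lintegral_mono fun ω => ?_
  rw [← mul_assoc]
  refine mul_le_mul' ?_ le_rfl
  -- since `S` has diameter less than `3`, the decay along the axis beats the distance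
  have hd : edist (s, ω) z ≤ 3 * (1 + edist s z.1) := by
    refine max_le ?_ ?_
    · refine le_trans ?_ (le_mul_of_one_le_left' (by norm_num))
      exact le_add_self
    · refine le_trans ?_ (mul_le_mul' le_rfl le_self_add)
      rw [mul_one, edist_dist]
      exact ENNReal.ofReal_le_of_le_toReal (by simpa using (hS _ _).le)
  split_ifs with h
  · refine mul_le_mul' ((ENNReal.rpow_neg_le_one zero_le_two le_self_add).trans (by norm_num))
        le_rfl
  · rw [ENNReal.ofReal_one, one_mul]
    have h0 : edist (s, ω) z ≠ 0 := by
      intro h0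
      have : edist s z.1 = 0 := le_antisymm ((edist_fst_le (s, ω) z).trans h0.le) zero_le
      simp [this] at h
    rw [neg_add, add_comm (-l), ENNReal.rpow_add _ _ h0 (edist_ne_top _ _), ← mul_assoc]
    gcongr
    calc (1 + edist s z.1) ^ (-2 : ℝ) ≤ (1 + edist s z.1) ^ (-1 : ℝ) :=
          ENNReal.rpow_le_rpow_of_exponent_le le_self_add (by norm_num)
      _ ≤ 3 * edist (s, ω) z ^ (-1 : ℝ) := by
          rw [ENNReal.rpow_neg_one, ENNReal.rpow_neg_one, ← div_eq_mul_inv,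
            ENNReal.le_div_iff_mul_le (Or.inl h0) (Or.inl (edist_ne_top _ _))]
          calc _ ≤ (1 + edist s z.1)⁻¹ * (3 * (1 + edist s z.1)) := by gcongr
            _ = 3 * ((1 + edist s z.1)⁻¹ * (1 + edist s z.1)) := by ring
            _ = 3 := by
                rw [ENNReal.inv_mul_cancel (by simp) (by simp [edist_ne_top]), mul_one]

/-- On each slice, the critical case in which the potential just fails to be bounded: comparison
with averages over balls of radius `ρ`, optimised in `ρ`. -/
theorem exists_lpn_slice_le_maxFun (hν : UpperRegular ν N A) (hN : 0 < N)
    (hS : ∀ x y : S, dist x y < 3) {c : ℝ≥0} (hc : c ≠ 0)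
    (hlow : ∀ (x : S) (r : ℝ), 0 < r → r ≤ 1 → c * ENNReal.ofReal r ^ N ≤ ν (Metric.ball x r))
    {θpt θ θq l : ℝ} (hpt1 : θpt ≤ 1) (h0 : 0 < θ) (h1 : θ ≤ θpt)
    (hNθ : N * θ < 1) (hq : θ < θq) (hq1 : θq ≤ 1) (hl : l = N * (1 - θpt) + 1) :
    ∃ C : ℝ≥0, ∀ g U : ℝ × S → ℝ≥0∞, Measurable g → Measurable U →
      (∀ z, U z ≤ cylPotDecay ν l g z) → SliceDiffBound ν l g U → ∀ t,
      lpn θ ν (fun x => U (t, x)) ≤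
        C * (maxFun 1 volume (fun s => lpn θpt ν (fun ω => g (s, ω))) t ^ (1 - θ / θq) *
          lpn θq ν (fun x => U (t, x)) ^ (θ / θq)) := by
  have hpt0 : 0 < θpt := h0.trans_le h1
  have hq0 : 0 < θq := h0.trans hq
  obtain ⟨C1, hC1⟩ := exists_lpn_splitPot_le hν hN hpt0 hpt1 h0 h1 hNθ hl
  set B : ℝ≥0 := A ^ (1 + θ - θq) with hB
  set C2 : ℝ≥0 := (1 + c⁻¹ * A) * C1 + c⁻¹ * B + 3 * C1 + 1 with hC2
  have hα : 0 < N * θ := by positivity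
  have hβ : 0 < N * (θq - θ) := mul_pos hN (by linarith)
  have hC20 : (C2 : ℝ≥0∞) ≠ 0 := by
    have : 0 < C2 := by positivity
    exact_mod_cast this.ne'
  refine ⟨2 * C2, fun g U hg hU hU1 hU2 t => ?_⟩
  have hF := measurable_lpn_slice (ν := ν) hpt0 hg
  set F := fun s => lpn θpt ν (fun ω => g (s, ω)) with hFdef
  set G := maxFun 1 volume F t with hG
  set Q := lpn θq ν (fun x => U (t, x)) with hQ
  have hUt : Measurable fun y => U (t, y) := hU.comp measurable_prodMk_left
  have e1 : 1 - θ / θq = N * (θq - θ) / (N * θ + N * (θq - θ)) := by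
    rw [← mul_add, add_sub_cancel]; field_simp
  have e2 : θ / θq = N * θ / (N * θ + N * (θq - θ)) := by
    rw [← mul_add, add_sub_cancel]; field_simp
  have hsum : (C2 : ℝ≥0∞) ^ (1 - θ / θq) * (C2 : ℝ≥0∞) ^ (θ / θq) = C2 := by
    rw [← ENNReal.rpow_add _ _ hC20 (by simp), sub_add_cancel, ENNReal.rpow_one]
  have key : lpn θ ν (fun x => U (t, x)) ≤
      2 * ((C2 * G) ^ (1 - θ / θq) * (C2 * Q) ^ (θ / θq)) := by
    rw [e1, e2]
    refine le_two_mul_rpow_mul_rpow hα hβ (fun ρ hρ => ?_) (fun h => ?_) fun h => ?_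
    · have hρ0 : ENNReal.ofReal ρ ≠ 0 := by simpa using hρ
      -- small balls allow comparison with averages; for `ρ > 1` the bound at `ρ = 1` is already
      -- enough
      rcases le_or_gt ρ 1 with hρ1 | hρ1
      · have hWm : Measurable fun x => splitPot ν l ρ g (t, x) := measurable_splitPot_slice hg t
        have hI : ∀ f : S → ℝ≥0∞, Measurable f →
            Measurable fun x => ∫⁻ y in Metric.ball x ρ, f y ∂ν := fun f hf =>
          (lowerSemicontinuous_setLIntegral_ball ρ).measurable
        set W := fun x => splitPot ν l ρ g (t, x) with hW
        set D := (c : ℝ≥0∞)⁻¹ * ENNReal.ofReal ρ ^ (-N) with hD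
        have hDW : Measurable fun x => D * ∫⁻ y in Metric.ball x ρ, W y ∂ν := (hI W hWm).const_mul _
        have hDU : Measurable fun x => D * ∫⁻ y in Metric.ball x ρ, U (t, y) ∂ν :=
          (hI _ hUt).const_mul _
        calc lpn θ ν (fun x => U (t, x))
            ≤ lpn θ ν (fun x => W x + (D * ∫⁻ y in Metric.ball x ρ, U (t, y) ∂ν +
                D * ∫⁻ y in Metric.ball x ρ, W y ∂ν)) := by
              refine lpn_mono fun x => ?_
              rw [← mul_add]
              exact le_avg_add_splitPot hU2 hg hU hc hρ x (hlow x ρ hρ hρ1)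
          _ ≤ lpn θ ν W + (D * lpn θ ν (fun x => ∫⁻ y in Metric.ball x ρ, U (t, y) ∂ν) +
                D * lpn θ ν (fun x => ∫⁻ y in Metric.ball x ρ, W y ∂ν)) := by
              refine (lpn_add_le (by linarith) hWm (hDU.add hDW)).trans ?_
              gcongr
              refine (lpn_add_le (by linarith) hDU hDW).trans_eq ?_
              rw [lpn_const_mul' _ _ (hI _ hUt), lpn_const_mul' _ _ (hI _ hWm)]
          _ ≤ lpn θ ν W + (D * (B * ENNReal.ofReal ρ ^ (N * (1 + θ - θq)) * Q) +
                D * (A * ENNReal.ofReal ρ ^ N * lpn θ ν W)) := by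
              gcongr
              · exact lpn_setLIntegral_ball_le hν h0 hq.le hq1 hUt hρ
              · have := lpn_setLIntegral_ball_le hν h0 le_rfl (by linarith) hWm hρ
                rwa [add_sub_cancel_right, NNReal.rpow_one, mul_one] at this
          _ = (1 + (c : ℝ≥0∞)⁻¹ * A) * lpn θ ν W +
                (c : ℝ≥0∞)⁻¹ * B * (ENNReal.ofReal ρ ^ (-(N * (θq - θ))) * Q) := by
              have e3 : ENNReal.ofReal ρ ^ (-(N * (θq - θ))) =
                  ENNReal.ofReal ρ ^ (-N) * ENNReal.ofReal ρ ^ (N * (1 + θ - θq)) := by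
                rw [← ENNReal.rpow_add _ _ hρ0 ENNReal.ofReal_ne_top]
                congr 1; ring
              have e4 : ENNReal.ofReal ρ ^ (-N) * ENNReal.ofReal ρ ^ N = 1 := by
                rw [mul_comm]; exact ofReal_rpow_neg_mul_cancel hρ N
              rw [e3, hD]
              calc _ = lpn θ ν W + ((c : ℝ≥0∞)⁻¹ * ENNReal.ofReal ρ ^ (-N) *
                    (B * ENNReal.ofReal ρ ^ (N * (1 + θ - θq)) * Q) +
                    (c : ℝ≥0∞)⁻¹ * (ENNReal.ofReal ρ ^ (-N) * ENNReal.ofReal ρ ^ N) *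
                      A * lpn θ ν W) := by ring
                _ = _ := by rw [e4]; ring
          _ ≤ (1 + (c : ℝ≥0∞)⁻¹ * A) * (C1 * G * ENNReal.ofReal ρ ^ (N * θ)) +
                (c : ℝ≥0∞)⁻¹ * B * (ENNReal.ofReal ρ ^ (-(N * (θq - θ))) * Q) := by
              gcongr
              exact hC1 g hg t ρ hρ
          _ = ENNReal.ofReal ρ ^ (N * θ) * ((1 + (c : ℝ≥0∞)⁻¹ * A) * C1 * G) +
                ENNReal.ofReal ρ ^ (-(N * (θq - θ))) * ((c : ℝ≥0∞)⁻¹ * B * Q) := by ring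
          _ ≤ _ := by
              have hcc : (c : ℝ≥0∞)⁻¹ = ((c⁻¹ : ℝ≥0) : ℝ≥0∞) := (ENNReal.coe_inv hc).symm
              rw [hcc]
              gcongr
              · norm_cast
                rw [hC2, add_assoc, add_assoc]
                exact le_self_add
              · norm_cast
                rw [hC2, add_assoc, add_comm _ (c⁻¹ * B), add_assoc]
                exact le_self_add
      · refine le_trans ?_ le_self_add
        calc lpn θ ν (fun x => U (t, x))
            ≤ lpn θ ν (fun x => 3 * splitPot ν l 1 g (t, x)) :=
              lpn_mono fun x => (hU1 _).trans (cylPotDecay_le_splitPot hS g _)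
          _ = 3 * lpn θ ν (fun x => splitPot ν l 1 g (t, x)) := lpn_const_mul _ (by simp) _
          _ ≤ 3 * (C1 * G * ENNReal.ofReal 1 ^ (N * θ)) := by
              gcongr; exact hC1 g hg t 1 one_pos
          _ = 3 * C1 * G * ENNReal.ofReal 1 ^ (N * θ) := by ring
          _ ≤ C2 * G * ENNReal.ofReal ρ ^ (N * θ) := by
              gcongr
              have : 3 * C1 ≤ C2 := by
                rw [hC2, add_assoc _ (3 * C1), add_comm _ (3 * C1 + 1), add_assoc]
                exact le_self_add
              exact_mod_cast this
          _ = _ := mul_comm _ _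
    · have hF0 := ae_eq_zero_of_maxFun_eq_zero hF ((mul_eq_zero.1 h).resolve_left hC20)
      have h0' := cylPot_eq_zero (l := l) hg (ae_eq_zero_of_slice hpt0 hg hF0)
      refine lpn_of_ae_zero (.of_forall fun x => ?_)
      exact le_antisymm (((hU1 _).trans (cylPotDecay_le_cylPot l g _)).trans (h0' _).le) zero_le
    · exact lpn_of_ae_zero (lpn_eq_zero hq0 hUt ((mul_eq_zero.1 h).resolve_left hC20))
  have p1 : 0 ≤ 1 - θ / θq := by rw [sub_nonneg, div_le_one hq0]; exact hq.le
  refine key.trans_eq ?_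
  rw [ENNReal.mul_rpow_of_nonneg _ _ p1, ENNReal.mul_rpow_of_nonneg _ _ (by positivity)]
  push_cast
  calc _ = 2 * ((C2 : ℝ≥0∞) ^ (1 - θ / θq) * (C2 : ℝ≥0∞) ^ (θ / θq)) *
        (G ^ (1 - θ / θq) * Q ^ (θ / θq)) := by ring
    _ = _ := by rw [hsum]

/-- The case `θst = 0` of the critical estimate. The exponent is reached from that of
`exists_lpn_slice_le_maxFun` by a further application of Hölder's inequality. -/
theorem exists_lpn_slice_le_maxFun_rpow (hν : UpperRegular ν N A) (hN : 0 < N)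
    (hS : ∀ x y : S, dist x y < 3) {c : ℝ≥0} (hc : c ≠ 0)
    (hlow : ∀ (x : S) (r : ℝ), 0 < r → r ≤ 1 → c * ENNReal.ofReal r ^ N ≤ ν (Metric.ball x r))
    {a θpt θq l : ℝ} (ha0 : 0 < a) (ha1 : a < 1) (hpt0 : 0 < θpt) (hpt1 : θpt ≤ 1) (hq0 : 0 < θq)
    (hq1 : θq ≤ 1) (hl : l = N * (1 - θpt) + 1) :
    ∃ C : ℝ≥0, ∀ g U : ℝ × S → ℝ≥0∞, Measurable g → Measurable U →
      (∀ z, U z ≤ cylPotDecay ν l g z) → SliceDiffBound ν l g U → ∀ t,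
      lpn ((1 - a) * θq) ν (fun x => U (t, x)) ≤
        C * (maxFun 1 volume (fun s => lpn θpt ν (fun ω => g (s, ω))) t ^ a *
          lpn θq ν (fun x => U (t, x)) ^ (1 - a)) := by
  have ha1' : 0 < 1 - a := by linarith
  -- the auxiliary exponent `1 / θ` exceeds `N` and is at least `1 / θpt` and `1 / ((1 - a) θq)`
  obtain ⟨θ, h0, h1, h2, hNθ⟩ : ∃ θ, 0 < θ ∧ θ ≤ θpt ∧ θ ≤ (1 - a) * θq ∧ N * θ < 1 := by
    refine ⟨min (min θpt ((1 - a) * θq)) (N⁻¹ / 2), by positivity,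
      (min_le_left _ _).trans (min_le_left _ _), (min_le_left _ _).trans (min_le_right _ _), ?_⟩
    calc _ ≤ N * (N⁻¹ / 2) := by gcongr; exact min_le_right _ _
      _ < 1 := by field_simp; norm_num
  have hq : θ < θq := by nlinarith
  obtain ⟨C, hC⟩ := exists_lpn_slice_le_maxFun hν hN hS hc hlow hpt1 h0 h1 hNθ hq hq1 hl
  -- the weight `x` solves `(1 - a) θq = x θ + (1 - x) θq`
  set x := a * θq / (θq - θ) with hx
  have hd : 0 < θq - θ := by linarith
  have hx0 : 0 < x := by positivity
  have hx1 : x ≤ 1 := by rw [hx, div_le_one hd]; linarith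
  have e1 : (1 - a) * θq = x * θ + (1 - x) * θq := by rw [hx]; field_simp; ring
  have e2 : (1 - θ / θq) * x = a := by rw [hx]; field_simp
  have e3 : θ / θq * x + (1 - x) = 1 - a := by linarith
  refine ⟨C ^ x, fun g U hg hU hU1 hU2 t => ?_⟩
  have hUt : Measurable fun y => U (t, y) := hU.comp measurable_prodMk_left
  have := lpn_rpow_mul_rpow_le (μ := ν) hx0 hx1 h0.le hq0 hUt hUt (by rw [← e1]; positivity)
  rw [← e1] at this
  have e4 : ∀ y : S, U (t, y) ^ x * U (t, y) ^ (1 - x) = U (t, y) := fun y => by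
    rw [← ENNReal.rpow_add_of_nonneg _ _ hx0.le (by linarith), add_sub_cancel, ENNReal.rpow_one]
  simp_rw [e4] at this
  refine this.trans ((mul_le_mul' (ENNReal.rpow_le_rpow (hC g U hg hU hU1 hU2 t) hx0.le)
    le_rfl).trans_eq ?_)
  rw [ENNReal.mul_rpow_of_nonneg _ _ hx0.le, ENNReal.mul_rpow_of_nonneg _ _ hx0.le,
    ← ENNReal.rpow_mul, ← ENNReal.rpow_mul, e2, ENNReal.coe_rpow_of_nonneg _ hx0.le, mul_assoc,
    mul_assoc, ← ENNReal.rpow_add_of_nonneg _ _ (by positivity) (by linarith), e3]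

end cylinder

/-! ### The interpolation inequality on the cylinder -/

section cylinder

variable {S : Type*} [PseudoMetricSpace S] [MeasurableSpace S] [BorelSpace S]
  [SecondCountableTopology S] {ν : Measure S} [IsFiniteMeasure ν] {N : ℝ} {A : ℝ≥0}

theorem lpn_le_rpow_mul_rpow {X : Type*} [MeasurableSpace X] {μ : Measure X} {a θ₁ θ₂ : ℝ}
    (ha0 : 0 < a) (ha1 : a ≤ 1) (h1 : 0 ≤ θ₁) (h2 : 0 < θ₂) (hθ : 0 < a * θ₁ + (1 - a) * θ₂)
    {f : X → ℝ≥0∞} (hf : Measurable f) :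
    lpn (a * θ₁ + (1 - a) * θ₂) μ f ≤ lpn θ₁ μ f ^ a * lpn θ₂ μ f ^ (1 - a) := by
  have := lpn_rpow_mul_rpow_le (μ := μ) ha0 ha1 h1 h2 hf hf hθ
  have e : ∀ y, f y ^ a * f y ^ (1 - a) = f y := fun y => by
    rw [← ENNReal.rpow_add_of_nonneg _ _ ha0.le (by linarith), add_sub_cancel, ENNReal.rpow_one]
  simpa only [e] using this

/-- The slice norms are interpolated with a function `H` of the axial variable which is controlled
by the density of the potential. -/
theorem exists_slice_interpolation (hν : UpperRegular ν N A) (hN : 0 < N) (hA : 0 < A)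
    (hS : ∀ x y : S, dist x y < 3) {c : ℝ≥0} (hc : c ≠ 0)
    (hlow : ∀ (x : S) (r : ℝ), 0 < r → r ≤ 1 → c * ENNReal.ofReal r ^ N ≤ ν (Metric.ball x r))
    {a θp θs θpt θst θqt l : ℝ} (ha0 : 0 < a) (ha1 : a ≤ 1) (hp0 : 0 < θp) (hp1 : θp ≤ 1)
    (hs0 : 0 ≤ θs) (hsp : θs ≤ θp) (hpt0 : 0 < θpt) (hpt1 : θpt ≤ 1) (hst0 : 0 ≤ θst)
    (hstp : θst ≤ θpt) (hqt0 : 0 < θqt) (hqt1 : θqt ≤ 1) (hrt : 0 < a * θst + (1 - a) * θqt)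
    (hl0 : 0 < l) (hl1 : l < N + 1)
    (hl : (θp < 1 ∧ 0 < θs ∧ l ≤ N * (1 + θst - θpt) + (1 + θs - θp)) ∨
      l < N * (1 + θst - θpt) + (1 + θs - θp))
    (hcorner : ¬ (l = N * (1 + θst - θpt) + (1 + θs - θp) ∧ θs = θp ∧ θpt = 1 ∧
      θst = a * θst + (1 - a) * θqt)) :
    ∃ C : ℝ≥0, ∀ g U : ℝ × S → ℝ≥0∞, Measurable g → Measurable U →
      (∀ z, U z ≤ cylPotDecay ν l g z) → SliceDiffBound ν l g U →
      ∃ H : ℝ → ℝ≥0∞, Measurable H ∧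
        lpn θs volume H ≤ C * lpn θp volume (fun s => lpn θpt ν (fun ω => g (s, ω))) ∧
        ∀ t, lpn (a * θst + (1 - a) * θqt) ν (fun x => U (t, x)) ≤
          H t ^ a * lpn θqt ν (fun x => U (t, x)) ^ (1 - a) := by
  -- a bound for the slice norms with exponent `θst` suffices, by Hölder's inequality
  have of_slice : (∃ C : ℝ≥0, ∀ g : ℝ × S → ℝ≥0∞, Measurable g → ∃ H : ℝ → ℝ≥0∞, Measurable H ∧
      lpn θs volume H ≤ C * lpn θp volume (fun s => lpn θpt ν (fun ω => g (s, ω))) ∧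
      ∀ t, lpn θst ν (fun x => cylPotDecay ν l g (t, x)) ≤ H t) →
      ∃ C : ℝ≥0, ∀ g U : ℝ × S → ℝ≥0∞, Measurable g → Measurable U →
      (∀ z, U z ≤ cylPotDecay ν l g z) → SliceDiffBound ν l g U →
      ∃ H : ℝ → ℝ≥0∞, Measurable H ∧
        lpn θs volume H ≤ C * lpn θp volume (fun s => lpn θpt ν (fun ω => g (s, ω))) ∧
        ∀ t, lpn (a * θst + (1 - a) * θqt) ν (fun x => U (t, x)) ≤
          H t ^ a * lpn θqt ν (fun x => U (t, x)) ^ (1 - a) := by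
    rintro ⟨C, hC⟩
    refine ⟨C, fun g U hg hU hU1 _ => ?_⟩
    obtain ⟨H, hHm, hH, hH'⟩ := hC g hg
    refine ⟨H, hHm, hH, fun t => ?_⟩
    refine (lpn_le_rpow_mul_rpow ha0 ha1 hst0 hqt0 hrt (hU.comp measurable_prodMk_left)).trans
      (mul_le_mul' (ENNReal.rpow_le_rpow ?_ ha0.le) le_rfl)
    exact (lpn_mono fun x => hU1 (t, x)).trans (hH' t)
  -- a multiple of the maximal function is an admissible `H` when `θs = θp < 1`
  have of_maxFun : θs = θp → θp < 1 → (∃ C : ℝ≥0, ∀ g U : ℝ × S → ℝ≥0∞, Measurable g →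
      Measurable U → (∀ z, U z ≤ cylPotDecay ν l g z) → SliceDiffBound ν l g U → ∀ t,
      lpn (a * θst + (1 - a) * θqt) ν (fun x => U (t, x)) ≤
        C * (maxFun 1 volume (fun s => lpn θpt ν (fun ω => g (s, ω))) t ^ a *
          lpn θqt ν (fun x => U (t, x)) ^ (1 - a))) →
      ∃ C : ℝ≥0, ∀ g U : ℝ × S → ℝ≥0∞, Measurable g → Measurable U →
      (∀ z, U z ≤ cylPotDecay ν l g z) → SliceDiffBound ν l g U →
      ∃ H : ℝ → ℝ≥0∞, Measurable H ∧
        lpn θs volume H ≤ C * lpn θp volume (fun s => lpn θpt ν (fun ω => g (s, ω))) ∧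
        ∀ t, lpn (a * θst + (1 - a) * θqt) ν (fun x => U (t, x)) ≤
          H t ^ a * lpn θqt ν (fun x => U (t, x)) ^ (1 - a) := by
    rintro rfl hs1 ⟨C, hC⟩
    obtain ⟨C', hC'⟩ := exists_lpn_maxFun_le hp0 hs1
    refine ⟨C ^ a⁻¹ * C', fun g U hg hU hU1 hU2 => ?_⟩
    refine ⟨fun t => (C : ℝ≥0∞) ^ a⁻¹ * maxFun 1 volume (fun s => lpn θpt ν (fun ω => g (s, ω))) t,
      measurable_maxFun.const_mul _, ?_, fun t => ?_⟩
    · rw [lpn_const_mul' _ _ measurable_maxFun, ENNReal.coe_mul,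
        ENNReal.coe_rpow_of_nonneg _ (inv_nonneg.2 ha0.le), mul_assoc]
      gcongr
      exact hC' _ (measurable_lpn_slice hpt0 hg)
    · refine (hC g U hg hU hU1 hU2 t).trans_eq ?_
      rw [ENNReal.mul_rpow_of_nonneg _ _ ha0.le, ENNReal.rpow_inv_rpow ha0.ne', mul_assoc]
  by_cases hlt : l < N * (1 + θst - θpt) + (1 + θs - θp)
  · exact of_slice (exists_slice_bound_of_lt hν hN hS hp0 hp1 hs0 hsp hpt0 hpt1 hst0 hstp hl0 hlt)
  obtain ⟨hp1, hs0, hl⟩ := hl.resolve_right hlt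
  have hleq := le_antisymm hl (not_lt.1 hlt)
  have of_cylPot := fun (h : ∃ C : ℝ≥0, ∀ g : ℝ × S → ℝ≥0∞, Measurable g →
      ∃ H : ℝ → ℝ≥0∞, Measurable H ∧
      lpn θs volume H ≤ C * lpn θp volume (fun s => lpn θpt ν (fun ω => g (s, ω))) ∧
      ∀ t, lpn θst ν (fun x => cylPot ν l g (t, x)) ≤ H t) =>
    of_slice (h.imp fun C hC g hg => (hC g hg).imp fun H ⟨h1, h2, h3⟩ => ⟨h1, h2, fun t =>
      (lpn_mono fun _ => cylPotDecay_le_cylPot l g _).trans (h3 t)⟩)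
  rcases hsp.lt_or_eq with hsp | hsp
  · exact of_cylPot (exists_slice_bound_of_eq hν hN hs0 hsp hp1 hpt0 hpt1 hst0 hstp hleq)
  have hl2 : l = N * (1 + θst - θpt) + 1 := by rw [hleq, hsp]; ring
  have hstp' : θst < θpt := by
    have : N * (1 + θst - θpt) < N * 1 := by linarith
    linarith [lt_of_mul_lt_mul_left this hN.le]
  rcases hst0.eq_or_lt with rfl | hst0
  · refine of_maxFun hsp hp1 ?_
    have ha1 : a < 1 := by
      refine ha1.lt_of_ne ?_
      rintro rfl
      simp at hrt
    obtain ⟨C, hC⟩ := exists_lpn_slice_le_maxFun_rpow hν hN hS hc hlow (l := l) ha0 ha1 hpt0 hpt1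
      hqt0 hqt1 (by rw [hl2, add_zero])
    refine ⟨C, fun g U hg hU hU1 hU2 t => ?_⟩
    rw [mul_zero, zero_add]
    exact hC g U hg hU hU1 hU2 t
  rcases hpt1.lt_or_eq with hpt1 | rfl
  · obtain ⟨C, hC⟩ := exists_lpn_cylPot_le hν hN hA (l := l) hp0 hp1 hpt1 hst0 hstp' hl2
    refine of_cylPot ⟨C, fun g hg => ⟨fun t => lpn θst ν (fun x => cylPot ν l g (t, x)),
      measurable_lpn_slice hst0 (measurable_cylPot hg), ?_, fun t => le_rfl⟩⟩
    rw [hsp]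
    exact hC g hg
  · refine of_maxFun hsp hp1 ?_
    have hne : θst ≠ a * θst + (1 - a) * θqt := fun h => hcorner ⟨hleq, hsp, rfl, h⟩
    have ha1 : a < 1 := by
      refine ha1.lt_of_ne ?_
      rintro rfl
      simp at hne
    have hne' : θst ≠ θqt := by
      rintro rfl
      exact hne (by ring)
    obtain ⟨C1, hC1⟩ := exists_measure_cylPot_lt_le hν hN (l := l) hst0 hstp' (by rw [hl2]; ring)
    obtain ⟨C2, hC2⟩ := exists_lpn_le_of_measure_le (μ := ν) ha0 ha1 hst0 hqt0 hne'
    refine ⟨C2 * C1 ^ a, fun g U hg hU hU1 hU2 t => ?_⟩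
    refine (hC2 _ (hU.comp measurable_prodMk_left)
      (C1 * maxFun 1 volume (fun s => ∫⁻ ω, g (s, ω) ∂ν) t) fun b hb => ?_).trans_eq ?_
    · refine (measure_mono fun x hx => ?_).trans (hC1 g hg t b hb)
      exact lt_of_lt_of_le hx ((hU1 _).trans (cylPotDecay_le_cylPot l g _))
    · simp only [lpn_one]
      rw [ENNReal.mul_rpow_of_nonneg _ _ ha0.le, ENNReal.coe_mul,
        ENNReal.coe_rpow_of_nonneg _ ha0.le, mul_assoc, mul_assoc]
      rfl

/-- Hölder's inequality along the axis turns the slice interpolation into an inequality between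
mixed norms; an arbitrary axial weight may be placed on the interpolating norm. -/
theorem exists_lpn_lpn_interpolation (hν : UpperRegular ν N A) (hN : 0 < N) (hA : 0 < A)
    (hS : ∀ x y : S, dist x y < 3) {c : ℝ≥0} (hc : c ≠ 0)
    (hlow : ∀ (x : S) (r : ℝ), 0 < r → r ≤ 1 → c * ENNReal.ofReal r ^ N ≤ ν (Metric.ball x r))
    {a θp θs θq θpt θst θqt l : ℝ} (ha0 : 0 < a) (ha1 : a ≤ 1) (hp0 : 0 < θp) (hp1 : θp ≤ 1)
    (hs0 : 0 ≤ θs) (hsp : θs ≤ θp) (hpt0 : 0 < θpt) (hpt1 : θpt ≤ 1) (hst0 : 0 ≤ θst)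
    (hstp : θst ≤ θpt) (hq0 : 0 < θq) (hqt0 : 0 < θqt) (hqt1 : θqt ≤ 1)
    (hr : 0 < a * θs + (1 - a) * θq) (hrt : 0 < a * θst + (1 - a) * θqt)
    (hl0 : 0 < l) (hl1 : l < N + 1)
    (hl : (θp < 1 ∧ 0 < θs ∧ l ≤ N * (1 + θst - θpt) + (1 + θs - θp)) ∨
      l < N * (1 + θst - θpt) + (1 + θs - θp))
    (hcorner : ¬ (l = N * (1 + θst - θpt) + (1 + θs - θp) ∧ θs = θp ∧ θpt = 1 ∧
      θst = a * θst + (1 - a) * θqt)) :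
    ∃ C : ℝ≥0, ∀ g U : ℝ × S → ℝ≥0∞, Measurable g → Measurable U →
      (∀ z, U z ≤ cylPotDecay ν l g z) → SliceDiffBound ν l g U → ∀ w : ℝ → ℝ≥0∞, Measurable w →
      lpn (a * θs + (1 - a) * θq) volume
        (fun t => w t ^ (1 - a) * lpn (a * θst + (1 - a) * θqt) ν (fun x => U (t, x))) ≤
        C * lpn θp volume (fun s => lpn θpt ν (fun ω => g (s, ω))) ^ a *
          lpn θq volume (fun t => w t * lpn θqt ν (fun x => U (t, x))) ^ (1 - a) := by
  obtain ⟨C, hC⟩ := exists_slice_interpolation hν hN hA hS hc hlow ha0 ha1 hp0 hp1 hs0 hsp hpt0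
    hpt1 hst0 hstp hqt0 hqt1 hrt hl0 hl1 hl hcorner
  refine ⟨C ^ a, fun g U hg hU hU1 hU2 w hw => ?_⟩
  obtain ⟨H, hHm, hH, hH'⟩ := hC g U hg hU hU1 hU2
  have hwm : Measurable fun t => w t * lpn θqt ν (fun x => U (t, x)) :=
    hw.mul (measurable_lpn_slice hqt0 hU)
  refine (lpn_mono (g := fun t => H t ^ a * (w t * lpn θqt ν (fun x => U (t, x))) ^ (1 - a))
    fun t => ?_).trans ((lpn_rpow_mul_rpow_le ha0 ha1 hs0 hq0 hHm hwm hr).trans ?_)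
  · rw [ENNReal.mul_rpow_of_nonneg _ _ (by linarith), mul_left_comm]
    exact mul_le_mul' le_rfl (hH' t)
  · rw [ENNReal.coe_rpow_of_nonneg _ ha0.le, ← ENNReal.mul_rpow_of_nonneg _ _ ha0.le]
    gcongr

end cylinder

/-! ### Measure of spherical caps -/

section sphere

open scoped Pointwise

variable {E : Type*} [NormedAddCommGroup E] [NormedSpace ℝ E] [MeasurableSpace E] [BorelSpace E]
  [FiniteDimensional ℝ E] (μ : Measure E) [μ.IsAddHaarMeasure]

theorem dist_sphere_lt_three (x y : Metric.sphere (0 : E) 1) : dist x y < 3 := by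
  have hx : ‖(x : E)‖ = 1 := norm_eq_of_mem_sphere x
  have hy : ‖(y : E)‖ = 1 := norm_eq_of_mem_sphere y
  have := norm_sub_le (x : E) (y : E)
  rw [Subtype.dist_eq, dist_eq_norm]
  linarith

theorem ENNReal.ofReal_pow_finrank_mul {n : ℕ} {r : ℝ} (hr : 0 < r) :
    ENNReal.ofReal (1 / r) * ENNReal.ofReal (r ^ n) = ENNReal.ofReal r ^ ((n : ℝ) - 1) := by
  rw [← ENNReal.ofReal_mul (by positivity), ENNReal.ofReal_rpow_of_pos hr,
    Real.rpow_sub_one hr.ne', Real.rpow_natCast]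
  congr 1
  field_simp

/-- Spherical caps of radius `r` have measure at most `A r^{n-1}`: the cone over the cap is covered
by `O(1/r)` balls of radius `2r`. -/
theorem exists_upperRegular_toSphere :
    ∃ A : ℝ≥0, 0 < A ∧ UpperRegular μ.toSphere ((Module.finrank ℝ E : ℝ) - 1) A := by
  set n := Module.finrank ℝ E with hn
  set b := μ (Metric.ball (0 : E) 1) with hb
  have hbT : b ≠ ∞ := measure_ball_lt_top.ne
  set V := μ.toSphere univ with hV
  have hVT : V ≠ ∞ := measure_ne_top _ _
  refine ⟨n * (2 * (2 ^ n * b.toNNReal)) + V.toNNReal + 1, by positivity, fun θ r hr => ?_⟩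
  push_cast
  rw [ENNReal.coe_toNNReal hbT, ENNReal.coe_toNNReal hVT]
  -- for `r > 1` the total measure suffices
  rcases lt_or_ge 1 r with hr1 | hr1
  · rcases n.eq_zero_or_pos with h0 | hn0
    · rw [Measure.toSphere_apply' _ Metric.isOpen_ball.measurableSet, ← hn, h0]
      simp
    calc μ.toSphere (Metric.ball θ r) ≤ V * 1 := by rw [mul_one]; exact measure_mono (subset_univ _)
      _ ≤ _ := by
        have hn1 : (0 : ℝ) ≤ (n : ℝ) - 1 := by
          have : (1 : ℝ) ≤ n := by exact_mod_cast hn0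
          linarith
        gcongr
        · rw [add_assoc, add_comm V, ← add_assoc]; exact le_add_self
        · have := ENNReal.rpow_le_rpow (ENNReal.one_le_ofReal.2 hr1.le) hn1
          rwa [ENNReal.one_rpow] at this
  set k := ⌊1 / r⌋₊ with hk
  -- the point `s ω` of the cone lies in the ball centred at the multiple of `r θ` just below `s`
  have hcov : Ioo (0 : ℝ) 1 • ((↑) '' Metric.ball θ r : Set E) ⊆
      ⋃ j ∈ Finset.range (k + 1), Metric.ball (((j : ℝ) * r) • (θ : E)) (2 * r) := by
    rintro _ ⟨s, hs, _, ⟨ω, hω, rfl⟩, rfl⟩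
    have hθ : ‖(θ : E)‖ = 1 := norm_eq_of_mem_sphere θ
    simp only [mem_iUnion, Finset.mem_range]
    have hsr : 0 ≤ s / r := div_nonneg hs.1.le hr.le
    refine ⟨⌊s / r⌋₊, Nat.lt_succ_of_le (Nat.floor_le_floor ?_), ?_⟩
    · gcongr; exact hs.2.le
    · have h1 := Nat.floor_le hsr
      have h2 := Nat.lt_floor_add_one (s / r)
      set j : ℝ := ((⌊s / r⌋₊ : ℕ) : ℝ) with hj
      rw [le_div_iff₀ hr] at h1
      rw [div_lt_iff₀ hr] at h2
      have h3 : ‖(ω : E) - θ‖ < r := by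
        rwa [Metric.mem_ball, Subtype.dist_eq, dist_eq_norm] at hω
      rw [Metric.mem_ball, dist_eq_norm]
      have h4 : s • (ω : E) - (j * r) • (θ : E) = s • ((ω : E) - θ) + (s - j * r) • (θ : E) := by
        rw [smul_sub, sub_smul]; abel
      rw [h4]
      refine (norm_add_le _ _).trans_lt ?_
      rw [norm_smul, norm_smul, hθ, mul_one, Real.norm_of_nonneg hs.1.le,
        Real.norm_of_nonneg (by linarith)]
      nlinarith [norm_nonneg ((ω : E) - θ), hs.1, hs.2]
  rw [Measure.toSphere_apply' _ Metric.isOpen_ball.measurableSet, ← hn]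
  have hkr : ((k + 1 : ℕ) : ℝ≥0∞) ≤ 2 * ENNReal.ofReal (1 / r) := by
    have h1 : (1 : ℝ) ≤ 1 / r := by rw [le_div_iff₀ hr]; linarith
    have h2 : (k : ℝ) ≤ 1 / r := Nat.floor_le (by positivity)
    rw [← ENNReal.ofReal_natCast, ← ENNReal.ofReal_ofNat 2, ← ENNReal.ofReal_mul zero_le_two]
    refine ENNReal.ofReal_le_ofReal ?_
    push_cast
    linarith
  calc n * μ (Ioo (0 : ℝ) 1 • ((↑) '' Metric.ball θ r : Set E))
      ≤ n * ∑ j ∈ Finset.range (k + 1), μ (Metric.ball (((j : ℝ) * r) • (θ : E)) (2 * r)) := by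
        gcongr
        exact (measure_mono hcov).trans (measure_biUnion_finset_le _ _)
    _ = n * (((k + 1 : ℕ) : ℝ≥0∞) * (ENNReal.ofReal ((2 * r) ^ n) * b)) := by
        simp_rw [Measure.addHaar_ball_of_pos μ _ (by positivity : 0 < 2 * r), ← hn, ← hb]
        rw [Finset.sum_const, Finset.card_range, nsmul_eq_mul]
    _ ≤ n * (2 * ENNReal.ofReal (1 / r) * (ENNReal.ofReal ((2 * r) ^ n) * b)) := by gcongr
    _ = n * (2 * (2 ^ n * b)) * ENNReal.ofReal r ^ ((n : ℝ) - 1) := by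
        rw [← ENNReal.ofReal_pow_finrank_mul hr, mul_pow, ENNReal.ofReal_mul (by positivity),
          ENNReal.ofReal_pow zero_le_two, ENNReal.ofReal_ofNat]
        ring
    _ ≤ _ := by
        gcongr
        rw [add_assoc]
        exact le_self_add

/-- Spherical caps of radius `r ≤ 1` have measure at least `c r^{n-1}`: the cone over the cap
contains about `1/r` disjoint balls of radius `r/8`. -/
theorem exists_le_toSphere_ball [Nontrivial E] :
    ∃ c : ℝ≥0, c ≠ 0 ∧ ∀ (θ : Metric.sphere (0 : E) 1) (r : ℝ), 0 < r → r ≤ 1 →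
      c * ENNReal.ofReal r ^ ((Module.finrank ℝ E : ℝ) - 1) ≤ μ.toSphere (Metric.ball θ r) := by
  set n := Module.finrank ℝ E with hn
  have hn0 : 0 < n := Module.finrank_pos
  set b := μ (Metric.ball (0 : E) 1) with hb
  have hbT : b ≠ ∞ := measure_ball_lt_top.ne
  have hb0 : 0 < b.toNNReal :=
    ENNReal.toNNReal_pos (Metric.measure_ball_pos μ _ one_pos).ne' hbT
  refine ⟨n * ((1 / 8) ^ n * b.toNNReal), by positivity, fun θ r hr hr1 => ?_⟩
  have hθ : ‖(θ : E)‖ = 1 := norm_eq_of_mem_sphere θ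
  set k := ⌊1 / r⌋₊ with hk
  -- balls on the ray through `θ` at heights between `1/2` and `3/4`, where the cone has width `≳ r`
  set ctr : ℕ → E := fun j => (1 / 2 + j * r / 4) • (θ : E) with hctr
  have hsub : ⋃ j ∈ Finset.range (k + 1), Metric.ball (ctr j) (r / 8) ⊆
      Ioo (0 : ℝ) 1 • ((↑) '' Metric.ball θ r : Set E) := by
    intro y hy
    simp only [mem_iUnion, Finset.mem_range] at hy
    obtain ⟨j, hj, hy⟩ := hy
    rw [Metric.mem_ball, dist_eq_norm] at hy
    set s : ℝ := 1 / 2 + j * r / 4 with hs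
    have hjr : j * r ≤ 1 := by
      have h1 : (j : ℝ) ≤ 1 / r := (Nat.cast_le.2 (Nat.lt_succ_iff.1 hj)).trans
        (Nat.floor_le (by positivity))
      rwa [le_div_iff₀ hr] at h1
    have hjr0 : 0 ≤ j * r := by positivity
    have hns : ‖ctr j‖ = s := by
      rw [hctr, norm_smul, hθ, mul_one, Real.norm_of_nonneg (by positivity)]
    have h1 : |‖y‖ - s| < r / 8 := by
      rw [← hns]; exact (abs_norm_sub_norm_le _ _).trans_lt hy
    have h2 := abs_lt.1 h1
    have hy0 : 3 / 8 < ‖y‖ := by linarith [h2.1]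
    have hy1 : ‖y‖ < 1 := by linarith [h2.2]
    have hyp : 0 < ‖y‖ := by linarith
    have hu : ‖y‖⁻¹ • y ∈ Metric.sphere (0 : E) 1 := by
      rw [mem_sphere_zero_iff_norm, norm_smul, norm_inv, norm_norm, inv_mul_cancel₀ hyp.ne']
    refine ⟨‖y‖, ⟨hyp, hy1⟩, _, ⟨⟨‖y‖⁻¹ • y, hu⟩, ?_, rfl⟩, smul_inv_smul₀ hyp.ne' y⟩
    rw [Metric.mem_ball, Subtype.dist_eq, dist_eq_norm]
    have h3 : ‖y‖⁻¹ • y - (θ : E) = ‖y‖⁻¹ • ((y - ctr j) + (s - ‖y‖) • (θ : E)) := by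
      have h4 : (θ : E) = ‖y‖⁻¹ • ‖y‖ • (θ : E) := (inv_smul_smul₀ hyp.ne' _).symm
      nth_rewrite 1 [h4]
      rw [← smul_sub, sub_smul, hctr]
      congr 1
      abel
    dsimp only
    rw [h3, norm_smul, norm_inv, norm_norm, inv_mul_lt_iff₀ hyp]
    refine (norm_add_le _ _).trans_lt ?_
    rw [norm_smul, hθ, mul_one, Real.norm_eq_abs, abs_sub_comm]
    nlinarith
  have hdisj : (Finset.range (k + 1) : Set ℕ).PairwiseDisjoint
      fun j => Metric.ball (ctr j) (r / 8) := by
    intro i _ j _ hij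
    refine Metric.ball_disjoint_ball ?_
    rw [dist_eq_norm, hctr]
    dsimp only
    rw [← sub_smul, norm_smul, hθ, mul_one, Real.norm_eq_abs]
    have h1 : (1 : ℝ) ≤ |(i : ℝ) - j| := by
      have h2 : (1 : ℤ) ≤ |(i : ℤ) - j| :=
        Int.one_le_abs (sub_ne_zero.2 (by exact_mod_cast hij))
      exact_mod_cast h2
    have h3 : 1 / 2 + (i : ℝ) * r / 4 - (1 / 2 + j * r / 4) = ((i : ℝ) - j) * (r / 4) := by ring
    rw [h3, abs_mul, abs_of_pos (by positivity : 0 < r / 4)]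
    nlinarith
  rw [Measure.toSphere_apply' _ Metric.isOpen_ball.measurableSet, ← hn]
  have hkr : ENNReal.ofReal (1 / r) ≤ ((k + 1 : ℕ) : ℝ≥0∞) := by
    rw [← ENNReal.ofReal_natCast]
    refine ENNReal.ofReal_le_ofReal ?_
    push_cast
    exact (Nat.lt_floor_add_one _).le
  calc ((n * ((1 / 8) ^ n * b.toNNReal) : ℝ≥0) : ℝ≥0∞) * ENNReal.ofReal r ^ ((n : ℝ) - 1)
      = n * (ENNReal.ofReal (1 / r) * (ENNReal.ofReal ((r / 8) ^ n) * b)) := by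
        have h1 : ENNReal.ofReal ((r / 8) ^ n) = ((1 / 8 : ℝ≥0) : ℝ≥0∞) ^ n *
            ENNReal.ofReal (r ^ n) := by
          rw [div_eq_inv_mul, mul_pow, ENNReal.ofReal_mul (by positivity),
            ENNReal.ofReal_pow (by positivity)]
          congr 2
          rw [ENNReal.ofReal]
          congr 1
          ext
          simp
        rw [← ENNReal.ofReal_pow_finrank_mul hr, h1]
        push_cast
        rw [ENNReal.coe_toNNReal hbT]
        ring
    _ ≤ n * (((k + 1 : ℕ) : ℝ≥0∞) * (ENNReal.ofReal ((r / 8) ^ n) * b)) := by gcongr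
    _ = n * μ (⋃ j ∈ Finset.range (k + 1), Metric.ball (ctr j) (r / 8)) := by
        rw [measure_biUnion_finset hdisj fun _ _ => Metric.isOpen_ball.measurableSet]
        simp_rw [Measure.addHaar_ball_of_pos μ _ (by positivity : 0 < r / 8), ← hn, ← hb]
        rw [Finset.sum_const, Finset.card_range, nsmul_eq_mul]
    _ ≤ _ := by
        gcongr

end sphere

/-! ### The Riesz potential representation -/

/-- The Gaussian in the subordination formula for `r ^ (-l)`. -/
noncomputable def heatKer (l t r : ℝ) : ℝ :=
  t ^ (-(l / 2) - 1) * Real.exp (-(Real.pi ^ 2 * r ^ 2) / t)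

theorem heatKer_nonneg {l t : ℝ} (ht : 0 < t) (r : ℝ) : 0 ≤ heatKer l t r := by
  unfold heatKer; positivity

theorem heatKer_anti {l t : ℝ} (ht : 0 < t) {r r' : ℝ} (h0 : 0 ≤ r) (h : r ≤ r') :
    heatKer l t r' ≤ heatKer l t r := by
  unfold heatKer
  gcongr

theorem measurable_heatKer (l : ℝ) : Measurable fun p : ℝ × ℝ => heatKer l p.1 p.2 := by
  unfold heatKer
  fun_prop

/-- Subordination: the Gaussians superpose to a multiple of the Riesz kernel `r^{-l}`. -/
theorem lintegral_heatKer {l r : ℝ} (hl : 0 < l) (hr : 0 < r) :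
    ∫⁻ t in Ioi (0 : ℝ), ENNReal.ofReal (heatKer l t r) =
      ENNReal.ofReal ((Real.pi ^ 2) ^ (-(l / 2)) * Real.Gamma (l / 2)) *
        ENNReal.ofReal r ^ (-l) := by
  set b := Real.pi ^ 2 * r ^ 2 with hb
  have hb0 : 0 < b := by positivity
  set G : ℝ → ℝ := fun s => s ^ (l / 2 - 1) * Real.exp (-(b * s)) with hG
  have hGi : IntegrableOn G (Ioi 0) := by
    have := integrableOn_rpow_mul_exp_neg_mul_rpow (p := 1) (s := l / 2 - 1) (b := b) (by linarith)
      one_pos hb0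
    simpa [hG, neg_mul] using this
  -- the substitution `t = 1 / s` turns the integral into a Gamma integral
  have hEq : ∀ t ∈ Ioi (0 : ℝ), (|(-1 : ℝ)| * t ^ ((-1 : ℝ) - 1)) • G (t ^ (-1 : ℝ)) =
      heatKer l t r := by
    intro t ht
    have ht0 : 0 < t := ht
    simp only [hG, heatKer, smul_eq_mul, abs_neg, abs_one, one_mul]
    rw [← Real.rpow_mul ht0.le, ← mul_assoc, ← Real.rpow_add ht0, Real.rpow_neg_one, ← hb]
    congr 2
    · ring
    · rw [neg_div, div_eq_mul_inv]
  have hint : IntegrableOn (fun t => heatKer l t r) (Ioi 0) :=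
    ((integrableOn_Ioi_comp_rpow_iff G (by norm_num : (-1 : ℝ) ≠ 0)).2 hGi).congr_fun hEq
      measurableSet_Ioi
  have hval : ∫ t in Ioi (0 : ℝ), heatKer l t r = (1 / b) ^ (l / 2) * Real.Gamma (l / 2) := by
    rw [← setIntegral_congr_fun measurableSet_Ioi hEq,
      integral_comp_rpow_Ioi G (by norm_num : (-1 : ℝ) ≠ 0)]
    exact Real.integral_rpow_mul_exp_neg_mul_Ioi (by linarith) hb0
  rw [← ofReal_integral_eq_lintegral_ofReal hint
    ((ae_restrict_mem measurableSet_Ioi).mono fun t ht => heatKer_nonneg ht r), hval,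
    ENNReal.ofReal_rpow_of_pos hr, ← ENNReal.ofReal_mul (by
      have := Real.Gamma_pos_of_pos (by linarith : 0 < l / 2); positivity)]
  congr 1
  rw [hb, one_div, Real.inv_rpow (by positivity), ← Real.rpow_neg (by positivity),
    Real.mul_rpow (by positivity) (by positivity), ← Real.rpow_natCast r 2, ← Real.rpow_mul hr.le]
  have : ((2 : ℕ) : ℝ) * -(l / 2) = -l := by push_cast; ring
  rw [this]
  ring

/-- The Gaussians in the subordination formula are monotone in the distance, so that the formula
passes to absolute values of differences. -/
theorem lintegral_enorm_heatKer_sub_le {l a b : ℝ} (hl : 0 < l) (ha : 0 ≤ a) (hb : 0 ≤ b) :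
    ∫⁻ t in Ioi (0 : ℝ), ‖heatKer l t a - heatKer l t b‖ₑ ≤
      ENNReal.ofReal ((Real.pi ^ 2) ^ (-(l / 2)) * Real.Gamma (l / 2)) *
        ((ENNReal.ofReal a ^ (-l) - ENNReal.ofReal b ^ (-l)) +
          (ENNReal.ofReal b ^ (-l) - ENNReal.ofReal a ^ (-l))) := by
  set K := ENNReal.ofReal ((Real.pi ^ 2) ^ (-(l / 2)) * Real.Gamma (l / 2)) with hK
  have hK0 : K ≠ 0 := by
    have := Real.Gamma_pos_of_pos (by linarith : 0 < l / 2)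
    have : 0 < (Real.pi ^ 2) ^ (-(l / 2)) * Real.Gamma (l / 2) := by positivity
    simpa [hK] using this
  have key : ∀ {a b : ℝ}, 0 ≤ a → a ≤ b →
      ∫⁻ t in Ioi (0 : ℝ), ‖heatKer l t a - heatKer l t b‖ₑ ≤
        K * (ENNReal.ofReal a ^ (-l) - ENNReal.ofReal b ^ (-l)) := by
    intro a b ha hab
    rcases hab.eq_or_lt with rfl | hab'
    · simp
    have hb : 0 < b := ha.trans_lt hab'
    have hbT : ENNReal.ofReal b ^ (-l) ≠ ∞ := by
      rw [ENNReal.ofReal_rpow_of_pos hb]; exact ENNReal.ofReal_ne_top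
    rcases ha.eq_or_lt with rfl | ha
    · rw [ENNReal.ofReal_zero, ENNReal.zero_rpow_of_neg (by linarith), ENNReal.top_sub hbT,
        ENNReal.mul_top hK0]
      exact le_top
    have hm : Measurable fun t => heatKer l t b :=
      (measurable_heatKer l).comp measurable_prodMk_right
    calc ∫⁻ t in Ioi (0 : ℝ), ‖heatKer l t a - heatKer l t b‖ₑ
        = ∫⁻ t in Ioi (0 : ℝ),
            (ENNReal.ofReal (heatKer l t a) - ENNReal.ofReal (heatKer l t b)) := by
          refine setLIntegral_congr_fun measurableSet_Ioi fun t ht => ?_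
          rw [← ENNReal.ofReal_sub _ (heatKer_nonneg ht b), Real.enorm_of_nonneg
            (sub_nonneg.2 (heatKer_anti ht ha.le hab))]
      _ = K * ENNReal.ofReal a ^ (-l) - K * ENNReal.ofReal b ^ (-l) := by
          rw [lintegral_sub hm.ennreal_ofReal, lintegral_heatKer hl ha, lintegral_heatKer hl hb]
          · rw [lintegral_heatKer hl hb]
            exact ENNReal.mul_ne_top ENNReal.ofReal_ne_top hbT
          · exact (ae_restrict_mem measurableSet_Ioi).mono fun t ht =>
              ENNReal.ofReal_le_ofReal (heatKer_anti ht ha.le hab)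
      _ ≤ _ := (ENNReal.mul_sub fun _ _ => ENNReal.ofReal_ne_top).ge
  -- one of the two truncated differences vanishes, the other one is the absolute value
  rcases le_total a b with h | h
  · exact (key ha h).trans (by gcongr; exact le_self_add)
  · refine le_trans (le_of_eq ?_) ((key hb h).trans (by gcongr; exact le_add_self))
    refine lintegral_congr fun t => ?_
    rw [← enorm_neg, neg_sub]

section riesz

variable {n : ℕ} {σ : ℝ}

theorem integrable_rpow_norm_mul_fourier (hσ : 0 < σ) (u : 𝓢(EuclideanSpace ℝ (Fin n), ℂ)) :
    Integrable fun ξ : EuclideanSpace ℝ (Fin n) =>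
      (((2 * Real.pi * ‖ξ‖) ^ σ : ℝ) : ℂ) * 𝓕 (u : EuclideanSpace ℝ (Fin n) → ℂ) ξ := by
  obtain ⟨k, hk⟩ := exists_nat_ge σ
  set v : 𝓢(EuclideanSpace ℝ (Fin n), ℂ) := 𝓕 u with hv
  have hvu : 𝓕 (u : EuclideanSpace ℝ (Fin n) → ℂ) = v := SchwartzMap.fourier_coe u
  rw [hvu]
  have hcont : Continuous fun ξ : EuclideanSpace ℝ (Fin n) =>
      (((2 * Real.pi * ‖ξ‖) ^ σ : ℝ) : ℂ) * v ξ :=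
    (Complex.continuous_ofReal.comp
      ((continuous_const.mul continuous_norm).rpow_const fun _ => Or.inr hσ.le)).mul v.continuous
  refine Integrable.mono' (((v.integrable (μ := volume)).norm.add
    (v.integrable_pow_mul volume k)).const_mul ((2 * Real.pi) ^ σ)) hcont.aestronglyMeasurable
    (.of_forall fun ξ => ?_)
  have hpi : 0 ≤ 2 * Real.pi := by positivity
  rw [norm_mul, Complex.norm_real, Real.norm_of_nonneg (by positivity),
    Real.mul_rpow hpi (norm_nonneg _), mul_assoc]
  simp only [Pi.add_apply]
  have h1 : ‖ξ‖ ^ σ ≤ 1 + ‖ξ‖ ^ k := by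
    rcases le_total ‖ξ‖ 1 with h | h
    · have := Real.rpow_le_one (norm_nonneg ξ) h hσ.le
      have := pow_nonneg (norm_nonneg ξ) k
      linarith
    · have := Real.rpow_le_rpow_of_exponent_le h hk
      rw [Real.rpow_natCast] at this
      linarith
  have h2 : ‖ξ‖ ^ σ * ‖v ξ‖ ≤ ‖v ξ‖ + ‖ξ‖ ^ k * ‖v ξ‖ := by
    calc _ ≤ (1 + ‖ξ‖ ^ k) * ‖v ξ‖ := by gcongr
      _ = _ := by ring
  exact mul_le_mul_of_nonneg_left h2 (by positivity)

theorem continuous_fracDeriv (hσ : 0 < σ) (u : 𝓢(EuclideanSpace ℝ (Fin n), ℂ)) :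
    Continuous (fracDeriv σ (u : EuclideanSpace ℝ (Fin n) → ℂ)) := by
  have B : Continuous fun p : EuclideanSpace ℝ (Fin n) × EuclideanSpace ℝ (Fin n) =>
      (-innerₗ (EuclideanSpace ℝ (Fin n))) p.1 p.2 := continuous_inner.neg
  exact VectorFourier.fourierIntegral_continuous Real.continuous_fourierChar B
    (integrable_rpow_norm_mul_fourier hσ u)

/-- Multiplication formula for a modulated Gaussian. -/
theorem integral_gaussian_mul_eq {F : EuclideanSpace ℝ (Fin n) → ℂ} (hF : Integrable F)
    {t : ℝ} (ht : 0 < t) (x : EuclideanSpace ℝ (Fin n)) :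
    ∫ ξ, Complex.exp (-(t : ℂ) * ‖ξ‖ ^ 2 + 2 * Real.pi * Complex.I * inner ℝ x ξ) * F ξ =
      ∫ y, ((Real.pi / t : ℂ) ^ (n / 2 : ℂ) * Complex.exp (-Real.pi ^ 2 * ‖x - y‖ ^ 2 / t)) *
        𝓕⁻ F y := by
  have ht' : 0 < (t : ℂ).re := by simpa using ht
  set h : EuclideanSpace ℝ (Fin n) → ℂ := fun ξ =>
    Complex.exp (-(t : ℂ) * ‖ξ‖ ^ 2 + 2 * Real.pi * Complex.I * inner ℝ x ξ) with hh
  have hFh : 𝓕 h = fun y => (Real.pi / t : ℂ) ^ (n / 2 : ℂ) *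
      Complex.exp (-Real.pi ^ 2 * ‖x - y‖ ^ 2 / t) := by
    ext y
    rw [hh, fourier_gaussian_innerProductSpace' ht', finrank_euclideanSpace_fin]
  have hi : Integrable h := GaussianFourier.integrable_cexp_neg_mul_sq_norm_add ht' _ _
  have hc : Continuous h := by
    rw [hh]; fun_prop
  have hFi : Integrable (𝓕 h) := by
    rw [hFh]
    refine Integrable.const_mul ?_ _
    have h1 : 0 < ((Real.pi ^ 2 / t : ℝ) : ℂ).re := by
      rw [Complex.ofReal_re]; positivity
    have h2 := (GaussianFourier.integrable_cexp_neg_mul_sq_norm_add h1 0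
      (0 : EuclideanSpace ℝ (Fin n))).comp_sub_left x
    refine h2.congr (.of_forall fun y => ?_)
    simp only [inner_zero_left, Complex.ofReal_zero, mul_zero, add_zero]
    congr 1
    push_cast
    ring
  have hinv : 𝓕⁻ (𝓕 h) = h := hc.fourierInv_fourier_eq hi hFi
  have B : Continuous fun p : EuclideanSpace ℝ (Fin n) × EuclideanSpace ℝ (Fin n) =>
      (-innerₗ (EuclideanSpace ℝ (Fin n))) p.1 p.2 := continuous_inner.neg
  -- move the Fourier transform from the Gaussian to `F`
  have := VectorFourier.integral_fourierIntegral_smul_eq_flip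
    (L := -innerₗ (EuclideanSpace ℝ (Fin n)))
    Real.continuous_fourierChar B hFi hF (μ := volume) (ν := volume)
  have hflip : (-innerₗ (EuclideanSpace ℝ (Fin n))).flip = -innerₗ (EuclideanSpace ℝ (Fin n)) := by
    ext a b
    simp [real_inner_comm]
  rw [hflip] at this
  change ∫ ξ, 𝓕⁻ (𝓕 h) ξ • F ξ = ∫ y, 𝓕 h y • 𝓕⁻ F y at this
  rw [hinv, hFh] at this
  simpa only [smul_eq_mul] using this

/-- `u` is a constant multiple of the superposition of heat evolutions of `|D|^σ u`. -/
theorem fracDeriv_subordination (hσ : 0 < σ) (hσn : σ < n)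
    (u : 𝓢(EuclideanSpace ℝ (Fin n), ℂ)) (x : EuclideanSpace ℝ (Fin n)) :
    IntegrableOn (fun t : ℝ => ∫ y, (heatKer (n - σ) t ‖x - y‖ : ℂ) * fracDeriv σ u y) (Ioi 0) ∧
    ((Real.pi ^ (-(n / 2 : ℝ)) * (Real.Gamma (σ / 2) * (2 * Real.pi) ^ σ) : ℝ) : ℂ) * u x =
      ∫ t in Ioi (0 : ℝ), ∫ y, (heatKer (n - σ) t ‖x - y‖ : ℂ) * fracDeriv σ u y := by
  set F : EuclideanSpace ℝ (Fin n) → ℂ := fun ξ =>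
    (((2 * Real.pi * ‖ξ‖) ^ σ : ℝ) : ℂ) * 𝓕 (u : EuclideanSpace ℝ (Fin n) → ℂ) ξ with hF
  have hFi : Integrable F := integrable_rpow_norm_mul_fourier hσ u
  have hui : Integrable (𝓕 (u : EuclideanSpace ℝ (Fin n) → ℂ)) := by
    rw [← SchwartzMap.fourier_coe u]; exact SchwartzMap.integrable _
  have hσ2 : 0 < σ / 2 := by linarith
  have hG := Real.Gamma_pos_of_pos hσ2
  set m : EuclideanSpace ℝ (Fin n) → ℂ := fun ξ =>
    Complex.exp (2 * Real.pi * Complex.I * inner ℝ x ξ) with hm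
  have hmn : ∀ ξ, ‖m ξ‖ = 1 := fun ξ => by
    have : 2 * Real.pi * Complex.I * inner ℝ x ξ = ((2 * Real.pi * inner ℝ x ξ : ℝ) : ℂ) *
        Complex.I := by
      push_cast; ring
    rw [hm]
    dsimp only
    rw [this, Complex.norm_exp_ofReal_mul_I]
  -- the Gamma integral of `exp (-‖ξ‖² t)` produces `‖ξ‖^{-σ}`, which cancels the multiplier of
  -- `|D|^σ`
  set Φ : EuclideanSpace ℝ (Fin n) → ℝ → ℂ := fun ξ t =>
    ((t ^ (σ / 2 - 1) * Real.exp (-(‖ξ‖ ^ 2 * t)) : ℝ) : ℂ) * (m ξ * F ξ) with hΦ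
  have hint1 : ∀ ξ : EuclideanSpace ℝ (Fin n), ξ ≠ 0 →
      ∫ t in Ioi (0 : ℝ), t ^ (σ / 2 - 1) * Real.exp (-(‖ξ‖ ^ 2 * t)) =
        Real.Gamma (σ / 2) * ‖ξ‖ ^ (-σ) := by
    intro ξ hξ
    have hξ0 : 0 < ‖ξ‖ := norm_pos_iff.2 hξ
    rw [Real.integral_rpow_mul_exp_neg_mul_Ioi hσ2 (by positivity), one_div,
      Real.inv_rpow (by positivity), ← Real.rpow_natCast, ← Real.rpow_mul hξ0.le, mul_comm,
      Real.rpow_neg hξ0.le]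
    congr 3
    push_cast; ring
  have hint2 : ∀ ξ : EuclideanSpace ℝ (Fin n), ξ ≠ 0 →
      IntegrableOn (fun t : ℝ => t ^ (σ / 2 - 1) * Real.exp (-(‖ξ‖ ^ 2 * t))) (Ioi 0) := by
    intro ξ hξ
    have hξ0 : 0 < ‖ξ‖ := norm_pos_iff.2 hξ
    have := integrableOn_rpow_mul_exp_neg_mul_rpow (p := 1) (s := σ / 2 - 1) (b := ‖ξ‖ ^ 2)
      (by linarith) one_pos (by positivity)
    simpa [neg_mul] using this
  have hF0 : F 0 = 0 := by simp [hF, Real.zero_rpow hσ.ne']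
  have hΦnorm : ∀ ξ, ∫ t in Ioi (0 : ℝ), ‖Φ ξ t‖ =
      Real.Gamma (σ / 2) * (2 * Real.pi) ^ σ *
        ‖if ξ = 0 then 0 else 𝓕 (u : EuclideanSpace ℝ (Fin n) → ℂ) ξ‖ := by
    intro ξ
    by_cases hξ : ξ = 0
    · simp [hΦ, hξ, hF0]
    have hξ0 : 0 < ‖ξ‖ := norm_pos_iff.2 hξ
    have e : ∀ t ∈ Ioi (0 : ℝ), ‖Φ ξ t‖ =
        (t ^ (σ / 2 - 1) * Real.exp (-(‖ξ‖ ^ 2 * t))) * ‖F ξ‖ := fun t ht => by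
      have ht0 : 0 < t := ht
      simp only [hΦ, norm_mul, hmn, one_mul, Complex.norm_real]
      rw [Real.norm_of_nonneg (by positivity), Real.norm_of_nonneg (by positivity)]
    rw [setIntegral_congr_fun measurableSet_Ioi e, integral_mul_const, hint1 ξ hξ, if_neg hξ]
    simp only [hF, norm_mul, Complex.norm_real]
    rw [Real.norm_of_nonneg (by positivity), Real.mul_rpow (by positivity) hξ0.le,
      Real.rpow_neg hξ0.le]
    have := (Real.rpow_pos_of_pos hξ0 σ).ne'
    field_simp
  have hFm : Measurable F := by
    have : Continuous (𝓕 (u : EuclideanSpace ℝ (Fin n) → ℂ)) := by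
      rw [← SchwartzMap.fourier_coe u]; exact SchwartzMap.continuous _
    have := this.measurable
    rw [hF]
    fun_prop
  have hΦm : Measurable (Function.uncurry Φ) := by
    have h1 : Measurable m := by rw [hm]; fun_prop
    have h2 : Measurable fun p : EuclideanSpace ℝ (Fin n) × ℝ =>
        p.2 ^ (σ / 2 - 1) * Real.exp (-(‖p.1‖ ^ 2 * p.2)) := by
      fun_prop
    have h3 : Measurable fun p : EuclideanSpace ℝ (Fin n) × ℝ => m p.1 * F p.1 :=
      (h1.comp measurable_fst).mul (hFm.comp measurable_fst)
    exact (Complex.measurable_ofReal.comp h2).mul h3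
  have hΦi : Integrable (Function.uncurry Φ) (volume.prod (volume.restrict (Ioi (0 : ℝ)))) := by
    refine (integrable_prod_iff hΦm.aestronglyMeasurable).2 ⟨.of_forall fun ξ => ?_, ?_⟩
    · by_cases hξ : ξ = 0
      · simp [hΦ, hξ, hF0, Function.uncurry]
      · exact Integrable.mul_const (Integrable.ofReal (𝕜 := ℂ) (hint2 ξ hξ)) (m ξ * F ξ)
    · simp only [Function.uncurry_apply_pair, hΦnorm]
      refine Integrable.const_mul ?_ _
      refine hui.norm.mono' ?_ (.of_forall fun ξ => ?_)
      · have : Measurable (𝓕 (u : EuclideanSpace ℝ (Fin n) → ℂ)) := by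
          rw [← SchwartzMap.fourier_coe u]; exact (SchwartzMap.continuous _).measurable
        exact (Measurable.ite (measurableSet_singleton 0) measurable_const
          this).norm.aestronglyMeasurable
      · rw [norm_norm]
        split_ifs <;> simp
  -- for fixed `t` the integral over frequencies is a convolution with a Gaussian
  have hinner : ∀ t ∈ Ioi (0 : ℝ), ∫ ξ, Φ ξ t =
      ((Real.pi ^ (n / 2 : ℝ) : ℝ) : ℂ) *
        ∫ y, (heatKer (n - σ) t ‖x - y‖ : ℂ) * fracDeriv σ u y := by
    intro t ht
    have ht0 : 0 < t := ht
    have e1 : ∀ ξ, Φ ξ t = ((t ^ (σ / 2 - 1) : ℝ) : ℂ) *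
        (Complex.exp (-(t : ℂ) * ‖ξ‖ ^ 2 + 2 * Real.pi * Complex.I * inner ℝ x ξ) * F ξ) := by
      intro ξ
      simp only [hΦ, hm]
      rw [Complex.exp_add]
      push_cast
      have : -((‖ξ‖ : ℂ) ^ 2 * t) = -(t : ℂ) * ‖ξ‖ ^ 2 := by ring
      rw [this]
      ring
    simp_rw [e1]
    rw [integral_const_mul, integral_gaussian_mul_eq hFi ht0, ← integral_const_mul,
      ← integral_const_mul]
    refine integral_congr_ae (.of_forall fun y => ?_)
    dsimp only
    have e2 : (Real.pi / t : ℂ) ^ (n / 2 : ℂ) =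
        ((Real.pi ^ (n / 2 : ℝ) * t ^ (-(n / 2 : ℝ)) : ℝ) : ℂ) := by
      have h3 : (Real.pi / t : ℂ) = ((Real.pi / t : ℝ) : ℂ) := by push_cast; rfl
      have h4 : (n / 2 : ℂ) = ((n / 2 : ℝ) : ℂ) := by push_cast; rfl
      rw [h3, h4, ← Complex.ofReal_cpow (by positivity), Real.div_rpow Real.pi_pos.le ht0.le,
        Real.rpow_neg ht0.le, div_eq_mul_inv]
    have e3 : Complex.exp (-Real.pi ^ 2 * ‖x - y‖ ^ 2 / t) =
        ((Real.exp (-(Real.pi ^ 2 * ‖x - y‖ ^ 2) / t) : ℝ) : ℂ) := by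
      push_cast
      congr 1
      ring
    have e4 : t ^ (-(((n : ℝ) - σ) / 2) - 1) = t ^ (σ / 2 - 1) * t ^ (-(n / 2 : ℝ)) := by
      rw [← Real.rpow_add ht0]
      congr 1; ring
    rw [e2, e3, heatKer, e4]
    have e5 : fracDeriv σ u y = 𝓕⁻ F y := rfl
    rw [e5]
    push_cast
    ring
  have hpi : Real.pi ^ (-(n / 2 : ℝ)) * Real.pi ^ (n / 2 : ℝ) = 1 := by
    rw [← Real.rpow_add Real.pi_pos, neg_add_cancel, Real.rpow_zero]
  have hpi' : ((Real.pi ^ (-(n / 2 : ℝ)) : ℝ) : ℂ) * ((Real.pi ^ (n / 2 : ℝ) : ℝ) : ℂ) = 1 := by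
    exact_mod_cast hpi
  have hinner' : ∀ t ∈ Ioi (0 : ℝ), ((Real.pi ^ (-(n / 2 : ℝ)) : ℝ) : ℂ) * ∫ ξ, Φ ξ t =
      ∫ y, (heatKer (n - σ) t ‖x - y‖ : ℂ) * fracDeriv σ u y := fun t ht => by
    rw [hinner t ht, ← mul_assoc, hpi', one_mul]
  -- exchange the two integrals
  refine ⟨IntegrableOn.congr_fun ((hΦi.integral_prod_right).const_mul _) hinner' measurableSet_Ioi,
      ?_⟩
  rw [← setIntegral_congr_fun measurableSet_Ioi hinner', integral_const_mul,
    ← integral_integral_swap hΦi]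
  have hux : u x = ∫ ξ, m ξ * 𝓕 (u : EuclideanSpace ℝ (Fin n) → ℂ) ξ := by
    have h1 : 𝓕⁻ (𝓕 (u : EuclideanSpace ℝ (Fin n) → ℂ)) = u :=
        u.continuous.fourierInv_fourier_eq u.integrable hui
    rw [← congrFun h1 x, Real.fourierInv_eq']
    refine integral_congr_ae (.of_forall fun ξ => ?_)
    simp only [hm, smul_eq_mul]
    congr 2
    rw [real_inner_comm]
    push_cast; ring
  have hae : ∀ᵐ ξ : EuclideanSpace ℝ (Fin n), ∫ t in Ioi (0 : ℝ), Φ ξ t =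
      ((Real.Gamma (σ / 2) * (2 * Real.pi) ^ σ : ℝ) : ℂ) *
        (m ξ * 𝓕 (u : EuclideanSpace ℝ (Fin n) → ℂ) ξ) := by
    have : Nonempty (Fin n) := by
      refine ⟨⟨0, ?_⟩⟩
      have : (0 : ℝ) < n := hσ.trans hσn
      exact_mod_cast this
    filter_upwards [(countable_singleton (0 : EuclideanSpace ℝ (Fin n))).ae_notMem volume] with ξ hξ
    have hξ0 : 0 < ‖ξ‖ := norm_pos_iff.2 hξ
    simp only [hΦ]
    rw [integral_mul_const, integral_complex_ofReal, hint1 ξ hξ]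
    simp only [hF]
    rw [Real.mul_rpow (by positivity) hξ0.le]
    have h2 : ‖ξ‖ ^ (-σ) * ‖ξ‖ ^ σ = 1 := by
      rw [← Real.rpow_add hξ0, neg_add_cancel, Real.rpow_zero]
    have h3 : ((‖ξ‖ ^ (-σ) : ℝ) : ℂ) * ((‖ξ‖ ^ σ : ℝ) : ℂ) = 1 := by exact_mod_cast h2
    push_cast
    linear_combination ((Real.Gamma (σ / 2) : ℝ) : ℂ) * (((2 * Real.pi) ^ σ : ℝ) : ℂ) * m ξ *
      𝓕 (u : EuclideanSpace ℝ (Fin n) → ℂ) ξ * h3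
  rw [integral_congr_ae hae, integral_const_mul, ← hux]
  push_cast
  ring

theorem integrable_heatKer_mul {l : ℝ} (hσ : 0 < σ) (u : 𝓢(EuclideanSpace ℝ (Fin n), ℂ)) {t : ℝ}
    (ht : 0 < t) (x : EuclideanSpace ℝ (Fin n)) :
    Integrable fun y => (heatKer l t ‖x - y‖ : ℂ) * fracDeriv σ u y := by
  have hbdd : ∀ y, ‖fracDeriv σ u y‖ ≤ ∫ ξ : EuclideanSpace ℝ (Fin n),
      ‖(((2 * Real.pi * ‖ξ‖) ^ σ : ℝ) : ℂ) * 𝓕 (u : EuclideanSpace ℝ (Fin n) → ℂ) ξ‖ := fun y =>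
    VectorFourier.norm_fourierIntegral_le_integral_norm _ _ _ _ _
  have hk : Integrable fun y : EuclideanSpace ℝ (Fin n) => (heatKer l t ‖x - y‖ : ℂ) := by
    have h1 : 0 < ((Real.pi ^ 2 / t : ℝ) : ℂ).re := by
      rw [Complex.ofReal_re]; positivity
    have h2 := (GaussianFourier.integrable_cexp_neg_mul_sq_norm_add h1 0
      (0 : EuclideanSpace ℝ (Fin n))).comp_sub_left x
    refine (h2.const_mul ((t ^ (-(l / 2) - 1) : ℝ) : ℂ)).congr (.of_forall fun y => ?_)
    simp only [inner_zero_left, Complex.ofReal_zero, mul_zero, add_zero, heatKer]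
    push_cast
    congr 2
    ring
  exact hk.mul_bdd (continuous_fracDeriv hσ u).aestronglyMeasurable (.of_forall hbdd)

/-- Tonelli's theorem for a family of kernels. -/
theorem enorm_setIntegral_integral_mul_le {κ : ℝ → EuclideanSpace ℝ (Fin n) → ℝ}
    (hκ : Measurable (Function.uncurry κ)) {f : EuclideanSpace ℝ (Fin n) → ℂ} (hf : Measurable f) :
    ‖∫ t in Ioi (0 : ℝ), ∫ y, (κ t y : ℂ) * f y‖ₑ ≤
      ∫⁻ y, (∫⁻ t in Ioi (0 : ℝ), ‖κ t y‖ₑ) * ‖f y‖ₑ := by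
  have hm : Measurable fun p : ℝ × EuclideanSpace ℝ (Fin n) => ‖κ p.1 p.2‖ₑ * ‖f p.2‖ₑ :=
    hκ.enorm.mul (hf.enorm.comp measurable_snd)
  calc _ ≤ ∫⁻ t in Ioi (0 : ℝ), ∫⁻ y, ‖κ t y‖ₑ * ‖f y‖ₑ := by
        refine (enorm_integral_le_lintegral_enorm _).trans (lintegral_mono fun t => ?_)
        refine (enorm_integral_le_lintegral_enorm _).trans (lintegral_mono fun y => ?_)
        rw [enorm_mul]
        have : ‖(κ t y : ℂ)‖ₑ = ‖κ t y‖ₑ := by simp [enorm_eq_nnnorm]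
        rw [this]
    _ = ∫⁻ y, ∫⁻ t in Ioi (0 : ℝ), ‖κ t y‖ₑ * ‖f y‖ₑ := lintegral_lintegral_swap hm.aemeasurable
    _ = _ := by
        refine lintegral_congr fun y => ?_
        exact lintegral_mul_const _ (hκ.comp measurable_prodMk_right).enorm

/-- A Schwartz function and its increments are bounded by Riesz potentials of `|D|^σ u`. For the
increments the kernel is the absolute value of the difference of two Riesz kernels, written as the
sum of the two truncated differences. -/
theorem exists_enorm_le_lintegral_fracDeriv (n : ℕ) {σ : ℝ} (hσ : 0 < σ) (hσn : σ < n) :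
    ∃ C : ℝ≥0, ∀ u : 𝓢(EuclideanSpace ℝ (Fin n), ℂ),
      (∀ x, ‖u x‖ₑ ≤ C * ∫⁻ y, edist x y ^ (-(n - σ)) * ‖fracDeriv σ u y‖ₑ) ∧
      ∀ x z, ‖u x - u z‖ₑ ≤ C * ∫⁻ y, ((edist x y ^ (-(n - σ)) - edist z y ^ (-(n - σ))) +
        (edist z y ^ (-(n - σ)) - edist x y ^ (-(n - σ)))) * ‖fracDeriv σ u y‖ₑ := by
  set l : ℝ := n - σ with hl
  have hl0 : 0 < l := by linarith
  set κ : ℝ := Real.pi ^ (-(n / 2 : ℝ)) * (Real.Gamma (σ / 2) * (2 * Real.pi) ^ σ) with hκ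
  have hκ0 : 0 < κ := by
    have := Real.Gamma_pos_of_pos (by linarith : 0 < σ / 2)
    positivity
  set K : ℝ≥0 := ((Real.pi ^ 2) ^ (-(l / 2)) * Real.Gamma (l / 2)).toNNReal with hK
  have hmul : ∀ {w v : ℂ} {I : ℝ≥0∞}, (κ : ℂ) * w = v → ‖v‖ₑ ≤ K * I →
      ‖w‖ₑ ≤ (κ.toNNReal⁻¹ * K : ℝ≥0) * I := by
    intro w v I hw hv
    have h1 : w = ((κ⁻¹ : ℝ) : ℂ) * v := by
      rw [← hw, ← mul_assoc]
      have : ((κ⁻¹ : ℝ) : ℂ) * (κ : ℂ) = 1 := by exact_mod_cast inv_mul_cancel₀ hκ0.ne'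
      rw [this, one_mul]
    have h2 : ‖((κ⁻¹ : ℝ) : ℂ)‖ₑ = ((κ.toNNReal⁻¹ : ℝ≥0) : ℝ≥0∞) := by
      rw [← Real.toNNReal_inv]
      have : ‖((κ⁻¹ : ℝ) : ℂ)‖ₑ = ‖κ⁻¹‖ₑ := by simp [enorm_eq_nnnorm]
      rw [this, Real.enorm_of_nonneg (by positivity)]
      rfl
    rw [h1, enorm_mul, h2, ENNReal.coe_mul, mul_assoc]
    gcongr
  have hker : ∀ x : EuclideanSpace ℝ (Fin n),
      Measurable (Function.uncurry fun t y => heatKer l t ‖x - y‖) := fun x =>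
    (measurable_heatKer l).comp (measurable_fst.prodMk (by fun_prop))
  refine ⟨κ.toNNReal⁻¹ * K, fun u => ?_⟩
  have hf := (continuous_fracDeriv hσ u).measurable
  have hK' : ∀ g : EuclideanSpace ℝ (Fin n) → ℝ≥0∞, ∫⁻ y, K * g y * ‖fracDeriv σ u y‖ₑ =
      K * ∫⁻ y, g y * ‖fracDeriv σ u y‖ₑ := fun g => by
    simp_rw [mul_assoc]
    exact lintegral_const_mul' _ _ (by simp)
  refine ⟨fun x => hmul (fracDeriv_subordination hσ hσn u x).2 ?_, fun x z => ?_⟩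
  · refine (enorm_setIntegral_integral_mul_le (hker x) hf).trans (le_of_le_of_eq ?_ (hK' _))
    gcongr with y
    -- at the pole the kernel is infinite, so nothing is to be shown
    rcases eq_or_ne x y with rfl | hxy
    · rw [edist_self, ENNReal.zero_rpow_of_neg (by linarith), ENNReal.mul_top]
      · exact le_top
      · have := Real.Gamma_pos_of_pos (by linarith : 0 < l / 2)
        have : 0 < (Real.pi ^ 2) ^ (-(l / 2)) * Real.Gamma (l / 2) := by positivity
        simpa [hK] using this
    · rw [edist_dist, dist_eq_norm]
      refine le_trans (le_of_eq ?_) (lintegral_heatKer hl0 (norm_pos_iff.2 (sub_ne_zero.2 hxy))).le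
      refine setLIntegral_congr_fun measurableSet_Ioi fun t ht => ?_
      exact Real.enorm_of_nonneg (heatKer_nonneg ht _)
  · have hx := fracDeriv_subordination hσ hσn u x
    have hz := fracDeriv_subordination hσ hσn u z
    have hsub : (κ : ℂ) * (u x - u z) = ∫ t in Ioi (0 : ℝ), ∫ y,
        ((heatKer l t ‖x - y‖ - heatKer l t ‖z - y‖ : ℝ) : ℂ) * fracDeriv σ u y := by
      rw [mul_sub, hx.2, hz.2, ← integral_sub hx.1 hz.1]
      refine setIntegral_congr_fun measurableSet_Ioi fun t ht => ?_
      rw [← integral_sub (integrable_heatKer_mul hσ u ht x) (integrable_heatKer_mul hσ u ht z)]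
      refine integral_congr_ae (.of_forall fun y => ?_)
      push_cast
      ring
    refine hmul hsub ((enorm_setIntegral_integral_mul_le ((hker x).sub (hker z)) hf).trans
      (le_of_le_of_eq ?_ (hK' _)))
    gcongr with y
    rw [edist_dist, edist_dist, dist_eq_norm, dist_eq_norm]
    exact lintegral_enorm_heatKer_sub_le hl0 (norm_nonneg _) (norm_nonneg _)

end riesz

/-! ### Logarithmic polar coordinates -/

theorem lintegral_volumeIoiPow (k : ℕ) (G : ℝ → ℝ≥0∞) :
    ∫⁻ ρ : Ioi (0 : ℝ), G ρ ∂(Measure.volumeIoiPow k) =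
      ∫⁻ s : ℝ, ENNReal.ofReal (Real.exp ((k + 1) * s)) * G (Real.exp s) := by
  rw [Measure.volumeIoiPow, lintegral_withDensity_eq_lintegral_mul_non_measurable _
    ((measurable_subtype_coe.pow_const k).ennreal_ofReal)
      (.of_forall fun _ => ENNReal.ofReal_lt_top)]
  have h1 := lintegral_subtype_comap (μ := volume) measurableSet_Ioi
    (fun ρ : ℝ => ENNReal.ofReal (ρ ^ k) * G ρ) (s := Ioi (0 : ℝ))
  refine h1.trans ?_
  have h2 := lintegral_image_eq_lintegral_abs_deriv_mul MeasurableSet.univ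
    (fun s _ => (Real.hasDerivAt_exp s).hasDerivWithinAt) Real.exp_injective.injOn
    (fun ρ : ℝ => ENNReal.ofReal (ρ ^ k) * G ρ)
  rw [image_univ, Real.range_exp, setLIntegral_univ] at h2
  rw [h2]
  refine lintegral_congr fun s => ?_
  rw [← mul_assoc, abs_of_pos (Real.exp_pos s), ← ENNReal.ofReal_mul (Real.exp_pos s).le,
    ← Real.exp_nat_mul, ← Real.exp_add]
  congr 3
  ring

section polar

variable {n : ℕ}

/-- Integration in logarithmic polar coordinates `y = e^s ω`. -/
theorem lintegral_eq_lintegral_exp_smul (hn : 0 < n) {h : EuclideanSpace ℝ (Fin n) → ℝ≥0∞}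
    (hh : Measurable h) :
    ∫⁻ y, h y = ∫⁻ s : ℝ, ∫⁻ ω, ENNReal.ofReal (Real.exp (n * s)) * h (Real.exp s • ω.1)
      ∂(volume : Measure (EuclideanSpace ℝ (Fin n))).toSphere := by
  have : Nonempty (Fin n) := ⟨⟨0, hn⟩⟩
  have hmp :=
    (volume : Measure (EuclideanSpace ℝ (Fin n))).measurePreserving_homeomorphUnitSphereProd
  rw [finrank_euclideanSpace_fin] at hmp
  have hms : Measurable fun p : Metric.sphere (0 : EuclideanSpace ℝ (Fin n)) 1 × Ioi (0 : ℝ) =>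
      h ((p.2 : ℝ) • (p.1 : EuclideanSpace ℝ (Fin n))) :=
    hh.comp ((measurable_subtype_coe.comp measurable_snd).smul
      (measurable_subtype_coe.comp measurable_fst))
  have hn1 : ((n - 1 : ℕ) : ℝ) + 1 = n := by
    rw [Nat.cast_pred hn]; ring
  calc ∫⁻ y, h y = ∫⁻ y in ({0}ᶜ : Set (EuclideanSpace ℝ (Fin n))), h y := by
        rw [Measure.restrict_congr_set (t := univ) (by simp), Measure.restrict_univ]
    _ = ∫⁻ y : ({0}ᶜ : Set (EuclideanSpace ℝ (Fin n))), h y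
          ∂((volume : Measure (EuclideanSpace ℝ (Fin n))).comap Subtype.val) :=
        (lintegral_subtype_comap (measurableSet_singleton _).compl h).symm
    _ = ∫⁻ p : Metric.sphere (0 : EuclideanSpace ℝ (Fin n)) 1 × Ioi (0 : ℝ),
          h ((p.2 : ℝ) • (p.1 : EuclideanSpace ℝ (Fin n)))
          ∂((volume : Measure (EuclideanSpace ℝ (Fin n))).toSphere.prod
              (Measure.volumeIoiPow (n - 1))) := by
        rw [← hmp.lintegral_comp hms]
        refine lintegral_congr fun y => ?_
        have hy : (y : EuclideanSpace ℝ (Fin n)) ≠ 0 := y.2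
        congr 1
        simp [norm_ne_zero_iff.2 hy, smul_smul]
    _ = ∫⁻ ρ : Ioi (0 : ℝ), ∫⁻ ω, h ((ρ : ℝ) • (ω : EuclideanSpace ℝ (Fin n)))
          ∂(volume : Measure (EuclideanSpace ℝ (Fin n))).toSphere
          ∂(Measure.volumeIoiPow (n - 1)) := by
        rw [lintegral_prod_symm _ hms.aemeasurable]
    _ = _ := by
        have := lintegral_volumeIoiPow (n - 1) fun ρ =>
          ∫⁻ ω, h (ρ • (ω : EuclideanSpace ℝ (Fin n)))
            ∂(volume : Measure (EuclideanSpace ℝ (Fin n))).toSphere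
        rw [this, hn1]
        refine lintegral_congr fun s => ?_
        have hx : Measurable fun ω : Metric.sphere (0 : EuclideanSpace ℝ (Fin n)) 1 =>
            Real.exp s • (ω : EuclideanSpace ℝ (Fin n)) := by fun_prop
        have hmω : Measurable fun ω : Metric.sphere (0 : EuclideanSpace ℝ (Fin n)) 1 =>
            h (Real.exp s • (ω : EuclideanSpace ℝ (Fin n))) :=
          hh.comp hx
        exact (lintegral_const_mul _ hmω).symm

theorem eLpNorm_ofReal_eq_lpn {X F : Type*} [MeasurableSpace X] [TopologicalSpace F]
    [ContinuousENorm F] {μ : Measure X} {p : ℝ}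
    (hp : 0 < p) (f : X → F) : eLpNorm f (ENNReal.ofReal p) μ = lpn p⁻¹ μ fun x => ‖f x‖ₑ := by
  rw [eLpNorm_eq_lintegral_rpow_enorm_toReal (by simpa using hp) ENNReal.ofReal_ne_top,
    lpn_of_pos (inv_pos.2 hp), ENNReal.toReal_ofReal hp.le, inv_inv, one_div]

/-- The mixed norm of `|x|^{-γ} f` in logarithmic polar coordinates. -/
theorem mixedNorm_powWeight_eq (hn : 0 < n) {p pt : ℝ} (hp : 0 < p) (hpt : 0 < pt) (γ : ℝ)
    (f : EuclideanSpace ℝ (Fin n) → ℂ) :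
    mixedNorm (ENNReal.ofReal p) (ENNReal.ofReal pt) (powWeight (-γ) f) =
      lpn p⁻¹ volume fun s => ENNReal.ofReal (Real.exp ((n / p - γ) * s)) *
        lpn pt⁻¹ (volume : Measure (EuclideanSpace ℝ (Fin n))).toSphere
          fun ω => ‖f (Real.exp s • ω.1)‖ₑ := by
  set ν := (volume : Measure (EuclideanSpace ℝ (Fin n))).toSphere
  have hn1 : ((n - 1 : ℕ) : ℝ) + 1 = n := by
    rw [Nat.cast_pred hn]; ring
  set Ψ : ℝ → ℝ≥0∞ := fun ρ => lpn pt⁻¹ ν fun ω => ‖powWeight (-γ) f (ρ • ω.1)‖ₑ with hΨ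
  have h1 : mixedNorm (ENNReal.ofReal p) (ENNReal.ofReal pt) (powWeight (-γ) f) =
      (∫⁻ ρ : Ioi (0 : ℝ), Ψ ρ ^ p ∂(Measure.volumeIoiPow (n - 1))) ^ p⁻¹ := by
    rw [mixedNorm, eLpNorm_ofReal_eq_lpn hp, lpn_of_pos (inv_pos.2 hp), inv_inv]
    simp only [eLpNorm_ofReal_eq_lpn hpt, enorm_eq_self]
    rfl
  rw [h1, lintegral_volumeIoiPow (n - 1) (fun ρ => Ψ ρ ^ p), lpn_of_pos (inv_pos.2 hp), inv_inv,
      hn1]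
  congr 1
  refine lintegral_congr fun s => ?_
  have h2 : Ψ (Real.exp s) = ENNReal.ofReal (Real.exp (-γ * s)) *
      lpn pt⁻¹ ν fun ω => ‖f (Real.exp s • ω.1)‖ₑ := by
    rw [hΨ, ← lpn_const_mul _ ENNReal.ofReal_ne_top]
    dsimp only
    congr 1
    ext ω
    have hω : ‖(ω : EuclideanSpace ℝ (Fin n))‖ = 1 := norm_eq_of_mem_sphere ω
    have h3 : ‖((Real.exp (-γ * s) : ℝ) : ℂ)‖ₑ = ENNReal.ofReal (Real.exp (-γ * s)) := by
      have : ∀ x : ℝ, ‖(x : ℂ)‖ₑ = ‖x‖ₑ := fun x => by simp [enorm_eq_nnnorm]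
      rw [this, ← Real.enorm_of_nonneg (Real.exp_pos _).le]
    rw [powWeight, enorm_mul, norm_smul, hω, mul_one, Real.norm_of_nonneg (Real.exp_pos s).le,
      ← Real.exp_mul, mul_comm s, h3]
  rw [h2, ENNReal.mul_rpow_of_nonneg _ _ hp.le, ENNReal.mul_rpow_of_nonneg _ _ hp.le, ← mul_assoc,
    ENNReal.ofReal_rpow_of_pos (Real.exp_pos _), ENNReal.ofReal_rpow_of_pos (Real.exp_pos _),
    ← Real.exp_mul, ← Real.exp_mul, ← ENNReal.ofReal_mul (Real.exp_pos _).le, ← Real.exp_add]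
  congr 3
  field_simp
  ring

end polar

/-! ### Transfer of the Riesz kernel to the cylinder -/

/-- Distances in logarithmic polar coordinates. -/
theorem le_edist_exp_smul {V : Type*} [NormedAddCommGroup V] [NormedSpace ℝ V]
    (θ ω : Metric.sphere (0 : V) 1) (t s : ℝ) :
    ENNReal.ofReal (Real.exp (max t s) / (2 * (1 + |s - t|))) * edist (s, ω) (t, θ) ≤
      edist (Real.exp t • (θ : V)) (Real.exp s • (ω : V)) := by
  have key : ∀ (θ ω : Metric.sphere (0 : V) 1) (t s : ℝ), s ≤ t →
      Real.exp t * max (t - s) (dist θ ω) ≤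
        2 * (1 + (t - s)) * ‖Real.exp t • (θ : V) - Real.exp s • (ω : V)‖ := by
    intro θ ω t s hst
    have hθ : ‖(θ : V)‖ = 1 := norm_eq_of_mem_sphere θ
    have hω : ‖(ω : V)‖ = 1 := norm_eq_of_mem_sphere ω
    set τ := t - s with hτ
    have hτ0 : 0 ≤ τ := by linarith
    set D := ‖Real.exp t • (θ : V) - Real.exp s • (ω : V)‖ with hD
    have hD0 : 0 ≤ D := norm_nonneg _
    have ht := Real.exp_pos t
    have h1 : Real.exp t - Real.exp s ≤ D := by
      have := norm_sub_norm_le (Real.exp t • (θ : V)) (Real.exp s • (ω : V))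
      rwa [norm_smul, norm_smul, hθ, hω, mul_one, mul_one, Real.norm_of_nonneg ht.le,
        Real.norm_of_nonneg (Real.exp_pos s).le] at this
    have hst' : Real.exp s * (1 + τ) ≤ Real.exp t := by
      have h2 : Real.exp t = Real.exp s * Real.exp τ := by rw [← Real.exp_add, hτ]; ring_nf
      have h3 := Real.add_one_le_exp τ
      rw [h2]
      have := Real.exp_pos s
      nlinarith
    -- the radial separation, with `1 - e^{-τ} ≥ τ / (1 + τ)`
    have h2 : Real.exp t * τ ≤ (1 + τ) * D := by nlinarith
    -- the angular separation, after moving both points to the larger radius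
    have h3 : Real.exp t * dist θ ω ≤ 2 * D := by
      have h4 : Real.exp t • ((θ : V) - ω) = (Real.exp t • (θ : V) - Real.exp s • (ω : V)) -
          (Real.exp t - Real.exp s) • (ω : V) := by
        rw [smul_sub, sub_smul]; abel
      have h5 := norm_sub_le (Real.exp t • (θ : V) - Real.exp s • (ω : V))
        ((Real.exp t - Real.exp s) • (ω : V))
      rw [← h4, norm_smul, norm_smul, hω, mul_one, Real.norm_of_nonneg ht.le,
        Real.norm_of_nonneg (sub_nonneg.2 (Real.exp_le_exp.2 hst))] at h5
      rw [Subtype.dist_eq, dist_eq_norm]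
      linarith
    rw [mul_max_of_nonneg _ _ ht.le]
    refine max_le ?_ ?_ <;> nlinarith
  have hmain : Real.exp (max t s) * max |s - t| (dist ω θ) ≤
      2 * (1 + |s - t|) * ‖Real.exp t • (θ : V) - Real.exp s • (ω : V)‖ := by
    rcases le_total s t with h | h
    · rw [max_eq_left h, abs_sub_comm, abs_of_nonneg (sub_nonneg.2 h), dist_comm]
      exact key θ ω t s h
    · rw [max_eq_right h, abs_of_nonneg (sub_nonneg.2 h), norm_sub_rev]
      exact key ω θ s t h
  have h2 : edist (s, ω) (t, θ) = ENNReal.ofReal (max |s - t| (dist ω θ)) := by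
    rw [edist_dist, Prod.dist_eq, Real.dist_eq]
  rw [h2, edist_dist, dist_eq_norm, ← ENNReal.ofReal_mul (by positivity)]
  refine ENNReal.ofReal_le_ofReal ?_
  rw [div_mul_eq_mul_div, div_le_iff₀ (by positivity)]
  linarith

theorem exists_one_add_rpow_le_exp {ε m : ℝ} (hε : 0 < ε) (hm : 0 < m) :
    ∃ C : ℝ, 0 < C ∧ ∀ τ : ℝ, 0 ≤ τ → (1 + τ) ^ m ≤ C * Real.exp (ε * τ) := by
  set δ := min 1 (ε / m) with hδ
  have hδ0 : 0 < δ := by positivity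
  have hδ1 : δ ≤ 1 := min_le_left _ _
  refine ⟨(δ⁻¹) ^ m, by positivity, fun τ hτ => ?_⟩
  have h1 : 1 + τ ≤ δ⁻¹ * Real.exp (δ * τ) := by
    rw [← div_eq_inv_mul, le_div_iff₀ hδ0]
    have := Real.add_one_le_exp (δ * τ)
    nlinarith
  calc (1 + τ) ^ m ≤ (δ⁻¹ * Real.exp (δ * τ)) ^ m := by gcongr
    _ = (δ⁻¹) ^ m * Real.exp (δ * τ * m) := by
        rw [Real.mul_rpow (by positivity) (Real.exp_pos _).le, ← Real.exp_mul]
    _ ≤ (δ⁻¹) ^ m * Real.exp (ε * τ) := by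
        refine mul_le_mul_of_nonneg_left (Real.exp_le_exp.2 ?_) (by positivity)
        have : δ * m ≤ ε := by
          rw [← le_div_iff₀ hm]; exact min_le_right _ _
        calc δ * τ * m = (δ * m) * τ := by ring
          _ ≤ ε * τ := by gcongr

/-- The weights of the two endpoints are dominated by the weight of the larger one, with an
exponential gain in the distance along the axis. -/
theorem exists_exp_add_le {ε₁ ε₂ m : ℝ} (h1 : 0 < ε₁) (h2 : 0 < ε₂) (hm : 0 < m) :
    ∃ C : ℝ, 0 < C ∧ ∀ s t : ℝ, Real.exp (ε₁ * t + ε₂ * s) ≤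
      C * Real.exp (max t s) ^ (ε₁ + ε₂) * (1 + |s - t|) ^ (-m) := by
  obtain ⟨C, hC0, hC⟩ := exists_one_add_rpow_le_exp (lt_min h1 h2) hm
  refine ⟨C, hC0, fun s t => ?_⟩
  have h3 := hC |s - t| (abs_nonneg _)
  rw [Real.rpow_neg (by positivity), ← div_eq_mul_inv, le_div_iff₀ (by positivity), ← Real.exp_mul]
  calc _ ≤ Real.exp (ε₁ * t + ε₂ * s) * (C * Real.exp (min ε₁ ε₂ * |s - t|)) := by gcongr
    _ = C * Real.exp (ε₁ * t + ε₂ * s + min ε₁ ε₂ * |s - t|) := by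
        rw [Real.exp_add (ε₁ * t + ε₂ * s)]; ring
    _ ≤ _ := by
        gcongr
        rcases le_total s t with h | h
        · rw [max_eq_left h, abs_sub_comm, abs_of_nonneg (sub_nonneg.2 h)]
          nlinarith [min_le_right ε₁ ε₂]
        · rw [max_eq_right h, abs_of_nonneg (sub_nonneg.2 h)]
          nlinarith [min_le_left ε₁ ε₂]

/-- Mean value estimate for negative powers. -/
theorem ENNReal.rpow_neg_sub_rpow_neg_le {l : ℝ} (hl : 0 < l) {a b d : ℝ≥0∞} (ha : a ≠ ∞)
    (hb : b ≠ ∞) (hd : d ≠ ∞) (h : b ≤ a + d) :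
    a ^ (-l) - b ^ (-l) ≤ ENNReal.ofReal l * (d * a ^ (-(l + 1))) := by
  rcases le_total b a with hba | hab
  · rw [tsub_eq_zero_of_le (ENNReal.rpow_neg_le_rpow_neg hl.le hba)]
    exact zero_le
  lift a to ℝ≥0 using ha
  lift b to ℝ≥0 using hb
  lift d to ℝ≥0 using hd
  rcases eq_or_ne a 0 with rfl | ha0
  · rcases eq_or_ne d 0 with rfl | hd0
    · have : b = 0 := by simpa using h
      simp [this]
    · rw [ENNReal.coe_zero, ENNReal.zero_rpow_of_neg (by linarith : -(l + 1) < 0),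
        ENNReal.mul_top (by simpa using hd0), ENNReal.mul_top (by simpa using hl)]
      exact le_top
  have ha' : (0 : ℝ) < a := by positivity
  have hab' : (a : ℝ) ≤ b := by exact_mod_cast hab
  have hb' : (0 : ℝ) < b := ha'.trans_le hab'
  have h' : (b : ℝ) ≤ a + d := by exact_mod_cast h
  have hreal : (a : ℝ) ^ (-l) - (b : ℝ) ^ (-l) ≤ l * (d * (a : ℝ) ^ (-(l + 1))) := by
    have e1 : (b : ℝ) ^ (-l) = (a : ℝ) ^ (-l) * Real.exp (-(l * Real.log (b / a))) := by
      rw [Real.rpow_def_of_pos hb', Real.rpow_def_of_pos ha', ← Real.exp_add,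
        Real.log_div hb'.ne' ha'.ne']
      congr 1; ring
    have e2 : 1 - l * (b / a - 1) ≤ Real.exp (-(l * Real.log (b / a))) := by
      have h1 := Real.add_one_le_exp (-(l * Real.log (b / a)))
      have h2 := Real.log_le_sub_one_of_pos (div_pos hb' ha')
      nlinarith
    have e3 : (a : ℝ) ^ (-(l + 1)) = (a : ℝ) ^ (-l) / a := by
      rw [neg_add, ← sub_eq_add_neg, Real.rpow_sub_one ha'.ne']
    have e4 : (b : ℝ) / a - 1 ≤ d / a := by
      rw [← sub_nonneg]
      have : (d : ℝ) / a - (b / a - 1) = (a + d - b) / a := by field_simp; ring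
      rw [this]
      exact div_nonneg (by linarith) ha'.le
    have e5 : 0 < (a : ℝ) ^ (-l) := by positivity
    have e6 : 1 - Real.exp (-(l * Real.log (b / a))) ≤ l * (d / a) := by nlinarith
    calc _ = (a : ℝ) ^ (-l) * (1 - Real.exp (-(l * Real.log (b / a)))) := by rw [e1]; ring
      _ ≤ (a : ℝ) ^ (-l) * (l * (d / a)) := by gcongr
      _ = _ := by rw [e3]; ring
  have hc : ∀ (x : ℝ≥0) (y : ℝ), 0 < (x : ℝ) → (x : ℝ≥0∞) ^ y = ENNReal.ofReal ((x : ℝ) ^ y) :=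
    fun x y hx => by rw [← ENNReal.ofReal_rpow_of_pos hx, ENNReal.ofReal_coe_nnreal]
  rw [hc a _ ha', hc b _ hb', hc a _ ha', ← ENNReal.ofReal_sub _ (by positivity),
    ← ENNReal.ofReal_coe_nnreal (p := d), ← ENNReal.ofReal_mul (by positivity),
    ← ENNReal.ofReal_mul hl.le]
  exact ENNReal.ofReal_le_ofReal hreal

section transfer

variable {V : Type*} [NormedAddCommGroup V] [NormedSpace ℝ V]

/-- Negative powers of distances in logarithmic polar coordinates. -/
theorem edist_exp_smul_rpow_neg_le {l : ℝ} (hl : 0 ≤ l) (θ ω : Metric.sphere (0 : V) 1) (t s : ℝ) :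
    edist (Real.exp t • (θ : V)) (Real.exp s • (ω : V)) ^ (-l) ≤
      ENNReal.ofReal (2 ^ l * Real.exp (max t s) ^ (-l) * (1 + |s - t|) ^ l) *
        edist (s, ω) (t, θ) ^ (-l) := by
  refine (ENNReal.rpow_neg_le_rpow_neg hl (le_edist_exp_smul θ ω t s)).trans_eq ?_
  rw [ENNReal.mul_rpow_of_ne_top ENNReal.ofReal_ne_top (edist_ne_top _ _),
    ENNReal.ofReal_rpow_of_pos (by positivity), Real.div_rpow (by positivity) (by positivity),
    Real.mul_rpow (by positivity) (by positivity), Real.rpow_neg (by positivity : 0 ≤ 1 + |s - t|),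
    Real.rpow_neg zero_le_two]
  congr 2
  field_simp

/-- The Riesz kernel with its weights, in logarithmic polar coordinates. -/
theorem exists_weight_mul_edist_le {ε₁ ε₂ l : ℝ} (h1 : 0 < ε₁) (h2 : 0 < ε₂) (hl : l = ε₁ + ε₂) :
    ∃ C : ℝ≥0, ∀ (θ ω : Metric.sphere (0 : V) 1) (t s : ℝ),
      ENNReal.ofReal (Real.exp (ε₁ * t + ε₂ * s)) *
          edist (Real.exp t • (θ : V)) (Real.exp s • (ω : V)) ^ (-l) ≤
        C * ((1 + edist s t) ^ (-2 : ℝ) * edist (s, ω) (t, θ) ^ (-l)) ∧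
      ENNReal.ofReal (Real.exp (ε₁ * t + ε₂ * s)) * (ENNReal.ofReal (Real.exp t) *
          edist (Real.exp t • (θ : V)) (Real.exp s • (ω : V)) ^ (-(l + 1))) ≤
        C * edist (s, ω) (t, θ) ^ (-(l + 1)) := by
  have hl0 : 0 < l := by linarith
  obtain ⟨C, hC0, hC⟩ := exists_exp_add_le h1 h2 (by linarith : 0 < l + 2)
  rw [← hl] at hC
  refine ⟨(C * 2 ^ (l + 1)).toNNReal, fun θ ω t s => ?_⟩
  set M := Real.exp (max t s) with hM
  have hM0 : 0 < M := Real.exp_pos _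
  set τ := 1 + |s - t| with hτ
  have hτ1 : 1 ≤ τ := by rw [hτ]; linarith [abs_nonneg (s - t)]
  have hτ0 : 0 < τ := by linarith
  have h2l : (2 : ℝ) ^ l ≤ 2 ^ (l + 1) := Real.rpow_le_rpow_of_exponent_le one_le_two (by linarith)
  constructor
  · have e1 : 1 + edist s t = ENNReal.ofReal τ := by
      rw [edist_dist, Real.dist_eq, hτ, ENNReal.ofReal_add zero_le_one (abs_nonneg _),
        ENNReal.ofReal_one]
    calc _ ≤ ENNReal.ofReal (C * M ^ l * τ ^ (-(l + 2))) *
          (ENNReal.ofReal (2 ^ l * M ^ (-l) * τ ^ l) * edist (s, ω) (t, θ) ^ (-l)) := by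
          gcongr
          · exact hC s t
          · exact edist_exp_smul_rpow_neg_le hl0.le θ ω t s
      _ = ENNReal.ofReal ((C * M ^ l * τ ^ (-(l + 2))) * (2 ^ l * M ^ (-l) * τ ^ l)) *
            edist (s, ω) (t, θ) ^ (-l) := by
          rw [← mul_assoc, ← ENNReal.ofReal_mul (by positivity)]
      _ ≤ ENNReal.ofReal (C * 2 ^ (l + 1) * τ ^ (-2 : ℝ)) * edist (s, ω) (t, θ) ^ (-l) := by
          refine mul_le_mul' (ENNReal.ofReal_le_ofReal ?_) le_rfl
          have e2 : M ^ l * M ^ (-l) = 1 := by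
            rw [← Real.rpow_add hM0, add_neg_cancel, Real.rpow_zero]
          have e3 : τ ^ (-(l + 2)) * τ ^ l = τ ^ (-2 : ℝ) := by
            rw [← Real.rpow_add hτ0]; congr 1; ring
          calc _ = C * 2 ^ l * (M ^ l * M ^ (-l)) * (τ ^ (-(l + 2)) * τ ^ l) := by ring
            _ = C * 2 ^ l * τ ^ (-2 : ℝ) := by rw [e2, e3, mul_one]
            _ ≤ _ := by gcongr
      _ = _ := by
          rw [ENNReal.ofReal_mul (by positivity), e1, ENNReal.ofReal_rpow_of_pos hτ0, mul_assoc]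
          rfl
  · calc _ ≤ ENNReal.ofReal (C * M ^ l * τ ^ (-(l + 2))) * (ENNReal.ofReal M *
          (ENNReal.ofReal (2 ^ (l + 1) * M ^ (-(l + 1)) * τ ^ (l + 1)) *
            edist (s, ω) (t, θ) ^ (-(l + 1)))) := by
          gcongr
          · exact hC s t
          · rw [hM]; exact Real.exp_le_exp.2 (le_max_left _ _)
          · exact edist_exp_smul_rpow_neg_le (by linarith) θ ω t s
      _ = ENNReal.ofReal ((C * M ^ l * τ ^ (-(l + 2))) * (M *
            (2 ^ (l + 1) * M ^ (-(l + 1)) * τ ^ (l + 1)))) * edist (s, ω) (t, θ) ^ (-(l + 1)) := by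
          rw [← mul_assoc (ENNReal.ofReal M), ← mul_assoc, ← ENNReal.ofReal_mul hM0.le,
            ← ENNReal.ofReal_mul (by positivity)]
      _ ≤ _ := by
          refine mul_le_mul' (ENNReal.ofReal_le_ofReal ?_) le_rfl
          have e2 : M ^ l * M * M ^ (-(l + 1)) = 1 := by
            rw [← Real.rpow_add_one hM0.ne', ← Real.rpow_add hM0, add_neg_cancel, Real.rpow_zero]
          have e3 : τ ^ (-(l + 2)) * τ ^ (l + 1) ≤ 1 := by
            rw [← Real.rpow_add hτ0]
            exact Real.rpow_le_one_of_one_le_of_nonpos hτ1 (by linarith)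
          calc _ = C * 2 ^ (l + 1) * (M ^ l * M * M ^ (-(l + 1))) *
                (τ ^ (-(l + 2)) * τ ^ (l + 1)) := by
                ring
            _ ≤ C * 2 ^ (l + 1) * 1 * 1 := by rw [e2]; gcongr
            _ = _ := by ring

end transfer

section cylBounds

variable {n : ℕ}

/-- A pointwise bound for a weighted kernel in logarithmic polar coordinates transfers to the
integrals. The weight `e^{ns}` of the coordinates is split as `e^{ε₂ s} e^{κ s}` between the kernel
and the density. -/
theorem exp_mul_lintegral_le (hn : 0 < n) {ε₁ ε₂ κ : ℝ} (hκ : n = ε₂ + κ) (C₀ C : ℝ≥0)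
    {f : EuclideanSpace ℝ (Fin n) → ℂ} (hf : Measurable f) {k : EuclideanSpace ℝ (Fin n) → ℝ≥0∞}
    (hk : Measurable k) (t : ℝ)
    {K : ℝ → Metric.sphere (0 : EuclideanSpace ℝ (Fin n)) 1 → ℝ≥0∞}
    (h : ∀ s ω, ENNReal.ofReal (Real.exp (ε₁ * t + ε₂ * s)) * k (Real.exp s • ω.1) ≤ C * K s ω) :
    ENNReal.ofReal (Real.exp (ε₁ * t)) * (C₀ * ∫⁻ y, k y * ‖f y‖ₑ) ≤
      ∫⁻ s, ∫⁻ ω, K s ω * (C₀ * C * (ENNReal.ofReal (Real.exp (κ * s)) * ‖f (Real.exp s • ω.1)‖ₑ))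
        ∂(volume : Measure (EuclideanSpace ℝ (Fin n))).toSphere := by
  have hm : Measurable fun y => k y * ‖f y‖ₑ := hk.mul hf.enorm
  rw [lintegral_eq_lintegral_exp_smul hn hm, ← mul_assoc,
    ← lintegral_const_mul' _ _ (ENNReal.mul_ne_top ENNReal.ofReal_ne_top ENNReal.coe_ne_top)]
  refine lintegral_mono fun s => ?_
  rw [← lintegral_const_mul' _ _ (ENNReal.mul_ne_top ENNReal.ofReal_ne_top ENNReal.coe_ne_top)]
  refine lintegral_mono fun ω => ?_
  have e : ENNReal.ofReal (Real.exp (ε₁ * t)) * ENNReal.ofReal (Real.exp (n * s)) =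
      ENNReal.ofReal (Real.exp (ε₁ * t + ε₂ * s)) * ENNReal.ofReal (Real.exp (κ * s)) := by
    rw [← ENNReal.ofReal_mul (Real.exp_pos _).le, ← ENNReal.ofReal_mul (Real.exp_pos _).le,
      ← Real.exp_add, ← Real.exp_add, hκ]
    congr 2
    ring
  calc _ = C₀ * (ENNReal.ofReal (Real.exp (ε₁ * t)) * ENNReal.ofReal (Real.exp (n * s))) *
        (k (Real.exp s • ω.1) * ‖f (Real.exp s • ω.1)‖ₑ) := by ring
    _ = C₀ * (ENNReal.ofReal (Real.exp (ε₁ * t + ε₂ * s)) * k (Real.exp s • ω.1)) *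
        (ENNReal.ofReal (Real.exp (κ * s)) * ‖f (Real.exp s • ω.1)‖ₑ) := by rw [e]; ring
    _ ≤ C₀ * (C * K s ω) * (ENNReal.ofReal (Real.exp (κ * s)) * ‖f (Real.exp s • ω.1)‖ₑ) := by
        exact mul_le_mul' (mul_le_mul' le_rfl (h s ω)) le_rfl
    _ = _ := by ring

/-- In logarithmic polar coordinates a Schwartz function is a potential on the cylinder of its
fractional derivative, both taken with their power weights. -/
theorem exists_cylPotDecay_bounds (hn : 0 < n) {σ κ : ℝ} (hσ : 0 < σ) (hσκ : σ < κ) (hκn : κ < n) :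
    ∃ C : ℝ≥0, ∀ u : 𝓢(EuclideanSpace ℝ (Fin n), ℂ),
      ∃ g U : ℝ × Metric.sphere (0 : EuclideanSpace ℝ (Fin n)) 1 → ℝ≥0∞,
      (∀ t θ, g (t, θ) = C * (ENNReal.ofReal (Real.exp (κ * t)) *
        ‖fracDeriv σ u (Real.exp t • θ.1)‖ₑ)) ∧
      (∀ t θ, U (t, θ) = ENNReal.ofReal (Real.exp ((κ - σ) * t)) * ‖u (Real.exp t • θ.1)‖ₑ) ∧
      Measurable g ∧ Measurable U ∧
      (∀ z, U z ≤ cylPotDecay (volume : Measure (EuclideanSpace ℝ (Fin n))).toSphere (n - σ) g z) ∧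
      SliceDiffBound (volume : Measure (EuclideanSpace ℝ (Fin n))).toSphere (n - σ) g U := by
  obtain ⟨C₀, hC₀⟩ := exists_enorm_le_lintegral_fracDeriv n hσ (hσκ.trans hκn)
  set l : ℝ := n - σ with hl
  have hl0 : 0 < l := by linarith
  obtain ⟨C, hC⟩ := exists_weight_mul_edist_le (V := EuclideanSpace ℝ (Fin n))
    (sub_pos.2 hσκ) (sub_pos.2 hκn) (l := l) (by rw [hl]; ring)
  set L : ℝ≥0 := l.toNNReal with hL
  have hLe : ENNReal.ofReal l = L := rfl
  set D : ℝ≥0 := C * (1 + L) with hD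
  have hCD : (C : ℝ≥0∞) ≤ D := by
    rw [hD]; exact_mod_cast le_mul_of_one_le_right' (le_add_of_nonneg_right zero_le)
  have hLD : (L : ℝ≥0∞) * C ≤ D := by
    rw [hD, ← ENNReal.coe_mul, mul_comm]
    exact_mod_cast mul_le_mul' le_rfl (le_add_of_nonneg_left zero_le)
  have hexp : Measurable fun z : ℝ × Metric.sphere (0 : EuclideanSpace ℝ (Fin n)) 1 =>
      Real.exp z.1 • z.2.1 := by fun_prop
  refine ⟨C₀ * D, fun u => ?_⟩
  obtain ⟨hu1, hu2⟩ := hC₀ u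
  have hf : Measurable (fracDeriv σ u) := (continuous_fracDeriv hσ u).measurable
  have hum : Measurable u := u.continuous.measurable
  have hw : ∀ b : ℝ, Measurable fun z : ℝ × Metric.sphere (0 : EuclideanSpace ℝ (Fin n)) 1 =>
      ENNReal.ofReal (Real.exp (b * z.1)) := fun b => by fun_prop
  have hkm : ∀ x : EuclideanSpace ℝ (Fin n), Measurable fun y => edist x y ^ (-l) :=
    fun x => (measurable_edist_right).pow_const _
  refine ⟨fun z => (C₀ * D : ℝ≥0) * (ENNReal.ofReal (Real.exp (κ * z.1)) *
      ‖fracDeriv σ u (Real.exp z.1 • z.2.1)‖ₑ),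
    fun z => ENNReal.ofReal (Real.exp ((κ - σ) * z.1)) * ‖u (Real.exp z.1 • z.2.1)‖ₑ,
    fun _ _ => rfl, fun _ _ => rfl, ((hw κ).mul (hf.comp hexp).enorm).const_mul _,
    (hw _).mul (hum.comp hexp).enorm, fun z => ?_, fun t θ θ' => ?_⟩
  · obtain ⟨t, θ⟩ := z
    refine (mul_le_mul' le_rfl (hu1 _)).trans ?_
    simp only [ENNReal.coe_mul]
    refine exp_mul_lintegral_le hn (ε₂ := n - κ) (by ring) C₀ D hf (hkm _) t fun s ω => ?_
    exact (hC θ ω t s).1.trans (mul_le_mul' hCD le_rfl)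
  · dsimp only
    set x := Real.exp t • θ.1 with hx
    set z := Real.exp t • θ'.1 with hz
    -- the radii agree, so the increment of `U` is the weighted increment of `u` along a sphere
    have hux : ‖u x‖ₑ ≤ ‖u z‖ₑ + ‖u x - u z‖ₑ := by
      simpa using enorm_add_le (u z) (u x - u z)
    refine (mul_le_mul' le_rfl hux).trans ?_
    rw [mul_add]
    refine add_le_add le_rfl ((mul_le_mul' le_rfl (hu2 x z)).trans ?_)
    simp only [ENNReal.coe_mul]
    refine exp_mul_lintegral_le hn (ε₂ := n - κ) (by ring) C₀ D hf
      (((hkm _).sub (hkm _)).add ((hkm _).sub (hkm _))) t fun s ω => ?_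
    -- one of the two truncated differences of Riesz kernels, by the triangle inequality in `e^t θ`
    have hone : ∀ θ θ' : Metric.sphere (0 : EuclideanSpace ℝ (Fin n)) 1,
        ENNReal.ofReal (Real.exp ((κ - σ) * t + (n - κ) * s)) *
          (edist (Real.exp t • θ.1) (Real.exp s • ω.1) ^ (-l) -
            edist (Real.exp t • θ'.1) (Real.exp s • ω.1) ^ (-l)) ≤
        D * min (edist (s, ω) (t, θ) ^ (-l)) (edist θ θ' * edist (s, ω) (t, θ) ^ (-(l + 1))) := by
      intro θ θ'
      refine (le_min ?_ ?_).trans_eq (Monotone.map_min (f := fun x => (D : ℝ≥0∞) * x)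
        fun _ _ h => mul_le_mul' le_rfl h).symm
      · refine (mul_le_mul' le_rfl tsub_le_self).trans ((hC θ ω t s).1.trans
          (mul_le_mul' hCD ?_))
        refine mul_le_of_le_one_left' (ENNReal.rpow_le_one_of_one_le_of_neg ?_ (by norm_num))
        exact le_add_of_nonneg_right zero_le
      · have hd : edist (Real.exp t • θ'.1) (Real.exp s • ω.1) ≤
            edist (Real.exp t • θ.1) (Real.exp s • ω.1) +
              ENNReal.ofReal (Real.exp t) * edist θ θ' := by
          refine (edist_triangle_left _ _ (Real.exp t • θ.1)).trans ?_
          rw [add_comm]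
          refine add_le_add le_rfl (le_of_eq ?_)
          rw [edist_smul₀, ENNReal.smul_def, smul_eq_mul,
              ← Real.enorm_of_nonneg (Real.exp_pos t).le]
          rfl
        calc _ ≤ ENNReal.ofReal (Real.exp ((κ - σ) * t + (n - κ) * s)) * (L *
              (ENNReal.ofReal (Real.exp t) * edist θ θ' *
                edist (Real.exp t • θ.1) (Real.exp s • ω.1) ^ (-(l + 1)))) :=
              mul_le_mul' le_rfl (ENNReal.rpow_neg_sub_rpow_neg_le hl0 (edist_ne_top _ _)
                (edist_ne_top _ _) (ENNReal.mul_ne_top ENNReal.ofReal_ne_top (edist_ne_top _ _)) hd)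
          _ = L * edist θ θ' * (ENNReal.ofReal (Real.exp ((κ - σ) * t + (n - κ) * s)) *
              (ENNReal.ofReal (Real.exp t) *
                edist (Real.exp t • θ.1) (Real.exp s • ω.1) ^ (-(l + 1)))) := by ring
          _ ≤ L * edist θ θ' * (C * edist (s, ω) (t, θ) ^ (-(l + 1))) :=
              mul_le_mul' le_rfl (hC θ ω t s).2
          _ = L * C * (edist θ θ' * edist (s, ω) (t, θ) ^ (-(l + 1))) := by ring
          _ ≤ _ := mul_le_mul' hLD le_rfl
    rw [Pi.add_apply, Pi.sub_apply, Pi.sub_apply, mul_add]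
    refine (add_le_add (hone θ θ') (hone θ' θ)).trans ?_
    rw [← mul_add, edist_comm θ' θ]
    refine mul_le_mul' le_rfl (le_min (add_le_add (min_le_left _ _) (min_le_left _ _)) ?_)
    rw [mul_add]
    exact add_le_add (min_le_right _ _) (min_le_right _ _)

end cylBounds

/-! ### The weighted interpolation inequality -/

theorem theorem1p7 (n : ℕ) (hn : 2 ≤ n)
    (r rt p pt q qt a σ α β γ Δ Δt : ℝ)
    (hr : 1 ≤ r) (hrt : 1 ≤ rt) (hp : 1 ≤ p) (hpt : 1 ≤ pt) (hq : 1 ≤ q) (hqt : 1 ≤ qt)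
    (ha0 : 0 < a) (ha1 : a ≤ 1) (hσ0 : 0 < σ) (hσn : σ < n)
    (hγ : γ < n / r) (hβ : β < n / q) (hα₁ : n / p - n < α) (hα₂ : α < n / p - σ)
    (hscal : γ - n / r = a * (α + σ - n / p) + (1 - a) * (β - n / q))
    (hΔ : Δ = a * σ + n * (1 / r - (1 - a) / q - a / p))
    (hΔt : Δt = a * σ + n * (1 / rt - (1 - a) / qt - a / pt))
    (hrange :
      (0 ≤ Δ + (n - 1) * Δt ∧ 1 < p ∧
        a * (σ - n / p) < Δ ∧ Δ ≤ a * σ ∧ a * (σ - n / pt) ≤ Δt ∧ Δt ≤ a * σ) ∨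
      (0 < Δ + (n - 1) * Δt ∧
        a * (σ - n / p) ≤ Δ ∧ Δ ≤ a * σ ∧ a * (σ - n / pt) ≤ Δt ∧ Δt ≤ a * σ))
    (hcorner : ¬ (Δ + (n - 1) * Δt = 0 ∧ Δ = a * σ ∧ pt = 1 ∧ 1 / rt = 1 - σ / (n - 1))) :
    ∃ C : ℝ≥0, ∀ u : 𝓢(EuclideanSpace ℝ (Fin n), ℂ),
      mixedNorm (ENNReal.ofReal r) (ENNReal.ofReal rt) (powWeight (-γ) u) ≤
        C * mixedNorm (ENNReal.ofReal p) (ENNReal.ofReal pt) (powWeight (-α) (fracDeriv σ u)) ^ a *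
          mixedNorm (ENNReal.ofReal q) (ENNReal.ofReal qt) (powWeight (-β) u) ^ (1 - a) := by
  have hn0 : 0 < n := by omega
  have hn2 : (2 : ℝ) ≤ n := by exact_mod_cast hn
  have : Nonempty (Fin n) := ⟨⟨0, hn0⟩⟩
  have hp0 : 0 < p := by linarith
  have hpt0 : 0 < pt := by linarith
  have hq0 : 0 < q := by linarith
  have hqt0 : 0 < qt := by linarith
  have hr0 : 0 < r := by linarith
  have hrt0 : 0 < rt := by linarith
  obtain ⟨A, hA, hν⟩ :=
    exists_upperRegular_toSphere (volume : Measure (EuclideanSpace ℝ (Fin n)))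
  obtain ⟨c, hc, hlow⟩ :=
    exists_le_toSphere_ball (volume : Measure (EuclideanSpace ℝ (Fin n)))
  rw [finrank_euclideanSpace_fin] at hν hlow
  set ν := (volume : Measure (EuclideanSpace ℝ (Fin n))).toSphere
  -- the exponents of the potential part, determined by `1 / r = a * θs + (1 - a) / q`
  set θs := (r⁻¹ - (1 - a) * q⁻¹) / a with hθs
  set θst := (rt⁻¹ - (1 - a) * qt⁻¹) / a with hθst
  have er : a * θs + (1 - a) * q⁻¹ = r⁻¹ := by rw [hθs]; field_simp; ring
  have ert : a * θst + (1 - a) * qt⁻¹ = rt⁻¹ := by rw [hθst]; field_simp; ring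
  have eΔ : Δ = a * σ + n * a * (θs - p⁻¹) := by
    rw [hΔ, one_div, ← er]; ring
  have eΔt : Δt = a * σ + n * a * (θst - pt⁻¹) := by
    rw [hΔt, one_div, ← ert]; ring
  have hna : 0 < n * a := by positivity
  have lo : ∀ {θ θ' D : ℝ}, D = a * σ + n * a * (θ - θ'⁻¹) → a * (σ - n / θ') ≤ D → 0 ≤ θ := by
    intro θ θ' D h1 h2
    refine nonneg_of_mul_nonneg_right ?_ hna
    rw [h1, div_eq_mul_inv] at h2
    linarith
  have up : ∀ {θ θ' D : ℝ}, D = a * σ + n * a * (θ - θ'⁻¹) → D ≤ a * σ → θ ≤ θ'⁻¹ := by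
    intro θ θ' D h1 h2
    rw [← sub_nonpos]
    refine nonpos_of_mul_nonpos_right ?_ hna
    linarith
  have esum : Δ + (n - 1) * Δt =
      n * a * ((n - 1) * (1 + θst - pt⁻¹) + (1 + θs - p⁻¹) - (n - σ)) := by
    rw [eΔ, eΔt]; ring
  have hbd : a * (σ - n / p) ≤ Δ ∧ Δ ≤ a * σ ∧ a * (σ - n / pt) ≤ Δt ∧ Δt ≤ a * σ := by
    rcases hrange with ⟨-, -, h1, h2⟩ | ⟨-, h1⟩
    · exact ⟨h1.le, h2⟩
    · exact h1
  obtain ⟨hd1, hd2, hd3, hd4⟩ := hbd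
  have hl : (p⁻¹ < 1 ∧ 0 < θs ∧ n - σ ≤ (n - 1) * (1 + θst - pt⁻¹) + (1 + θs - p⁻¹)) ∨
      n - σ < (n - 1) * (1 + θst - pt⁻¹) + (1 + θs - p⁻¹) := by
    rw [esum] at hrange
    rcases hrange with ⟨h1, h2, h3, -⟩ | ⟨h1, -⟩
    · refine Or.inl ⟨inv_lt_one_of_one_lt₀ h2, ?_, ?_⟩
      · refine pos_of_mul_pos_right (b := θs) ?_ hna.le
        rw [eΔ, div_eq_mul_inv] at h3
        linarith
      · exact sub_nonneg.1 (nonneg_of_mul_nonneg_right h1 hna)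
    · exact Or.inr (sub_pos.1 (pos_of_mul_pos_right h1 hna.le))
  have hcorner' : ¬ (n - σ = (n - 1) * (1 + θst - pt⁻¹) + (1 + θs - p⁻¹) ∧ θs = p⁻¹ ∧ pt⁻¹ = 1 ∧
      θst = a * θst + (1 - a) * qt⁻¹) := by
    rintro ⟨h1, h2, h3, h4⟩
    refine hcorner ⟨by rw [esum, ← h1, sub_self, mul_zero], by rw [eΔ, h2]; ring,
      inv_eq_one.1 h3, ?_⟩
    rw [one_div, ← ert, ← h4]
    rw [h2, h3] at h1
    have hn1 : (n : ℝ) - 1 ≠ 0 := by linarith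
    field_simp
    linarith
  obtain ⟨C₁, hC₁⟩ := exists_lpn_lpn_interpolation hν (by linarith) hA dist_sphere_lt_three hc hlow
    ha0 ha1 (inv_pos.2 hp0) (inv_le_one_of_one_le₀ hp) (lo eΔ hd1) (up eΔ hd2) (inv_pos.2 hpt0)
    (inv_le_one_of_one_le₀ hpt) (lo eΔt hd3) (up eΔt hd4) (inv_pos.2 hq0) (inv_pos.2 hqt0)
    (inv_le_one_of_one_le₀ hqt) (by rw [er]; positivity) (by rw [ert]; positivity)
    (sub_pos.2 hσn) (by linarith) hl hcorner'
  rw [er, ert] at hC₁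
  set κ := n / p - α with hκ
  obtain ⟨C₂, hC₂⟩ := exists_cylPotDecay_bounds (κ := κ) hn0 hσ0 (by linarith) (by linarith)
  refine ⟨C₁ * C₂ ^ a, fun u => ?_⟩
  obtain ⟨g, U, hg, hU, hgm, hUm, h1, h2⟩ := hC₂ u
  -- the axial weight that turns the weight of `U` into the one of the interpolating norm
  set b := n / q - β - (κ - σ) with hb
  have key := hC₁ g U hgm hUm h1 h2 (fun t => ENNReal.ofReal (Real.exp (b * t))) (by fun_prop)
  have hUn : ∀ θ t, lpn θ ν (fun x => U (t, x)) = ENNReal.ofReal (Real.exp ((κ - σ) * t)) *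
      lpn θ ν fun ω => ‖u (Real.exp t • ω.1)‖ₑ := fun θ t => by
    simp_rw [hU]
    exact lpn_const_mul _ ENNReal.ofReal_ne_top _
  have hgn : ∀ t, lpn pt⁻¹ ν (fun x => g (t, x)) = C₂ * (ENNReal.ofReal (Real.exp (κ * t)) *
      lpn pt⁻¹ ν fun ω => ‖fracDeriv σ u (Real.exp t • ω.1)‖ₑ) := fun t => by
    simp_rw [hg]
    rw [lpn_const_mul _ ENNReal.coe_ne_top, lpn_const_mul _ ENNReal.ofReal_ne_top]
  have e1 : ∀ t, ENNReal.ofReal (Real.exp (b * t)) ^ (1 - a) *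
      ENNReal.ofReal (Real.exp ((κ - σ) * t)) = ENNReal.ofReal (Real.exp ((n / r - γ) * t)) := by
    intro t
    rw [ENNReal.ofReal_rpow_of_pos (Real.exp_pos _), ← Real.exp_mul,
      ← ENNReal.ofReal_mul (Real.exp_pos _).le, ← Real.exp_add]
    congr 2
    linear_combination t * hscal
  have e2 : ∀ t, ENNReal.ofReal (Real.exp (b * t)) * ENNReal.ofReal (Real.exp ((κ - σ) * t)) =
      ENNReal.ofReal (Real.exp ((n / q - β) * t)) := by
    intro t
    rw [← ENNReal.ofReal_mul (Real.exp_pos _).le, ← Real.exp_add]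
    congr 2
    ring
  simp_rw [hUn, hgn, ← mul_assoc, e1, e2, mul_assoc] at key
  rw [lpn_const_mul _ ENNReal.coe_ne_top, ENNReal.mul_rpow_of_nonneg _ _ ha0.le] at key
  rw [mixedNorm_powWeight_eq hn0 hr0 hrt0, mixedNorm_powWeight_eq hn0 hp0 hpt0,
    mixedNorm_powWeight_eq hn0 hq0 hqt0]
  refine key.trans_eq ?_
  rw [ENNReal.coe_mul, ENNReal.coe_rpow_of_nonneg _ ha0.le]
  ring
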